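/- Let $\mathbf w=(w_k)_{k\ge 0}$ be a sequence of non-negative real numbers with $w_0>0$ and $w_k>0$ for some $k\ge 2$. Let $\Phi(t)=\sum_{k\ge0} w_kt^k$, let $\rho\in[0,\infty]$ be its radius of convergence, and let $\Psi(t)=t\Phi'(t)/\Phi(t)=\sum_k kw_kt^k\big/\sum_k w_kt^k$. Put $\nu=\Psi(\rho)\in[0,\infty]$, interpreted as $\lim_{t\uparrow\rho}\Psi(t)=\sup_{0\le t<\rho}\Psi(t)$ if $\Phi(\rho)=\infty$. Assume that $\nu<1$, and let $\pi_k=\rho^kw_k/\Phi(\rho)$, $k\ge0$; this is a probability distribution with mean $\mu=\nu<1$. *Trees.* The Ulam--Harris tree has as its node set $V_\infty$ the set of all finite strings of positive integers; the root is the empty string, and the children of $v$ are $v1,v2,\dots$, in this order. Ordered rooted trees $T$ (finite or infinite, possibly with infinite outdegrees) are identified with subsets of $V_\infty$ that contain the root, contain the parent of each of their nodes, and contain $vj$ whenever they contain $vi$ and $j\le i$. Let $d^+_T(v)\in\{0,1,\dots,\infty\}$ be the outdegree of $v$ in $T$, with $d^+_T(v)=0$ if $v\notin T$. Let $\mathcal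 T_n$ be the random ordered rooted tree with $n$ nodes such that $\mathbb P(\mathcal T_n=T)=Z_n^{-1}\prod_{v\in T}w_{d^+_T(v)}$, where $Z_n$ is the normalizing constant. Only those $n$ with $Z_n>0$ are considered, and all limits are as $n\to\infty$ through such $n$. *Boxes.* Let $(Y_1,\dots,Y_n)$ be the random element of $\{y\in\mathbb Z_{\ge0}^n:\sum_i y_i=n-1\}$ that takes the value $y$ with probability proportional to $\prod_{i=1}^n w_{y_i}$, and let $N_k=|\{i:Y_i=k\}|$. Call a real sequence $(\Omega_n)$ a *threshold sequence* if $\Omega_n\to\infty$ and, for every sequence $K_n\to\infty$ with $K_n\le\Omega_n$ for all $n$, $$\sum_{k\le K_n}kN_k=\nu n+o_p(n)\qquad\text{and}\qquad \sum_{k>K_n}kN_k=(1-\nu)n+o_p(n).$$ Given a threshold sequence, let $Y^{**}=Y^{**}_n$ be a random variable with the size-biased distribution of $(Y_1\mid Y_1>\Omega_n)$, that is, $\mathbb P(Y^{**}=k)=k\,\mathbb P(Y_1=k)\big/\sum_{l>\Omega_n}l\,\mathbb P(Y_1=l)$ for $k>\Omega_n$, and $\mathbb P(Y^{**}=k)=0$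 otherwise (this is defined for all large $n$). *The limit tree.* Let $\widehat{\mathcal T}$ be the random tree in which every node is either normal or special, the root being special, and all random choices are independent. A normal node has $k$ children with probability $\pi_k$, all of them normal. A special node has $k$ children with probability $k\pi_k$ for $0\le k<\infty$, and infinitely many children with probability $1-\mu$; in the first case one of its children, chosen uniformly at random, is special and the others are normal, and in the second case all its children are normal. Almost surely $\widehat{\mathcal T}$ has exactly one node of infinite outdegree. Let $Y^{**}$ be independent of $\widehat{\mathcal T}$, and define $d^{++}_{\widehat{\mathcal T}}(v)=d^+_{\widehat{\mathcal T}}(v)$ if $d^+_{\widehat{\mathcal T}}(v)<\infty$, and $d^{++}_{\widehat{\mathcal T}}(v)=Y^{**}$ if $d^+_{\widehat{\mathcal T}}(v)=\infty$. **Theorem.** Threshold sequences exist. For every threshold sequence $(\Omega_n)$ and all nodes $v_1,\dots,v_\ell\in V_\infty$ (not depending on $n$), there are couplings of the random vectors $$\bigl(d^+_{\mathcal T_n}(v_1),\dots,d^+_{\mathcal T_n}(v_\ell)\bigr)\qquad\text{and}\qquad\bigl(d^{++}_{\widehat{\mathcal T}}(v_1),\dots,d^{++}_{\widehat{\mathcal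 T}}(v_\ell)\bigr)$$ such that the two vectors are equal with probability tending to $1$ as $n\to\infty$. -/

import Mathlib

open Filter Topology MeasureTheory
open scoped ENNReal NNReal

noncomputable section

namespace SimplyGenerated

/-- The probability distribution on `α` proportional to the masses `f`, i.e.
`a ↦ f a / ∑' b, f b`. If the total mass is `0` or `∞`, there is no such distribution, and the
value is the point mass at `a₀`. -/
def proportionalTo {α : Type*} (f : α → ℝ≥0∞) (a₀ : α) : PMF α :=
  open Classical in
  if h : tsum f ≠ 0 ∧ tsum f ≠ ∞ then PMF.normalize f h.1 h.2 else PMF.pure a₀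

/-! ### Weight sequences -/

/-- The generating function `Φ(t) = ∑ w_k t^k`, for `t ∈ [0, ∞]`, with values in `[0, ∞]`. -/
def Phi (w : ℕ → ℝ≥0) (t : ℝ≥0∞) : ℝ≥0∞ := ∑' k : ℕ, (w k : ℝ≥0∞) * t ^ k

/-- `Ψ(t) = t Φ'(t) / Φ(t) = (∑ k w_k t^k) / (∑ w_k t^k)`, for `t` with `Φ(t) < ∞`. -/
def Psi (w : ℕ → ℝ≥0) (t : ℝ≥0∞) : ℝ≥0∞ :=
  (∑' k : ℕ, (k : ℝ≥0∞) * ((w k : ℝ≥0∞) * t ^ k)) / Phi w t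

/-- The radius of convergence `ρ ∈ [0, ∞]` of `Φ`. -/
def radius (w : ℕ → ℝ≥0) : ℝ≥0∞ :=
  (FormalMultilinearSeries.ofScalars ℝ (fun k => (w k : ℝ))).radius

/-- `ν = Ψ(ρ)`. If `Φ(ρ) = ∞`, then `Ψ(ρ)` means the limit of `Ψ(t)` as `t ↑ ρ`, which is the
supremum since `Ψ` is increasing on `[0, ρ)`. -/
def nu (w : ℕ → ℝ≥0) : ℝ≥0∞ :=
  open Classical in
  if Phi w (radius w) < ∞ then Psi w (radius w) else ⨆ t : ℝ≥0∞, ⨆ _ : t < radius w, Psi w t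

/-! ### Ordered rooted trees as subtrees of the Ulam–Harris tree -/

/-- The nodes of the Ulam–Harris tree: finite strings. The string is stored with its last letter
first and with letters counted from `0`: the root is `[]`, and the children of `v`, in order, are
`0 :: v`, `1 :: v`, `2 :: v`, …. -/
abbrev Node : Type := List ℕ

/-- Ordered rooted trees, finite or infinite, where outdegrees may be infinite. -/
@[ext]
structure OrderedTree where
  nodes : Set Node
  root_mem : [] ∈ nodes
  parent_mem : ∀ (v : Node) (i : ℕ), i :: v ∈ nodes → v ∈ nodes
  left_mem : ∀ (v : Node) (i j : ℕ), i :: v ∈ nodes → j ≤ i → j :: v ∈ nodes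

/-- The tree that consists of its root only. -/
def OrderedTree.single : OrderedTree where
  nodes := {[]}
  root_mem := rfl
  parent_mem := fun _ _ h => by simp at h
  left_mem := fun _ _ _ h => by simp at h

/-- The outdegree of `v`; it is `0` if `v` is not a node of the tree. -/
def OrderedTree.outdeg (T : OrderedTree) (v : Node) : ℕ∞ := {i : ℕ | i :: v ∈ T.nodes}.encard

/-- The weight `∏_{v ∈ T} w_{d(v)}` of a finite tree `T`. -/
def OrderedTree.weight (w : ℕ → ℝ≥0) (T : OrderedTree) : ℝ≥0 :=
  ∏ᶠ v ∈ T.nodes, w (T.outdeg v).toNat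

/-- The weight of a tree that has exactly `n` nodes, and `0` for all other trees. -/
def sizeWeight (w : ℕ → ℝ≥0) (n : ℕ) (T : OrderedTree) : ℝ≥0∞ :=
  open Classical in
  if T.nodes.encard = n then (T.weight w : ℝ≥0∞) else 0

/-- The partition function `Z_n = ∑_{|T| = n} w(T)`. -/
def treeZ (w : ℕ → ℝ≥0) (n : ℕ) : ℝ≥0∞ := ∑' T : OrderedTree, sizeWeight w n T

/-- The (law of the) simply generated random tree `T_n`, meaningful when `Z_n > 0`. -/
def randomTree (w : ℕ → ℝ≥0) (n : ℕ) : PMF OrderedTree :=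
  proportionalTo (sizeWeight w n) OrderedTree.single

/-- `n → ∞` through those `n` for which `T_n` is defined, i.e. `Z_n > 0`. -/
def sizes (w : ℕ → ℝ≥0) : Filter ℕ := atTop ⊓ 𝓟 {n | 0 < treeZ w n}

/-! ### Balls in boxes -/

/-- The (law of the) random allocation `B_{m,n} = (Y_1, …, Y_n)` of `m` balls in `n` boxes:
probabilities proportional to `∏ w_{y_i}` on `{y : ∑ y_i = m}`. -/
def allocation (w : ℕ → ℝ≥0) (m n : ℕ) : PMF (Fin n → ℕ) :=
  proportionalTo (fun y => if ∑ i, y i = m then ∏ i, (w (y i) : ℝ≥0∞) else 0) 0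

/-- The total number of balls in the boxes with at most `K` balls, `∑_{k ≤ K} k N_k`. -/
def smallBalls {n : ℕ} (y : Fin n → ℕ) (K : ℝ) : ℕ := ∑ i with (y i : ℝ) ≤ K, y i

/-- The total number of balls in the boxes with more than `K` balls, `∑_{k > K} k N_k`. -/
def largeBalls {n : ℕ} (y : Fin n → ℕ) (K : ℝ) : ℕ := ∑ i with K < (y i : ℝ), y i

/-- The thresholds `Ω_n`: `Ω_n → ∞` so slowly that, in `B_{n-1,n}`, for every sequence `K_n → ∞`
with `K_n ≤ Ω_n`, `∑_{k ≤ K_n} k N_k = ν n + o_p(n)` and `∑_{k > K_n} k N_k = (1 - ν) n + o_p(n)`. -/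
def IsThreshold (w : ℕ → ℝ≥0) (Ω : ℕ → ℝ) : Prop :=
  Tendsto Ω (sizes w) atTop ∧
  ∀ K : ℕ → ℝ, Tendsto K (sizes w) atTop → (∀ n, K n ≤ Ω n) → ∀ ε : ℝ, 0 < ε →
    Tendsto (fun n : ℕ => (allocation w (n - 1) n).toMeasure
      {y | ε < |(smallBalls y (K n) : ℝ) / n - (nu w).toReal|}) (sizes w) (𝓝 0) ∧
    Tendsto (fun n : ℕ => (allocation w (n - 1) n).toMeasure
      {y | ε < |(largeBalls y (K n) : ℝ) / n - (1 - (nu w).toReal)|}) (sizes w) (𝓝 0)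

/-- The law of `Y_1`, the number of balls in the first box of `B_{n-1,n}` (where `n ≥ 1`). -/
def firstBox (w : ℕ → ℝ≥0) (n : ℕ) : PMF ℕ :=
  (allocation w (n - 1) n).map fun y => if h : 0 < n then y ⟨0, h⟩ else 0

/-- The law of `Y**`: the size-biased law of `Y_1` conditioned on being larger than `K`,
`P(Y** = k) = k P(Y_1 = k) / ∑_{l > K} l P(Y_1 = l)` for `k > K`. -/
def sizeBiasedLarge (w : ℕ → ℝ≥0) (n : ℕ) (K : ℝ) : PMF ℕ :=
  open Classical in
  proportionalTo (fun k => if K < (k : ℝ) then (k : ℝ≥0∞) * firstBox w n k else 0) 0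

/-! ### The modified Galton–Watson tree -/

/-- The offspring distribution `π_k = ρ^k w_k / Φ(ρ)`. -/
def offspring (w : ℕ → ℝ≥0) : PMF ℕ := proportionalTo (fun k => (w k : ℝ≥0∞) * radius w ^ k) 0

/-- The law of the offspring of a special node: `P(ξ̂ = k) = k π_k` for finite `k`, and
`P(ξ̂ = ∞) = 1 - μ` where `μ = ∑ k π_k ≤ 1`. (The total mass is then `1`.) -/
def specialOffspring (π : PMF ℕ) : PMF ℕ∞ :=
  open Classical in
  proportionalTo
    (fun k => if k = ⊤ then 1 - ∑' j : ℕ, (j : ℝ≥0∞) * π j else (k.toNat : ℝ≥0∞) * π k.toNat) ⊤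

/-- The offspring `k` of a special node together with the position `j` of its special child,
which is uniform on `{0, …, k - 1}` when `1 ≤ k < ∞`. (Otherwise `j = 0`, which is ignored.) -/
def specialMark (π : PMF ℕ) : PMF (ℕ∞ × ℕ) :=
  (specialOffspring π).bind fun k =>
    match k.toNat with
    | 0 => PMF.pure (k, 0)
    | m + 1 => (PMF.uniformOfFintype (Fin (m + 1))).map fun j => (k, (j : ℕ))

/-- The random choices at a node: its offspring in case it is normal, and its offspring and the
position of its special child in case it is special. -/
abbrev Mark : Type := ℕ × (ℕ∞ × ℕ)

/-- Independent random choices at all nodes of the Ulam–Harris tree. -/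
def markMeasure (π : PMF ℕ) : Measure (Node → Mark) :=
  Measure.infinitePi fun _ : Node => π.toMeasure.prod (specialMark π).toMeasure

/-- The status of a node of the Ulam–Harris tree: not in the random tree, or in it and normal,
or in it and special. -/
inductive Status
  | absent
  | normal
  | special

/-- The status of the child number `i` of a node that has status `s` and mark `c`. -/
def childStatus (s : Status) (c : Mark) (i : ℕ) : Status :=
  open Classical in
  match s with
  | .absent => .absent
  | .normal => if i < c.1 then .normal else .absent
  | .special =>
    if (i : ℕ∞) < c.2.1 then
      if c.2.1 ≠ ⊤ ∧ i = c.2.2 then .special else .normal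
    else .absent

/-- The status of all nodes, where the root is special. -/
def status (ω : Node → Mark) : Node → Status
  | [] => .special
  | i :: v => childStatus (status ω v) (ω v) i

/-- The modified Galton–Watson tree `T̂`, as a function of the random choices. -/
def hatTree (ω : Node → Mark) : OrderedTree where
  nodes := {v | status ω v ≠ .absent}
  root_mem := by simp [status]
  parent_mem := by
    intro v i h hv
    exact h (by simp [status, hv, childStatus])
  left_mem := by
    intro v i j h hij
    simp only [Set.mem_ofPred_eq, status] at h ⊢
    cases hs : status ω v with
    | absent => simp [hs, childStatus] at h
    | normal =>
      simp only [hs, childStatus] at h ⊢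
      have hi : i < (ω v).1 := by by_contra hc; simp [hc] at h
      simp [lt_of_le_of_lt hij hi]
    | special =>
      simp only [hs, childStatus] at h ⊢
      have hi : (i : ℕ∞) < (ω v).2.1 := by by_contra hc; simp [hc] at h
      have hj : (j : ℕ∞) < (ω v).2.1 := lt_of_le_of_lt (by exact_mod_cast hij) hi
      rw [if_pos hj]
      split_ifs <;> simp

/-- The outdegree of `v` in `T`, with the value `∞` replaced by `y`. -/
def OrderedTree.modifiedOutdeg (T : OrderedTree) (y : ℕ) (v : Node) : ℕ∞ :=
  open Classical in
  if T.outdeg v = ⊤ then (y : ℕ∞) else T.outdeg v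

/-! ### The two random vectors and their comparison -/

/-- The law of the outdegrees of `T_n` at the nodes `v_1, …, v_ℓ`. -/
def degreeLaw (w : ℕ → ℝ≥0) {l : ℕ} (v : Fin l → Node) (n : ℕ) : Measure (Fin l → ℕ∞) :=
  ((randomTree w n).map fun T i => T.outdeg (v i)).toMeasure

/-- The law of the modified outdegrees of `T̂` at the nodes `v_1, …, v_ℓ`, where the infinite
outdegree is replaced by `Y**`, independent of `T̂`. -/
def modifiedDegreeLaw (w : ℕ → ℝ≥0) (Ω : ℕ → ℝ) {l : ℕ} (v : Fin l → Node) (n : ℕ) :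
    Measure (Fin l → ℕ∞) :=
  ((markMeasure (offspring w)).prod (sizeBiasedLarge w n (Ω n)).toMeasure).map
    fun p i => (hatTree p.1).modifiedOutdeg p.2 (v i)

/-- `X_n ≈ X'_n` along the filter `F`, for random variables `X_n`, `X'_n` with laws `P n`, `Q n`:
there are couplings of `X_n` and `X'_n` such that `X_n = X'_n` with probability tending to `1`. -/
def ApproxEqual {α : Type*} [MeasurableSpace α] (F : Filter ℕ) (P Q : ℕ → Measure α) : Prop :=
  ∃ γ : ℕ → Measure (α × α),
    (∀ n, (γ n).map Prod.fst = P n ∧ (γ n).map Prod.snd = Q n) ∧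
    Tendsto (fun n => γ n {p | p.1 = p.2}) F (𝓝 1)

end SimplyGenerated

end

/-!
Explore `T_n` on a finite set `S` of nodes and suppose that the outdegrees `d` found there leave
`q = 1 + ∑_{u ∈ S} (d(u) - 1)` children unexplored. The weights of the trees with these outdegrees
are counted by forests of `q` trees on `n - |S|` nodes, so by the cycle lemma
`P(T_n has outdegrees d on S) ≥ q P(Y_u = d(u) for all u ∈ S)`, with one box `u` for each node.

Since `ν < 1`, the partition function `Z(n - 1, n)` grows like `(Φ(ρ) / ρ)^n`, up to a
subexponential factor (faster than exponentially if `ρ = 0`), so a Chernoff bound gives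
`N_k / n ≤ π_k + ε` with high probability; as the number of boxes is `n` and the number of balls at
most `n`, this forces `N_k / n → π_k`. By exchangeability the boxes are then asymptotically
independent with law `π`. Hence for finite outdegrees the right-hand side above tends to
`q ∏ π_{d(u)}`, which bounds the probability that the limit tree has outdegrees `d` on `S`: there
are `q` places where its special path can leave `S`. If instead one of the nodes has outdegree
`k > Ω_n`, then `q = k + O(1)`, so the size-biasing of `Y**` appears as the factor `q`, and
`∑_{k > Ω_n} k P(Y_1 = k) → 1 - ν` is the probability that a special node has infinite outdegree.

These one-sided bounds, for finitely many patterns of outdegrees that carry almost all of the mass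
of the limit tree, already bound the probability of every event on the side of the limit tree by
that on the side of `T_n` plus `ε`, uniformly in the event, which is what a coupling needs.
-/

noncomputable section

namespace SimplyGenerated

/-! ### Couplings -/

section Coupling

variable {α β : Type*} [MeasurableSpace α] [MeasurableSpace β]

lemma exists_coupling_of_measure_univ_eq {μ : Measure α} {ν : Measure β} [IsFiniteMeasure μ]
    [IsFiniteMeasure ν] (h : μ Set.univ = ν Set.univ) :
    ∃ γ : Measure (α × β), γ.map Prod.fst = μ ∧ γ.map Prod.snd = ν := by
  rcases eq_or_ne μ 0 with rfl | hμ
  · exact ⟨0, by simp, by simp [Measure.measure_univ_eq_zero.1 (h.symm.trans (by simp))]⟩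
  have hinv : (μ Set.univ)⁻¹ * μ Set.univ = 1 :=
    ENNReal.inv_mul_cancel (by simpa using hμ) (measure_ne_top μ _)
  refine ⟨(μ Set.univ)⁻¹ • μ.prod ν, ?_, ?_⟩
  · rw [Measure.map_smul, Measure.map_fst_prod, smul_smul, ← h, hinv, one_smul]
  · rw [Measure.map_smul, Measure.map_snd_prod, smul_smul, hinv, one_smul]

lemma exists_coupling_of_le {P Q R : Measure α} [IsProbabilityMeasure P] [IsProbabilityMeasure Q]
    (hP : R ≤ P) (hQ : R ≤ Q) :
    ∃ γ : Measure (α × α), γ.map Prod.fst = P ∧ γ.map Prod.snd = Q ∧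
      R.map (fun a => (a, a)) ≤ γ := by
  have : IsFiniteMeasure R := isFiniteMeasure_of_le P hP
  obtain ⟨γ, hfst, hsnd⟩ :
      ∃ γ : Measure (α × α), γ.map Prod.fst = P - R ∧ γ.map Prod.snd = Q - R := by
    refine exists_coupling_of_measure_univ_eq ?_
    rw [Measure.sub_apply .univ hP, Measure.sub_apply .univ hQ, measure_univ (μ := P),
      measure_univ (μ := Q)]
  have hdiag : Measurable fun a : α => (a, a) := by fun_prop
  refine ⟨γ + R.map fun a => (a, a), ?_, ?_, Measure.le_add_left le_rfl⟩
  · rw [Measure.map_add _ _ measurable_fst, hfst, Measure.map_map measurable_fst hdiag]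
    exact (congrArg _ Measure.map_id).trans (Measure.sub_add_cancel_of_le hP)
  · rw [Measure.map_add _ _ measurable_snd, hsnd, Measure.map_map measurable_snd hdiag]
    exact (congrArg _ Measure.map_id).trans (Measure.sub_add_cancel_of_le hQ)

lemma measure_univ_le_inf_add {P Q : Measure α} {ε : ℝ≥0∞}
    (h : ∀ A, MeasurableSet A → Q A ≤ P A + ε) : Q Set.univ ≤ (P ⊓ Q) Set.univ + ε := by
  rw [Measure.inf_apply .univ, ← tsub_le_iff_right]
  refine le_sInf ?_
  rintro _ ⟨A, rfl⟩
  simp only [Set.inter_univ, tsub_le_iff_right]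
  calc Q Set.univ = Q (A ∪ Aᶜ) := by rw [Set.union_compl_self]
    _ ≤ Q (toMeasurable P A) + Q Aᶜ :=
      (measure_union_le _ _).trans (by gcongr; exact subset_toMeasurable P A)
    _ ≤ P A + ε + Q Aᶜ := by
      gcongr
      simpa only [measure_toMeasurable] using h _ (measurableSet_toMeasurable P A)
    _ = P A + Q Aᶜ + ε := add_right_comm _ _ _

lemma exists_coupling_of_forall_le (P Q : Measure α) [IsProbabilityMeasure P]
    [IsProbabilityMeasure Q] :
    ∃ γ : Measure (α × α), γ.map Prod.fst = P ∧ γ.map Prod.snd = Q ∧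
      ∀ ε, (∀ A, MeasurableSet A → Q A ≤ P A + ε) → 1 ≤ γ {p | p.1 = p.2} + ε := by
  obtain ⟨γ, hfst, hsnd, hγ⟩ := exists_coupling_of_le (inf_le_left : P ⊓ Q ≤ P) inf_le_right
  refine ⟨γ, hfst, hsnd, fun ε hε => ?_⟩
  calc 1 = Q Set.univ := measure_univ.symm
    _ ≤ (P ⊓ Q) Set.univ + ε := measure_univ_le_inf_add hε
    _ = (P ⊓ Q) ((fun a => (a, a)) ⁻¹' {p | p.1 = p.2}) + ε := by simp
    _ ≤ γ {p | p.1 = p.2} + ε := by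
      gcongr
      exact (Measure.le_map_apply (by fun_prop) _).trans (hγ _)

theorem approxEqual_of_eventually_le {F : Filter ℕ} (P Q : ℕ → Measure α)
    [∀ n, IsProbabilityMeasure (P n)] [∀ n, IsProbabilityMeasure (Q n)]
    (h : ∀ ε : ℝ≥0∞, ε ≠ 0 → ∀ᶠ n in F, ∀ A, MeasurableSet A → Q n A ≤ P n A + ε) :
    ApproxEqual F P Q := by
  choose γ hfst hsnd hγ using fun n => exists_coupling_of_forall_le (P n) (Q n)
  refine ⟨γ, fun n => ⟨hfst n, hsnd n⟩, ENNReal.tendsto_nhds_of_Icc fun ε hε => ?_⟩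
  filter_upwards [h ε hε.ne'] with n hn
  refine ⟨tsub_le_iff_right.2 (hγ n ε hn), ?_⟩
  calc γ n {p | p.1 = p.2} ≤ γ n (Prod.fst ⁻¹' Set.univ) := measure_mono fun _ _ => trivial
    _ = 1 := by rw [← Measure.map_apply measurable_fst .univ, hfst, measure_univ]
    _ ≤ 1 + ε := le_self_add

end Coupling

/-! ### Partition functions of boxes and forests -/

section Forests

open PowerSeries Finset.HasAntidiagonal

/-- The partition function `Z(m, n)` of allocations of `m` balls in `n` boxes: the coefficient of
`t ^ m` in `Φ(t) ^ n`. -/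
def boxZ (w : ℕ → ℝ≥0∞) (m n : ℕ) : ℝ≥0∞ := coeff m (PowerSeries.mk w ^ n)

lemma tsum_ite_sum_eq_prod {ι : Type*} [Fintype ι] (f : ι → ℕ → ℝ≥0∞) (m : ℕ) :
    ∑' y : ι → ℕ, (if ∑ i, y i = m then ∏ i, f i (y i) else 0) =
      coeff m (∏ i, PowerSeries.mk (f i)) := by
  classical
  rw [coeff_prod, ← Finsupp.equivFunOnFinite.tsum_eq,
    tsum_eq_sum (s := Finset.univ.finsuppAntidiag m)]
  · refine Finset.sum_congr rfl fun y hy => ?_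
    simp [← (Finset.mem_finsuppAntidiag.1 hy).1]
  · intro y hy
    exact if_neg fun h => hy (Finset.mem_finsuppAntidiag.2 ⟨by simpa using h, by simp⟩)

lemma tsum_ite_sum_eq_boxZ (w : ℕ → ℝ≥0∞) (m n : ℕ) :
    ∑' y : Fin n → ℕ, (if ∑ i, y i = m then ∏ i, w (y i) else 0) = boxZ w m n := by
  simp [tsum_ite_sum_eq_prod, boxZ]

lemma boxZ_ne_top {w : ℕ → ℝ≥0∞} (hw : ∀ k, w k ≠ ∞) (m n : ℕ) : boxZ w m n ≠ ∞ := by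
  rw [boxZ, coeff_pow]
  exact ENNReal.sum_ne_top.2 fun y _ => ENNReal.prod_ne_top fun i _ => by simpa using hw _

lemma boxZ_mul_boxZ_le (w : ℕ → ℝ≥0∞) (a b m n : ℕ) :
    boxZ w a m * boxZ w b n ≤ boxZ w (a + b) (m + n) := by
  rw [boxZ, boxZ, boxZ, pow_add, coeff_mul]
  exact Finset.single_le_sum
    (f := fun p : ℕ × ℕ => coeff p.1 (PowerSeries.mk w ^ m) * coeff p.2 (PowerSeries.mk w ^ n))
    (fun _ _ => zero_le) (mem_antidiagonal.2 (rfl : (a, b).1 + (a, b).2 = a + b))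

lemma boxZ_one (w : ℕ → ℝ≥0∞) (m : ℕ) : boxZ w m 1 = w m := by simp [boxZ]

lemma boxZ_zero (w : ℕ → ℝ≥0∞) (m : ℕ) : boxZ w m 0 = if m = 0 then 1 else 0 := by
  simp [boxZ, coeff_one]

lemma boxZ_pow_le (w : ℕ → ℝ≥0∞) (a b n : ℕ) : boxZ w a b ^ n ≤ boxZ w (n * a) (n * b) := by
  induction n with
  | zero => simp [boxZ_zero]
  | succ n ih =>
    calc boxZ w a b ^ (n + 1) = boxZ w a b ^ n * boxZ w a b := pow_succ _ _
      _ ≤ boxZ w (n * a) (n * b) * boxZ w a b := by gcongr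
      _ ≤ boxZ w (n * a + a) (n * b + b) := boxZ_mul_boxZ_le ..
      _ = boxZ w ((n + 1) * a) ((n + 1) * b) := by rw [Nat.succ_mul, Nat.succ_mul]

lemma pow_le_boxZ (w : ℕ → ℝ≥0∞) (k n : ℕ) : w k ^ n ≤ boxZ w (n * k) n := by
  simpa only [boxZ_one, mul_one] using boxZ_pow_le w k 1 n

lemma boxZ_succ (w : ℕ → ℝ≥0∞) (m n : ℕ) :
    boxZ w m (n + 1) = ∑ p ∈ antidiagonal m, w p.1 * boxZ w p.2 n := by
  rw [boxZ, pow_succ', coeff_mul]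
  simp [boxZ]

/-- This compares the coefficients of `t (Φ ^ (n + 1))' = (n + 1) t Φ' Φ ^ n`. -/
lemma succ_mul_sum_mul_boxZ (w : ℕ → ℝ≥0∞) (m n : ℕ) :
    ((n + 1 : ℕ) : ℝ≥0∞) * ∑ p ∈ antidiagonal m, (p.1 : ℝ≥0∞) * (w p.1 * boxZ w p.2 n) =
      m * boxZ w m (n + 1) := by
  cases m with
  | zero => simp
  | succ m =>
    have hderiv := coeff_derivative (PowerSeries.mk w ^ (n + 1)) m
    have hC : ((n : PowerSeries ℝ≥0∞) + 1) = C ((n : ℝ≥0∞) + 1) := by simp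
    rw [derivative_pow] at hderiv
    simp only [boxZ, Nat.cast_add, Nat.cast_one] at hderiv ⊢
    rw [mul_comm ((m : ℝ≥0∞) + 1), ← hderiv, Finset.Nat.antidiagonal_succ]
    simp only [add_tsub_cancel_right, mul_assoc]
    rw [hC, coeff_C_mul, mul_comm (_ ^ n), coeff_mul]
    simp only [coeff_derivative]
    simp [mul_comm, mul_left_comm, mul_assoc]

/-- The partition function of ordered forests of `q` trees with `n` nodes in total. It is encoded
by the closed formula `q / n * Z(n - q, n)` of the cycle lemma; `forestZ_succ` is the recursion
that characterizes it. -/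
def forestZ (w : ℕ → ℝ≥0∞) (q n : ℕ) : ℝ≥0∞ :=
  if n = 0 then (if q = 0 then 1 else 0) else
    if q ≤ n then q * boxZ w (n - q) n / n else 0

lemma forestZ_zero_right (w : ℕ → ℝ≥0∞) (q : ℕ) :
    forestZ w q 0 = if q = 0 then 1 else 0 := by simp [forestZ]

lemma forestZ_zero_left (w : ℕ → ℝ≥0∞) (n : ℕ) :
    forestZ w 0 n = if n = 0 then 1 else 0 := by simp [forestZ]

lemma forestZ_of_lt (w : ℕ → ℝ≥0∞) {q n : ℕ} (h : n < q) : forestZ w q n = 0 := by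
  unfold forestZ
  split_ifs <;> first | rfl | omega

lemma natCast_mul_forestZ (w : ℕ → ℝ≥0∞) {q n : ℕ} (hn : n ≠ 0) (h : q ≤ n) :
    n * forestZ w q n = q * boxZ w (n - q) n := by
  rw [forestZ, if_neg hn, if_pos h]
  exact ENNReal.mul_div_cancel (by simpa using hn) (by simp)

lemma natCast_mul_forestZ_one (w : ℕ → ℝ≥0∞) {n : ℕ} (hn : n ≠ 0) :
    n * forestZ w 1 n = boxZ w (n - 1) n := by
  rw [natCast_mul_forestZ w hn (by omega), Nat.cast_one, one_mul]

lemma natCast_mul_sum_mul_forestZ (w : ℕ → ℝ≥0∞) (q m : ℕ) (h : q + m ≠ 0) :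
    ((q + m : ℕ) : ℝ≥0∞) *
        ∑ p ∈ antidiagonal m, w p.1 * forestZ w (q + p.1) (q + m) =
      q * boxZ w m (q + m + 1) +
        ∑ p ∈ antidiagonal m, (p.1 : ℝ≥0∞) * (w p.1 * boxZ w p.2 (q + m)) := by
  rw [boxZ_succ, Finset.mul_sum, Finset.mul_sum, ← Finset.sum_add_distrib]
  refine Finset.sum_congr rfl fun p hp => ?_
  have hp := mem_antidiagonal.1 hp
  rw [mul_left_comm, natCast_mul_forestZ w h (by omega), show q + m - (q + p.1) = p.2 by omega]
  push_cast
  ring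

/-- Removing the root of the first tree of a forest turns its `k` children into roots. -/
lemma forestZ_succ (w : ℕ → ℝ≥0∞) (q n : ℕ) :
    forestZ w (q + 1) (n + 1) = ∑' k, w k * forestZ w (q + k) n := by
  rcases lt_or_ge n q with hq | hq
  · rw [forestZ_of_lt w (by omega), eq_comm, ENNReal.tsum_eq_zero]
    intro k
    rw [forestZ_of_lt w (by omega), mul_zero]
  obtain ⟨m, rfl⟩ := Nat.exists_eq_add_of_le hq
  have htsum : ∑' k, w k * forestZ w (q + k) (q + m) =
      ∑ p ∈ antidiagonal m, w p.1 * forestZ w (q + p.1) (q + m) := by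
    rw [Finset.Nat.sum_antidiagonal_eq_sum_range_succ_mk]
    refine tsum_eq_sum fun k hk => ?_
    rw [forestZ_of_lt w (by simp at hk; omega), mul_zero]
  rw [htsum]
  rcases Nat.eq_zero_or_pos (q + m) with h0 | h0
  · obtain ⟨rfl, rfl⟩ : q = 0 ∧ m = 0 := by omega
    simp [forestZ, boxZ]
  refine (ENNReal.mul_right_inj (Nat.cast_ne_zero.2 h0.ne') (ENNReal.natCast_ne_top _)).1 ?_
  refine (ENNReal.mul_right_inj (Nat.cast_ne_zero.2 (q + m).succ_ne_zero)
    (ENNReal.natCast_ne_top _)).1 ?_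
  rw [natCast_mul_sum_mul_forestZ w q m h0.ne', mul_left_comm,
    natCast_mul_forestZ w (Nat.succ_ne_zero _) (by omega), mul_add, succ_mul_sum_mul_boxZ,
    show q + m + 1 - (q + 1) = m by omega]
  push_cast
  ring

lemma sum_forestZ_mul_forestZ (w : ℕ → ℝ≥0∞) (n p q : ℕ) :
    ∑ i ∈ antidiagonal n, forestZ w p i.1 * forestZ w q i.2 = forestZ w (p + q) n := by
  induction n generalizing p q with
  | zero => cases p <;> cases q <;> simp [forestZ]
  | succ n ih =>
    cases p with
    | zero =>
      rw [Finset.Nat.antidiagonal_succ]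
      simp [forestZ_zero_left]
    | succ p =>
      rw [Finset.Nat.antidiagonal_succ]
      simp only [Finset.sum_cons, Finset.sum_map, forestZ_zero_right, Nat.succ_ne_zero, if_false,
        zero_mul, zero_add, Function.Embedding.prodMap, Function.Embedding.coeFn_mk, Prod.map,
        Function.Embedding.refl_apply]
      rw [show p + 1 + q = (p + q) + 1 by omega, forestZ_succ]
      simp only [Nat.succ_eq_add_one, forestZ_succ, ← ENNReal.tsum_mul_right]
      rw [← Summable.tsum_finsetSum fun _ _ => ENNReal.summable]
      refine tsum_congr fun k => ?_
      rw [show p + q + k = (p + k) + q by omega, ← ih, Finset.mul_sum]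
      simp only [mul_assoc]

/-- The generating function of ordered forests of `q` trees, by the number of nodes. -/
def forestGF (w : ℕ → ℝ≥0∞) (q : ℕ) (x : ℝ≥0∞) : ℝ≥0∞ := ∑' n, forestZ w q n * x ^ n

lemma forestGF_add (w : ℕ → ℝ≥0∞) (p q : ℕ) (x : ℝ≥0∞) :
    forestGF w (p + q) x = forestGF w p x * forestGF w q x := by
  simp only [forestGF]
  rw [← ENNReal.tsum_mul_right]
  simp only [← ENNReal.tsum_mul_left]
  rw [← ENNReal.tsum_prod, ← Finset.HasAntidiagonal.sigmaAntidiagonalEquivProd.tsum_eq,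
    ENNReal.tsum_sigma']
  refine tsum_congr fun n => ?_
  rw [tsum_fintype, ← sum_forestZ_mul_forestZ, Finset.sum_mul, ← Finset.sum_coe_sort]
  refine Finset.sum_congr rfl fun i _ => ?_
  have hpow : x ^ n = x ^ (i : ℕ × ℕ).1 * x ^ (i : ℕ × ℕ).2 := by
    rw [← pow_add, mem_antidiagonal.1 i.2]
  simp only [Finset.HasAntidiagonal.sigmaAntidiagonalEquivProd_apply]
  rw [hpow]
  ring

lemma forestGF_eq_pow (w : ℕ → ℝ≥0∞) (q : ℕ) (x : ℝ≥0∞) :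
    forestGF w q x = forestGF w 1 x ^ q := by
  induction q with
  | zero => simp [forestGF, forestZ_zero_left, ite_mul]
  | succ q ih => rw [forestGF_add, ih, pow_succ]

lemma forestGF_one_eq (w : ℕ → ℝ≥0∞) (x : ℝ≥0∞) :
    forestGF w 1 x = x * ∑' k, w k * forestGF w 1 x ^ k := by
  simp only [← forestGF_eq_pow]
  conv_lhs => rw [forestGF, tsum_eq_zero_add' ENNReal.summable]
  simp only [forestGF, forestZ_zero_right, one_ne_zero, if_false, zero_mul, zero_add,
    ← ENNReal.tsum_mul_left]
  rw [ENNReal.tsum_comm]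
  refine tsum_congr fun n => ?_
  rw [← zero_add 1, forestZ_succ, ← ENNReal.tsum_mul_right]
  refine tsum_congr fun k => ?_
  rw [zero_add, zero_add, pow_succ]
  ring

end Forests

/-! ### Explored parts of trees -/

section ExploredTrees

/-- A weight sequence in `[0, ∞)` as a sequence in `[0, ∞]`, where `boxZ` and `forestZ` live. -/
abbrev extWeight (w : ℕ → ℝ≥0) : ℕ → ℝ≥0∞ := fun k => (w k : ℝ≥0∞)

variable {S : Finset Node} {d : Node → ℕ} {T : OrderedTree}

/-- `S` is the node set of an exploration from the root: in a tree where `u ∈ S` has outdegree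
`d u`, every node of `S` can be reached from the root through nodes of `S`. -/
def IsExplored (S : Finset Node) (d : Node → ℕ) : Prop :=
  ∀ v ∈ S, v = [] ∨ ∃ i u, v = i :: u ∧ u ∈ S ∧ i < d u

/-- The root and the children of the nodes of `S`, in a tree where `u ∈ S` has outdegree `d u`. -/
def reach (S : Finset Node) (d : Node → ℕ) : Finset Node :=
  insert [] (S.biUnion fun u => (Finset.range (d u)).image (· :: u))

/-- The nodes that are known to belong to a tree with outdegrees `d` on `S`, but whose own
outdegree has not been explored. -/
def boundary (S : Finset Node) (d : Node → ℕ) : Finset Node := reach S d \ S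

lemma mem_reach {v : Node} :
    v ∈ reach S d ↔ v = [] ∨ ∃ i u, v = i :: u ∧ u ∈ S ∧ i < d u := by
  simp only [reach, Finset.mem_insert, Finset.mem_biUnion, Finset.mem_image, Finset.mem_range]
  exact or_congr_right
    ⟨fun ⟨u, hu, i, hi, h⟩ => ⟨i, u, h.symm, hu, hi⟩,
      fun ⟨i, u, h, hu, hi⟩ => ⟨u, hu, i, hi, h.symm⟩⟩

lemma nil_mem_reach : [] ∈ reach S d := mem_reach.2 (Or.inl rfl)

lemma cons_mem_reach {i : ℕ} {u : Node} : i :: u ∈ reach S d ↔ u ∈ S ∧ i < d u := by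
  simp [mem_reach]

lemma isExplored_iff_subset_reach : IsExplored S d ↔ S ⊆ reach S d :=
  forall₂_congr fun _ _ => mem_reach.symm

lemma card_reach (S : Finset Node) (d : Node → ℕ) : (reach S d).card = 1 + ∑ u ∈ S, d u := by
  rw [reach, Finset.card_insert_of_notMem (by simp), Finset.card_biUnion, add_comm]
  · congr 1
    refine Finset.sum_congr rfl fun u _ => ?_
    rw [Finset.card_image_of_injective _ (fun a b h => by simpa using h), Finset.card_range]
  · intro u _ u' _ hne
    rw [Function.onFun, Finset.disjoint_left]
    intro v hv hv'
    simp only [Finset.mem_image] at hv hv'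
    obtain ⟨i, _, rfl⟩ := hv
    obtain ⟨j, _, h⟩ := hv'
    exact hne (List.cons.inj h).2.symm

lemma IsExplored.card_boundary (hS : IsExplored S d) :
    (boundary S d).card + S.card = 1 + ∑ u ∈ S, d u := by
  rw [boundary, Finset.card_sdiff_add_card_eq_card (isExplored_iff_subset_reach.1 hS), card_reach]

lemma IsExplored.reach_eq (hS : IsExplored S d) (hb : boundary S d = ∅) : reach S d = S :=
  (Finset.sdiff_eq_empty_iff_subset.1 hb).antisymm (isExplored_iff_subset_reach.1 hS)

lemma IsExplored.insert (hS : IsExplored S d) {b : Node} (hb : b ∈ boundary S d) (k : ℕ) :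
    IsExplored (insert b S) (Function.update d b k) := by
  obtain ⟨hbr, hbS⟩ := Finset.mem_sdiff.1 hb
  have hreach : reach S d ⊆ reach (Insert.insert b S) (Function.update d b k) := by
    intro v hv
    rcases mem_reach.1 hv with rfl | ⟨i, u, rfl, hu, hi⟩
    · exact nil_mem_reach
    · refine cons_mem_reach.2 ⟨Finset.mem_insert_of_mem hu, ?_⟩
      rwa [Function.update_of_ne (by rintro rfl; exact hbS hu)]
  rw [isExplored_iff_subset_reach] at hS ⊢
  exact Finset.insert_subset (hreach hbr) (hS.trans hreach)

lemma IsExplored.card_boundary_insert (hS : IsExplored S d) {b : Node} (hb : b ∈ boundary S d)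
    (k : ℕ) :
    (boundary (Insert.insert b S) (Function.update d b k)).card + 1 = (boundary S d).card + k := by
  have hbS : b ∉ S := (Finset.mem_sdiff.1 hb).2
  have hcard := hS.card_boundary
  have hcard' := (hS.insert hb k).card_boundary
  rw [Finset.card_insert_of_notMem hbS, Finset.sum_insert hbS, Function.update_self,
    Finset.sum_update_of_notMem hbS] at hcard'
  omega

namespace OrderedTree

lemma cons_mem_nodes_iff {u : Node} (i : ℕ) : i :: u ∈ T.nodes ↔ (i : ℕ∞) < T.outdeg u := by
  have hlower : IsLowerSet {j : ℕ | j :: u ∈ T.nodes} := fun a b hba ha => T.left_mem u a b ha hba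
  change i ∈ {j : ℕ | j :: u ∈ T.nodes} ↔ _
  rw [outdeg]
  rcases hlower.eq_univ_or_Iio with h | ⟨a, h⟩
  · simp [h]
  · simp [h, Set.encard_eq_coe_toFinset_card]

lemma outdeg_eq_zero {u : Node} (h : u ∉ T.nodes) : T.outdeg u = 0 := by
  rw [outdeg, Set.encard_eq_zero, Set.eq_empty_iff_forall_notMem]
  exact fun i hi => h (T.parent_mem u i hi)

lemma outdeg_ne_top (h : T.nodes.Finite) (u : Node) : T.outdeg u ≠ ⊤ := by
  rw [outdeg, Set.encard_ne_top_iff]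
  exact h.preimage (f := fun i => i :: u) fun a _ b _ hab => (List.cons.inj hab).1

/-- `T` has the outdegrees `d` on `S`. -/
def Matches (T : OrderedTree) (S : Finset Node) (d : Node → ℕ) : Prop :=
  ∀ u ∈ S, T.outdeg u = d u

lemma matches_insert_iff {b : Node} (hb : b ∉ S) (k : ℕ) :
    T.Matches (insert b S) (Function.update d b k) ↔ T.Matches S d ∧ T.outdeg b = k := by
  simp only [Matches, Finset.forall_mem_insert, Function.update_self]
  rw [and_comm]
  refine and_congr_left fun _ => forall₂_congr fun u hu => ?_
  rw [Function.update_of_ne (by rintro rfl; exact hb hu)]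

lemma Matches.reach_subset (hT : T.Matches S d) : (reach S d : Set Node) ⊆ T.nodes := by
  intro v hv
  rcases mem_reach.1 hv with rfl | ⟨i, u, rfl, hu, hi⟩
  · exact T.root_mem
  · rw [cons_mem_nodes_iff, hT u hu]
    exact_mod_cast hi

lemma Matches.nodes_eq (hT : T.Matches S d) (hS : IsExplored S d) (hb : boundary S d = ∅) :
    T.nodes = (S : Set Node) := by
  have hr := hS.reach_eq hb
  refine Set.Subset.antisymm (fun v hv => ?_) (hr ▸ hT.reach_subset)
  induction v with
  | nil => exact hr.subset nil_mem_reach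
  | cons i u ih =>
    have hu : u ∈ S := ih (T.parent_mem u i hv)
    rw [cons_mem_nodes_iff, hT u hu] at hv
    exact hr.subset (cons_mem_reach.2 ⟨hu, by exact_mod_cast hv⟩)

end OrderedTree

/-- The finite tree with node set `S`, for a completed exploration. -/
def IsExplored.tree (hS : IsExplored S d) (hb : boundary S d = ∅) : OrderedTree where
  nodes := S
  root_mem := (hS.reach_eq hb).subset nil_mem_reach
  parent_mem := fun _ _ h => (cons_mem_reach.1 ((hS.reach_eq hb).superset h)).1
  left_mem := fun _ _ _ h hji => by
    obtain ⟨hu, hi⟩ := cons_mem_reach.1 ((hS.reach_eq hb).superset h)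
    exact (hS.reach_eq hb).subset (cons_mem_reach.2 ⟨hu, hji.trans_lt hi⟩)

lemma IsExplored.tree_matches (hS : IsExplored S d) (hb : boundary S d = ∅) :
    (hS.tree hb).Matches S d := by
  intro u hu
  have hchildren : {i : ℕ | i :: u ∈ (hS.tree hb).nodes} = Set.Iio (d u) := by
    ext i
    change i :: u ∈ S ↔ i < d u
    rw [← hS.reach_eq hb, cons_mem_reach]
    exact and_iff_right hu
  rw [OrderedTree.outdeg, hchildren, Set.encard_eq_coe_toFinset_card]
  simp

lemma sizeWeight_eq_zero (w : ℕ → ℝ≥0) {n : ℕ} (h : T.nodes.encard ≠ n) :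
    sizeWeight w n T = 0 := if_neg h

lemma OrderedTree.Matches.sizeWeight_eq (w : ℕ → ℝ≥0) (hT : T.Matches S d)
    (hS : T.nodes = (S : Set Node)) : sizeWeight w S.card T = ∏ u ∈ S, (w (d u) : ℝ≥0∞) := by
  rw [sizeWeight, if_pos (by rw [hS, Set.encard_coe_eq_coe_finsetCard]), OrderedTree.weight, hS,
    finprod_mem_coe_finset, ENNReal.ofNNReal_finsetProd]
  exact Finset.prod_congr rfl fun u hu => by rw [hT u hu, ENat.toNat_natCast]

/-- The total weight of the trees with `n` nodes that have the outdegrees `d` on `S`. -/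
def matchWeight (w : ℕ → ℝ≥0) (S : Finset Node) (d : Node → ℕ) (n : ℕ) : ℝ≥0∞ :=
  ∑' T, {T : OrderedTree | T.Matches S d}.indicator (sizeWeight w n) T

lemma matchWeight_eq_zero (w : ℕ → ℝ≥0) {n : ℕ}
    (h : ∀ T : OrderedTree, T.Matches S d → T.nodes.encard ≠ n) : matchWeight w S d n = 0 :=
  ENNReal.tsum_eq_zero.2 fun _ =>
    Set.indicator_apply_eq_zero.2 fun hT => sizeWeight_eq_zero w (h _ hT)

lemma matchWeight_eq_tsum_insert (w : ℕ → ℝ≥0) (d : Node → ℕ) {b : Node} (hb : b ∉ S) (n : ℕ) :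
    matchWeight w S d n = ∑' k, matchWeight w (insert b S) (Function.update d b k) n := by
  classical
  simp only [matchWeight]
  rw [ENNReal.tsum_comm]
  refine tsum_congr fun T => ?_
  by_cases hs : T.nodes.encard = n
  · obtain ⟨k, hk⟩ := ENat.ne_top_iff_exists.1
      (OrderedTree.outdeg_ne_top (Set.finite_of_encard_eq_coe hs) b)
    rw [tsum_eq_single k fun j hj => Set.indicator_of_notMem (fun h => hj ?_) _]
    · simp only [Set.indicator_apply, Set.mem_ofPred_eq, OrderedTree.matches_insert_iff hb, hk,
        and_true]
    · exact_mod_cast (hk.trans ((OrderedTree.matches_insert_iff hb j).1 h).2).symm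
  · rw [eq_comm, Set.indicator_apply_eq_zero.2 fun _ => sizeWeight_eq_zero w hs]
    exact ENNReal.tsum_eq_zero.2 fun _ =>
      Set.indicator_apply_eq_zero.2 fun _ => sizeWeight_eq_zero w hs

lemma matchWeight_of_boundary_eq_empty (w : ℕ → ℝ≥0) (hS : IsExplored S d)
    (hb : boundary S d = ∅) : matchWeight w S d S.card = ∏ u ∈ S, (w (d u) : ℝ≥0∞) := by
  rw [matchWeight, tsum_eq_single (hS.tree hb) fun T hT =>
    Set.indicator_of_notMem (fun h => hT (OrderedTree.ext (h.nodes_eq hS hb))) _]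
  rw [Set.indicator_of_mem (hS.tree_matches hb), (hS.tree_matches hb).sizeWeight_eq w rfl]

lemma matchWeight_card_eq_zero (w : ℕ → ℝ≥0) (hS : IsExplored S d) (hb : boundary S d ≠ ∅) :
    matchWeight w S d S.card = 0 := by
  refine matchWeight_eq_zero w fun T hT hn => ?_
  have hle := Set.encard_le_encard hT.reach_subset
  have hpos := Finset.card_pos.2 (Finset.nonempty_iff_ne_empty.2 hb)
  rw [hn, Set.encard_coe_eq_coe_finsetCard, Nat.cast_le, card_reach, ← hS.card_boundary] at hle
  omega

/-- The nodes of the boundary are the roots of an independent forest, whatever the explored part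
looks like. -/
theorem matchWeight_card_add (w : ℕ → ℝ≥0) (m : ℕ) (hS : IsExplored S d) :
    matchWeight w S d (S.card + m) =
      (∏ u ∈ S, (w (d u) : ℝ≥0∞)) * forestZ (extWeight w) (boundary S d).card m := by
  induction m generalizing S d with
  | zero =>
    rw [forestZ_zero_right, add_zero]
    by_cases hb : boundary S d = ∅
    · simp [hb, matchWeight_of_boundary_eq_empty w hS hb]
    · simp [hb, matchWeight_card_eq_zero w hS hb]
  | succ m ih =>
    rcases (boundary S d).eq_empty_or_nonempty with hb | ⟨b, hb⟩
    · rw [hb, Finset.card_empty, forestZ_zero_left, if_neg m.succ_ne_zero, mul_zero]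
      refine matchWeight_eq_zero w fun T hT hn => ?_
      rw [hT.nodes_eq hS hb, Set.encard_coe_eq_coe_finsetCard, Nat.cast_inj] at hn
      omega
    have hbS : b ∉ S := (Finset.mem_sdiff.1 hb).2
    obtain ⟨q, hq⟩ := Nat.exists_eq_add_one_of_ne_zero (Finset.card_pos.2 ⟨b, hb⟩).ne'
    rw [matchWeight_eq_tsum_insert w d hbS, hq, forestZ_succ, ← ENNReal.tsum_mul_left]
    refine tsum_congr fun k => ?_
    have hcard := hS.card_boundary_insert hb k
    have hprod : ∏ u ∈ S, (w (Function.update d b k u) : ℝ≥0∞) = ∏ u ∈ S, (w (d u) : ℝ≥0∞) :=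
      Finset.prod_congr rfl fun u hu => by
        rw [Function.update_of_ne (by rintro rfl; exact hbS hu)]
    rw [show S.card + (m + 1) = (insert b S).card + m by
        rw [Finset.card_insert_of_notMem hbS]; ring,
      ih (hS.insert hb k), Finset.prod_insert hbS, Function.update_self, hprod,
      show (boundary (insert b S) (Function.update d b k)).card = q + k by omega]
    ring

lemma treeZ_eq (w : ℕ → ℝ≥0) (n : ℕ) : treeZ w n = forestZ (extWeight w) 1 n := by
  have hS : IsExplored ∅ (fun _ => 0) := fun v hv => by simp at hv
  have hb : boundary ∅ (fun _ => 0) = {[]} := by simp [boundary, reach]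
  simpa [matchWeight, OrderedTree.Matches, treeZ, hb] using matchWeight_card_add w n hS

end ExploredTrees

/-! ### The growth rate of the partition function -/

section Radius

variable {w : ℕ → ℝ≥0} {s t : ℝ≥0∞}

lemma Phi_mono (h : s ≤ t) : Phi w s ≤ Phi w t := ENNReal.tsum_le_tsum fun k => by gcongr

lemma Phi_zero : Phi w 0 = w 0 := by
  rw [Phi, tsum_eq_single 0 fun k hk => by simp [hk], pow_zero, mul_one]

lemma le_Phi : (w 0 : ℝ≥0∞) ≤ Phi w t := Phi_zero.symm.trans_le (Phi_mono zero_le)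

lemma Phi_ne_zero (hw0 : 0 < w 0) : Phi w t ≠ 0 :=
  ((ENNReal.coe_pos.2 hw0).trans_le le_Phi).ne'

lemma Phi_coe_ne_top_iff (r : ℝ≥0) : Phi w r ≠ ∞ ↔ Summable fun k => w k * r ^ k := by
  rw [← ENNReal.tsum_coe_ne_top_iff_summable]
  simp [Phi]

lemma Phi_lt_top_of_lt_radius (h : t < radius w) : Phi w t < ∞ := by
  lift t to ℝ≥0 using h.ne_top
  rw [lt_top_iff_ne_top, Phi_coe_ne_top_iff]
  have hsummable := FormalMultilinearSeries.summable_nnnorm_mul_pow _ h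
  rw [← NNReal.summable_coe] at hsummable ⊢
  simpa [FormalMultilinearSeries.ofScalars_norm] using hsummable

lemma le_radius_of_Phi_lt_top (h : Phi w t < ∞) : t ≤ radius w := by
  refine ENNReal.le_of_forall_nnreal_lt fun r hr => ?_
  have hsummable := (Phi_coe_ne_top_iff r).1 ((Phi_mono hr.le).trans_lt h).ne
  refine FormalMultilinearSeries.le_radius_of_summable _ ?_
  simpa [FormalMultilinearSeries.ofScalars_norm, ← NNReal.summable_coe] using hsummable

lemma exists_pow_le_of_radius_eq_zero (h : radius w = 0) (C : ℝ≥0) (N : ℕ) :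
    ∃ a, N ≤ a ∧ C ^ a ≤ w a := by
  by_contra! hlt
  have hpos : (((C + 1)⁻¹ : ℝ≥0) : ℝ≥0∞) ≤ radius w := by
    refine FormalMultilinearSeries.le_radius_of_eventually_le _ 1 ?_
    filter_upwards [eventually_ge_atTop N] with a ha
    rw [FormalMultilinearSeries.ofScalars_norm]
    have hle : w a * (C + 1)⁻¹ ^ a ≤ 1 := by
      rw [inv_pow, ← div_eq_mul_inv]
      exact div_le_one_of_le₀ ((hlt a ha).le.trans (by gcongr; exact le_self_add)) zero_le
    simpa using NNReal.coe_le_coe.2 hle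
  simp [h] at hpos

lemma Phi_le_add_tsum : Phi w t ≤ w 0 + ∑' k : ℕ, (k : ℝ≥0∞) * (w k * t ^ k) := by
  rw [Phi, tsum_eq_zero_add' ENNReal.summable,
    tsum_eq_zero_add' (f := fun k : ℕ => (k : ℝ≥0∞) * (w k * t ^ k)) ENNReal.summable]
  simp only [pow_zero, mul_one, Nat.cast_zero, zero_mul, zero_add]
  gcongr _ + ?_
  exact ENNReal.tsum_le_tsum fun k =>
    le_mul_of_one_le_left zero_le (by exact_mod_cast Nat.le_add_left 1 k)

lemma Phi_le_div_of_Psi_le (hw0 : 0 < w 0) (ht : Phi w t ≠ ∞) {c : ℝ≥0∞} (hc : c < 1)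
    (h : Psi w t ≤ c) : Phi w t ≤ w 0 / (1 - c) := by
  rw [Psi, ENNReal.div_le_iff (Phi_ne_zero hw0) ht] at h
  rw [ENNReal.le_div_iff_mul_le (Or.inl (tsub_pos_of_lt hc).ne')
    (Or.inr ENNReal.coe_ne_top), mul_comm, ENNReal.sub_mul fun _ _ => ht, one_mul,
    tsub_le_iff_right]
  exact Phi_le_add_tsum.trans (by gcongr)

lemma Phi_le_of_forall_lt {B : ℝ≥0∞} (h0 : t ≠ 0) (h : ∀ s < t, Phi w s ≤ B) : Phi w t ≤ B := by
  rw [Phi, ENNReal.tsum_eq_iSup_nat]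
  refine iSup_le fun N => ?_
  have hcont : Continuous fun s : ℝ≥0∞ => ∑ k ∈ Finset.range N, (w k : ℝ≥0∞) * s ^ k :=
    continuous_finsetSum _ fun k _ =>
      (ENNReal.continuous_const_mul ENNReal.coe_ne_top).comp (ENNReal.continuous_pow k)
  have : (𝓝[<] t).NeBot := nhdsLT_neBot_of_exists_lt ⟨0, pos_iff_ne_zero.2 h0⟩
  refine le_of_tendsto (hcont.continuousWithinAt (s := Set.Iio t) (x := t)) ?_
  filter_upwards [self_mem_nhdsWithin] with s hs
  exact (ENNReal.sum_le_tsum _).trans (h s hs)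

lemma Phi_radius_lt_top (hw0 : 0 < w 0) (hnu : nu w < 1) : Phi w (radius w) < ∞ := by
  by_contra htop
  rw [nu, if_neg htop] at hnu
  have hradius : radius w ≠ 0 := fun h => htop (by simp [h, Phi_zero])
  refine htop ((Phi_le_of_forall_lt hradius fun t ht => ?_).trans_lt
    (ENNReal.div_lt_top (ENNReal.coe_ne_top (r := w 0)) (tsub_pos_of_lt hnu).ne'))
  exact Phi_le_div_of_Psi_le hw0 (Phi_lt_top_of_lt_radius ht).ne hnu (le_iSup₂_of_le t ht le_rfl)

lemma radius_ne_top (hw0 : 0 < w 0) (hw2 : ∃ k, 2 ≤ k ∧ 0 < w k) (hnu : nu w < 1) :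
    radius w ≠ ∞ := by
  intro h
  have hfin := Phi_radius_lt_top hw0 hnu
  obtain ⟨k, hk, hwk⟩ := hw2
  rw [h] at hfin
  refine hfin.ne (ENNReal.tsum_eq_top_of_eq_top ⟨k, ?_⟩)
  rw [ENNReal.top_pow (by omega), ENNReal.mul_top (by simpa using hwk.ne')]

lemma tsum_mul_radius_pow (hw0 : 0 < w 0) (hnu : nu w < 1) :
    ∑' k : ℕ, (k : ℝ≥0∞) * (w k * radius w ^ k) = nu w * Phi w (radius w) := by
  have h := Phi_radius_lt_top hw0 hnu
  rw [nu, if_pos h, Psi, ENNReal.div_mul_cancel (Phi_ne_zero hw0) h.ne]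

lemma add_pow_succ_le (t s : ℝ≥0∞) (k : ℕ) :
    (t + s) ^ (k + 1) ≤ (t + s) * t ^ k + k * (t + s) ^ k * s := by
  induction k with
  | zero => simp
  | succ k ih =>
    calc (t + s) ^ (k + 1 + 1) = t * (t + s) ^ (k + 1) + s * (t + s) ^ (k + 1) := by ring
      _ ≤ t * ((t + s) * t ^ k + k * (t + s) ^ k * s) + s * (t + s) ^ (k + 1) := by gcongr
      _ = (t + s) * t ^ (k + 1) + t * (k * (t + s) ^ k * s) + s * (t + s) ^ (k + 1) := by ring
      _ ≤ (t + s) * t ^ (k + 1) + (t + s) * (k * (t + s) ^ k * s) + s * (t + s) ^ (k + 1) := by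
        gcongr; exact le_self_add
      _ = _ := by push_cast; ring

/-- `t / Φ(t)` is maximal at `s` on `[0, s]` as long as `Ψ(s) ≤ 1`; no derivative is taken because
`s` may be the radius of convergence. -/
lemma mul_Phi_le_mul_Phi (hts : t ≤ s) (hs : s ≠ ∞) (hfin : Phi w s ≠ ∞)
    (hPsi : ∑' k : ℕ, (k : ℝ≥0∞) * (w k * s ^ k) ≤ Phi w s) : t * Phi w s ≤ s * Phi w t := by
  obtain ⟨r, rfl⟩ := exists_add_of_le hts
  have hr : r ≠ ∞ := ne_top_of_le_ne_top hs le_add_self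
  refine (ENNReal.add_le_add_iff_right (ENNReal.mul_ne_top hr hfin)).1 ?_
  calc t * Phi w (t + r) + r * Phi w (t + r)
      = ∑' k, (w k : ℝ≥0∞) * (t + r) ^ (k + 1) := by
        rw [← add_mul, Phi, ← ENNReal.tsum_mul_left]
        exact tsum_congr fun k => by ring
    _ ≤ ∑' k, ((t + r) * (w k * t ^ k) + r * (k * (w k * (t + r) ^ k))) := by
        refine ENNReal.tsum_le_tsum fun k => ?_
        calc (w k : ℝ≥0∞) * (t + r) ^ (k + 1)
            ≤ w k * ((t + r) * t ^ k + k * (t + r) ^ k * r) := by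
              gcongr; exact add_pow_succ_le t r k
          _ = _ := by ring
    _ = (t + r) * Phi w t + r * ∑' k : ℕ, (k : ℝ≥0∞) * (w k * (t + r) ^ k) := by
        rw [ENNReal.tsum_add, ENNReal.tsum_mul_left, ENNReal.tsum_mul_left, Phi]
    _ ≤ (t + r) * Phi w t + r * Phi w (t + r) := by gcongr

end Radius

section LowerBounds

variable {w : ℕ → ℝ≥0}

lemma boxZ_mul_boxZ_pred_le (w : ℕ → ℝ≥0∞) (a b : ℕ) {n : ℕ} (hn : n ≠ 0) :
    boxZ w a b * boxZ w (n - 1) n ≤ boxZ w (a + n - 1) (b + n) := by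
  have h := boxZ_mul_boxZ_le w a (n - 1) b n
  rwa [show a + (n - 1) = a + n - 1 by omega] at h

lemma forestZ_one_le (w : ℕ → ℝ≥0∞) {n : ℕ} (hn : n ≠ 0) :
    forestZ w 1 n ≤ boxZ w (n - 1) n := by
  rw [← natCast_mul_forestZ_one w hn]
  exact le_mul_of_one_le_left zero_le (by exact_mod_cast Nat.one_le_iff_ne_zero.2 hn)

lemma mul_boxZ_pred_le_boxZ_self (w : ℕ → ℝ≥0∞) {k n : ℕ} (hk : 2 ≤ k) (hn : n ≠ 0) :
    w k * w 0 ^ (k - 2) * boxZ w (n - 1) n ≤ boxZ w (k - 1 + n) (k - 1 + n) := by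
  have hle : w k * w 0 ^ (k - 2) ≤ boxZ w k (k - 1) := by
    calc w k * w 0 ^ (k - 2) ≤ boxZ w k 1 * boxZ w 0 (k - 2) := by
          rw [boxZ_one]
          gcongr
          simpa only [mul_zero] using pow_le_boxZ w 0 (k - 2)
      _ ≤ boxZ w (k + 0) (1 + (k - 2)) := boxZ_mul_boxZ_le ..
      _ = boxZ w k (k - 1) := by rw [add_zero, show 1 + (k - 2) = k - 1 by omega]
  calc _ ≤ boxZ w k (k - 1) * boxZ w (n - 1) n := by gcongr
    _ ≤ boxZ w (k + n - 1) (k - 1 + n) := boxZ_mul_boxZ_pred_le w _ _ hn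
    _ = boxZ w (k - 1 + n) (k - 1 + n) := by rw [show k + n - 1 = k - 1 + n by omega]

lemma forestGF_one_ne_top {w : ℕ → ℝ≥0∞} (hw0 : w 0 ≠ 0) (hw2 : ∃ k, 2 ≤ k ∧ w k ≠ 0)
    {c x : ℝ≥0∞} (hc : c ≠ ∞) (h : ∀ j, j ≠ 0 → boxZ w j j ≤ c ^ j) (hcx : c * x < 1) :
    forestGF w 1 x ≠ ∞ := by
  obtain ⟨k, hk, hwk⟩ := hw2
  set D : ℝ≥0∞ := w k * w 0 ^ (k - 2)
  have hD0 : D ≠ 0 := mul_ne_zero hwk (pow_ne_zero _ hw0)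
  have hgeom : ∑' n : ℕ, c ^ (k - 1) * (c * x) ^ n ≠ ∞ := by
    rw [ENNReal.tsum_mul_left, ENNReal.tsum_geometric]
    exact ENNReal.mul_ne_top (by finiteness) (ENNReal.inv_ne_top.2 (tsub_pos_of_lt hcx).ne')
  have hbound : D * forestGF w 1 x ≤ ∑' n : ℕ, c ^ (k - 1) * (c * x) ^ n := by
    rw [forestGF, ← ENNReal.tsum_mul_left]
    refine ENNReal.tsum_le_tsum fun n => ?_
    rcases eq_or_ne n 0 with rfl | hn
    · simp [forestZ_zero_right]
    calc D * (forestZ w 1 n * x ^ n) ≤ D * (boxZ w (n - 1) n * x ^ n) := by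
          gcongr; exact forestZ_one_le w hn
      _ ≤ boxZ w (k - 1 + n) (k - 1 + n) * x ^ n := by
          rw [← mul_assoc]; gcongr; exact mul_boxZ_pred_le_boxZ_self w hk hn
      _ ≤ c ^ (k - 1 + n) * x ^ n := by gcongr; exact h _ (by omega)
      _ = c ^ (k - 1) * (c * x) ^ n := by rw [pow_add, mul_pow, mul_assoc]
  intro htop
  rw [htop, ENNReal.mul_top hD0, top_le_iff] at hbound
  exact hgeom hbound

/-- `T = forestGF w 1 x` solves `T = x Φ(T)`, so `x = T / Φ(T)` is at most `ρ / Φ(ρ)`. -/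
lemma mul_Phi_radius_le_of_forestGF_ne_top (hw0 : 0 < w 0) (hw2 : ∃ k, 2 ≤ k ∧ 0 < w k)
    (hnu : nu w < 1) {x : ℝ≥0∞} (hx : x ≠ 0) (hT : forestGF (extWeight w) 1 x ≠ ∞) :
    x * Phi w (radius w) ≤ radius w := by
  set T := forestGF (extWeight w) 1 x
  have hfix : T = x * Phi w T := forestGF_one_eq (extWeight w) x
  have hT0 : T ≠ 0 := by
    rw [hfix]
    exact mul_ne_zero hx (Phi_ne_zero hw0)
  have hPhiT : Phi w T < ∞ := by
    rw [lt_top_iff_ne_top]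
    intro h
    rw [h, ENNReal.mul_top hx] at hfix
    exact hT hfix
  have hmono : T * Phi w (radius w) ≤ radius w * Phi w T := by
    refine mul_Phi_le_mul_Phi (le_radius_of_Phi_lt_top hPhiT) (radius_ne_top hw0 hw2 hnu)
      (Phi_radius_lt_top hw0 hnu).ne ?_
    rw [tsum_mul_radius_pow hw0 hnu]
    exact mul_le_of_le_one_left zero_le hnu.le
  refine (ENNReal.mul_le_mul_iff_right hT0 hT).1 ?_
  calc T * (x * Phi w (radius w)) = x * (T * Phi w (radius w)) := mul_left_comm ..
    _ ≤ x * (radius w * Phi w T) := by gcongr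
    _ = radius w * (x * Phi w T) := mul_left_comm ..
    _ = T * radius w := by rw [← hfix, mul_comm]

lemma exists_pow_le_boxZ_self (hw0 : 0 < w 0) (hw2 : ∃ k, 2 ≤ k ∧ 0 < w k) (hnu : nu w < 1)
    {c : ℝ≥0} (hc : c * radius w < Phi w (radius w)) :
    ∃ j, j ≠ 0 ∧ (c : ℝ≥0∞) ^ j ≤ boxZ (extWeight w) j j := by
  by_contra! hlt
  have hc0 : (c : ℝ≥0∞) ≠ 0 := fun h => by simpa [h] using hlt 1 one_ne_zero
  have hP0 : Phi w (radius w) ≠ 0 := Phi_ne_zero hw0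
  obtain ⟨x, hx, hxc⟩ : ∃ x, radius w / Phi w (radius w) < x ∧ x < (c : ℝ≥0∞)⁻¹ := by
    refine exists_between ?_
    rw [ENNReal.div_lt_iff (Or.inl hP0) (Or.inl (Phi_radius_lt_top hw0 hnu).ne), mul_comm,
      ← div_eq_mul_inv, ENNReal.lt_div_iff_mul_lt (Or.inl hc0) (Or.inl (by simp)), mul_comm]
    exact hc
  rw [ENNReal.div_lt_iff (Or.inl hP0) (Or.inl (Phi_radius_lt_top hw0 hnu).ne)] at hx
  refine absurd (mul_Phi_radius_le_of_forestGF_ne_top hw0 hw2 hnu ?_ ?_) hx.not_ge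
  · rintro rfl
    simp at hx
  · refine forestGF_one_ne_top (by simpa using hw0.ne') (by simpa [pos_iff_ne_zero] using hw2)
      ENNReal.coe_ne_top (fun j hj => (hlt j hj).le) ?_
    rwa [← one_div, ENNReal.lt_div_iff_mul_lt (Or.inl hc0) (Or.inl (by simp)), mul_comm] at hxc

lemma exists_mul_pow_le_boxZ_pred_of_mod_eq (w : ℕ → ℝ≥0∞) {c : ℝ≥0∞} (hc0 : c ≠ 0) (hc : c ≠ ∞)
    {j : ℕ} (h : c ^ j ≤ boxZ w j j) (a : ℕ) :
    ∃ κ : ℝ≥0∞, 0 < κ ∧ ∀ n, n % j = a → n ≠ 0 → boxZ w (n - 1) n ≠ 0 →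
      κ * c ^ n ≤ boxZ w (n - 1) n := by
  classical
  by_cases hex : ∃ n, n % j = a ∧ n ≠ 0 ∧ boxZ w (n - 1) n ≠ 0
  swap
  · exact ⟨1, one_pos, fun n hna hn hZ => absurd ⟨n, hna, hn, hZ⟩ hex⟩
  obtain ⟨hra, hr0, hrZ⟩ := Nat.find_spec hex
  set r := Nat.find hex
  refine ⟨boxZ w (r - 1) r / c ^ r, ENNReal.div_pos hrZ (by finiteness), fun n hna hn hZ => ?_⟩
  have hrn : r ≤ n := Nat.find_min' hex ⟨hna, hn, hZ⟩
  obtain ⟨q, hq⟩ : j ∣ n - r := (Nat.modEq_iff_dvd' hrn).1 (hra.trans hna.symm)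
  obtain rfl : n = q * j + r := by rw [mul_comm, ← hq]; omega
  calc boxZ w (r - 1) r / c ^ r * c ^ (q * j + r)
      = (c ^ j) ^ q * (boxZ w (r - 1) r / c ^ r * c ^ r) := by
        rw [pow_add, mul_comm q, pow_mul]; ring
    _ = (c ^ j) ^ q * boxZ w (r - 1) r := by
        rw [ENNReal.div_mul_cancel (pow_ne_zero _ hc0) (by finiteness)]
    _ ≤ boxZ w j j ^ q * boxZ w (r - 1) r := by gcongr
    _ ≤ boxZ w (q * j) (q * j) * boxZ w (r - 1) r := by gcongr; exact boxZ_pow_le w j j q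
    _ ≤ boxZ w (q * j + r - 1) (q * j + r) := boxZ_mul_boxZ_pred_le w _ _ hr0

lemma exists_mul_pow_le_boxZ_pred (w : ℕ → ℝ≥0∞) {c : ℝ≥0∞} (hc0 : c ≠ 0) (hc : c ≠ ∞)
    (h : ∃ j, j ≠ 0 ∧ c ^ j ≤ boxZ w j j) :
    ∃ κ : ℝ≥0∞, κ ≠ 0 ∧ ∀ n, n ≠ 0 → boxZ w (n - 1) n ≠ 0 → κ * c ^ n ≤ boxZ w (n - 1) n := by
  obtain ⟨j, hj, hcj⟩ := h
  choose κ hκ0 hκ using exists_mul_pow_le_boxZ_pred_of_mod_eq w hc0 hc hcj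
  refine ⟨(Finset.range j).inf κ, ((Finset.lt_inf_iff (by simp)).2 fun a _ => hκ0 a).ne',
    fun n hn hZ => le_trans ?_ (hκ (n % j) n rfl hn hZ)⟩
  gcongr
  exact Finset.inf_le (Finset.mem_range.2 (Nat.mod_lt _ (Nat.pos_of_ne_zero hj)))

lemma exists_pow_le_boxZ_mul_of_radius_eq_zero (hw0 : 0 < w 0) (h : radius w = 0) {k : ℕ}
    (hk : k ≠ 0) {C : ℝ≥0} (hC : 1 ≤ C) :
    ∃ a, a ≠ 0 ∧ (C : ℝ≥0∞) ^ a ≤ boxZ (extWeight w) (a * k) a := by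
  set m := min (w 0) 1
  have hm0 : 0 < m := lt_min hw0 one_pos
  obtain ⟨a, hka, hCa⟩ := exists_pow_le_of_radius_eq_zero h (C / m) (k + 1)
  have hone : 1 ≤ (C / m) ^ a :=
    one_le_pow₀ ((one_le_div hm0).2 ((min_le_right _ _).trans hC))
  have hpow : C ^ a ≤ w a ^ k * w 0 ^ (a - k) := by
    calc C ^ a = (C / m) ^ a * m ^ a := by rw [← mul_pow, div_mul_cancel₀ _ hm0.ne']
      _ ≤ ((C / m) ^ a) ^ k * m ^ (a - k) := mul_le_mul' (le_self_pow₀ hone hk)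
          (pow_le_pow_of_le_one zero_le (min_le_right _ _) (by omega))
      _ ≤ w a ^ k * w 0 ^ (a - k) := by gcongr; exact min_le_left _ _
  refine ⟨a, by omega, ?_⟩
  calc (C : ℝ≥0∞) ^ a ≤ extWeight w a ^ k * extWeight w 0 ^ (a - k) := by exact_mod_cast hpow
    _ ≤ boxZ (extWeight w) (k * a) k * boxZ (extWeight w) ((a - k) * 0) (a - k) := by
        gcongr <;> exact pow_le_boxZ ..
    _ ≤ boxZ (extWeight w) (k * a + (a - k) * 0) (k + (a - k)) := boxZ_mul_boxZ_le ..
    _ = boxZ (extWeight w) (a * k) a := by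
        rw [mul_zero, add_zero, mul_comm, Nat.add_sub_cancel' (by omega)]

lemma exists_mul_pow_le_boxZ_mul (w : ℕ → ℝ≥0∞) {a k : ℕ} (ha : a ≠ 0) (hwk : w k ≠ 0)
    {C : ℝ≥0∞} (hC : 1 ≤ C) (hCtop : C ≠ ∞) (h : C ^ a ≤ boxZ w (a * k) a) :
    ∃ κ : ℝ≥0∞, κ ≠ 0 ∧ ∀ j, κ * C ^ j ≤ boxZ w (j * k) j := by
  set b : ℝ≥0∞ := min (w k) 1
  have hb0 : b ≠ 0 := (lt_min (pos_iff_ne_zero.2 hwk) one_pos).ne'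
  have hCa : C ^ a ≠ 0 := pow_ne_zero _ (one_pos.trans_le hC).ne'
  refine ⟨b ^ a / C ^ a, (ENNReal.div_pos (pow_ne_zero _ hb0) (by finiteness)).ne', fun j => ?_⟩
  have hj : j / a * a + j % a = j := by rw [mul_comm]; exact Nat.div_add_mod j a
  have hmod : j % a ≤ a := (Nat.mod_lt _ (Nat.pos_of_ne_zero ha)).le
  calc b ^ a / C ^ a * C ^ j ≤ b ^ a / C ^ a * C ^ (j / a * a + a) := by
        gcongr _ * ?_
        exact pow_le_pow_right₀ hC (by omega)
    _ = (C ^ a) ^ (j / a) * (b ^ a / C ^ a * C ^ a) := by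
        rw [pow_add, mul_comm (j / a), pow_mul]; ring
    _ = (C ^ a) ^ (j / a) * b ^ a := by rw [ENNReal.div_mul_cancel hCa (by finiteness)]
    _ ≤ boxZ w (a * k) a ^ (j / a) * w k ^ (j % a) := by
        gcongr ?_ ^ _ * ?_
        · exact (pow_le_pow_of_le_one zero_le (min_le_right _ _) hmod).trans
            (by gcongr; exact min_le_left _ _)
    _ ≤ boxZ w (j / a * (a * k)) (j / a * a) * boxZ w (j % a * k) (j % a) := by
        gcongr
        · exact boxZ_pow_le ..
        · exact pow_le_boxZ ..
    _ ≤ boxZ w (j / a * (a * k) + j % a * k) (j / a * a + j % a) := boxZ_mul_boxZ_le ..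
    _ = boxZ w (j * k) j := by rw [← mul_assoc, ← add_mul, hj]

end LowerBounds

/-! ### Occupancy of the boxes -/

section Allocation

variable {w : ℕ → ℝ≥0} {m n : ℕ}

lemma proportionalTo_apply {α : Type*} {f : α → ℝ≥0∞} (a₀ : α) (h0 : tsum f ≠ 0)
    (h1 : tsum f ≠ ∞) (a : α) : proportionalTo f a₀ a = f a / tsum f := by
  rw [proportionalTo, dif_pos ⟨h0, h1⟩, PMF.normalize_apply, div_eq_mul_inv]

lemma treeZ_pos_iff : 0 < treeZ w n ↔ n ≠ 0 ∧ boxZ (extWeight w) (n - 1) n ≠ 0 := by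
  rw [treeZ_eq, pos_iff_ne_zero]
  rcases eq_or_ne n 0 with rfl | hn
  · simp [forestZ_zero_right]
  · simp [← natCast_mul_forestZ_one _ hn, hn]

lemma sizes_le_atTop : sizes w ≤ atTop := inf_le_left

lemma eventually_boxZ_ne_zero :
    ∀ᶠ n in sizes w, n ≠ 0 ∧ boxZ (extWeight w) (n - 1) n ≠ 0 := by
  filter_upwards [mem_inf_of_right (mem_principal_self _)] with n hn using treeZ_pos_iff.1 hn

lemma extWeight_ne_top (k : ℕ) : extWeight w k ≠ ∞ := ENNReal.coe_ne_top

lemma boxZ_mul_allocation (hZ : boxZ (extWeight w) m n ≠ 0) (y : Fin n → ℕ) :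
    boxZ (extWeight w) m n * allocation w m n y =
      if ∑ i, y i = m then ∏ i, (w (y i) : ℝ≥0∞) else 0 := by
  have htotal := tsum_ite_sum_eq_boxZ (extWeight w) m n
  have htop := boxZ_ne_top (extWeight_ne_top (w := w)) m n
  rw [allocation, proportionalTo_apply _ (by rwa [htotal]) (by rwa [htotal]), htotal,
    ENNReal.mul_div_cancel hZ htop]

lemma boxZ_mul_lintegral_allocation (hZ : boxZ (extWeight w) m n ≠ 0)
    (g : (Fin n → ℕ) → ℝ≥0∞) :
    boxZ (extWeight w) m n * ∫⁻ y, g y ∂(allocation w m n).toMeasure =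
      ∑' y : Fin n → ℕ, (if ∑ i, y i = m then ∏ i, (w (y i) : ℝ≥0∞) else 0) * g y := by
  rw [lintegral_countable', ← ENNReal.tsum_mul_left]
  refine tsum_congr fun y => ?_
  rw [PMF.toMeasure_apply_singleton _ _ (measurableSet_singleton y), ← boxZ_mul_allocation hZ]
  ring

lemma ae_allocation (hZ : boxZ (extWeight w) m n ≠ 0) :
    ∀ᵐ y ∂(allocation w m n).toMeasure, ∑ i, y i = m ∧ ∀ i, w (y i) ≠ 0 := by
  refine ae_iff_of_countable.2 fun y hy => ?_
  rw [PMF.toMeasure_apply_singleton _ _ (measurableSet_singleton y)] at hy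
  have hne := mul_ne_zero hZ hy
  rw [boxZ_mul_allocation hZ] at hne
  simpa [Finset.prod_eq_zero_iff] using hne

lemma prod_mk_ite_mem_imp_eq {R : Type*} [CommSemiring R] (u : ℕ → R) (I : Finset (Fin n))
    (c : Fin n → ℕ) :
    ∏ i, PowerSeries.mk (fun a => if i ∈ I → a = c i then u a else 0) =
      PowerSeries.C (∏ i ∈ I, u (c i)) *
        (PowerSeries.X ^ (∑ i ∈ I, c i) * PowerSeries.mk u ^ (n - I.card)) := by
  classical
  have hmem : ∏ i ∈ I, PowerSeries.mk (fun a => if i ∈ I → a = c i then u a else 0) =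
      PowerSeries.C (∏ i ∈ I, u (c i)) * PowerSeries.X ^ (∑ i ∈ I, c i) := by
    rw [map_prod, ← Finset.prod_pow_eq_pow_sum, ← Finset.prod_mul_distrib]
    refine Finset.prod_congr rfl fun i hi => ?_
    ext a
    rw [PowerSeries.coeff_mk, PowerSeries.coeff_C_mul, PowerSeries.coeff_X_pow]
    by_cases ha : a = c i <;> simp [hi, ha]
  have hcompl : ∏ i ∈ Iᶜ, PowerSeries.mk (fun a => if i ∈ I → a = c i then u a else 0) =
      PowerSeries.mk u ^ (n - I.card) := by
    rw [Finset.prod_congr rfl (g := fun _ => PowerSeries.mk u) fun i hi => by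
        simp [Finset.mem_compl.1 hi],
      Finset.prod_const, Finset.card_compl, Fintype.card_fin]
  rw [← Finset.prod_mul_prod_compl I, hmem, hcompl, mul_assoc]

lemma boxZ_mul_allocation_forall_eq (hZ : boxZ (extWeight w) m n ≠ 0) (I : Finset (Fin n))
    (c : Fin n → ℕ) :
    boxZ (extWeight w) m n * (allocation w m n).toMeasure {y | ∀ i ∈ I, y i = c i} =
      if ∑ i ∈ I, c i ≤ m then (∏ i ∈ I, (w (c i) : ℝ≥0∞)) *
        boxZ (extWeight w) (m - ∑ i ∈ I, c i) (n - I.card) else 0 := by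
  classical
  rw [← lintegral_indicator_one .of_discrete, boxZ_mul_lintegral_allocation hZ]
  have hprod (y : Fin n → ℕ) : (∏ i, (w (y i) : ℝ≥0∞)) *
      {y : Fin n → ℕ | ∀ i ∈ I, y i = c i}.indicator 1 y =
      ∏ i, (if i ∈ I → y i = c i then extWeight w (y i) else 0) := by
    rw [Finset.prod_ite_zero]
    simp [Set.indicator_apply]
  simp only [ite_mul, zero_mul, hprod]
  rw [tsum_ite_sum_eq_prod (fun i a => if i ∈ I → a = c i then extWeight w a else 0),
    prod_mk_ite_mem_imp_eq, PowerSeries.coeff_C_mul, PowerSeries.coeff_X_pow_mul']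
  simp only [mul_ite, mul_zero]
  rfl

lemma boxZ_mul_pow_le (w : ℕ → ℝ≥0∞) (t : ℝ≥0∞) (m n : ℕ) :
    boxZ w m n * t ^ m ≤ (∑' k, w k * t ^ k) ^ n := by
  induction n generalizing m with
  | zero =>
    rw [boxZ_zero]
    split_ifs with h <;> simp [h]
  | succ n ih =>
    rw [boxZ_succ, pow_succ', Finset.sum_mul]
    calc ∑ p ∈ Finset.HasAntidiagonal.antidiagonal m, w p.1 * boxZ w p.2 n * t ^ m
        ≤ ∑ p ∈ Finset.HasAntidiagonal.antidiagonal m,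
            w p.1 * t ^ p.1 * (∑' k, w k * t ^ k) ^ n := by
          refine Finset.sum_le_sum fun p hp => ?_
          rw [← Finset.HasAntidiagonal.mem_antidiagonal.1 hp, pow_add]
          calc _ = w p.1 * t ^ p.1 * (boxZ w p.2 n * t ^ p.2) := by ring
            _ ≤ _ := by gcongr; exact ih _
      _ = (∑ k ∈ Finset.range m.succ, w k * t ^ k) * (∑' k, w k * t ^ k) ^ n := by
          rw [Finset.Nat.sum_antidiagonal_eq_sum_range_succ_mk, Finset.sum_mul]
      _ ≤ _ := by gcongr; exact ENNReal.sum_le_tsum _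

lemma offspring_apply (hw0 : 0 < w 0) (hnu : nu w < 1) (k : ℕ) :
    offspring w k = w k * radius w ^ k / Phi w (radius w) :=
  proportionalTo_apply 0 (Phi_ne_zero hw0) (Phi_radius_lt_top hw0 hnu).ne k

lemma Phi_mul_offspring (hw0 : 0 < w 0) (hnu : nu w < 1) (k : ℕ) :
    Phi w (radius w) * offspring w k = w k * radius w ^ k := by
  rw [offspring_apply hw0 hnu,
    ENNReal.mul_div_cancel (Phi_ne_zero hw0) (Phi_radius_lt_top hw0 hnu).ne]

lemma tsum_mul_offspring (hw0 : 0 < w 0) (hnu : nu w < 1) :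
    ∑' k : ℕ, (k : ℝ≥0∞) * offspring w k = nu w := by
  refine (ENNReal.mul_right_inj (Phi_ne_zero hw0) (Phi_radius_lt_top hw0 hnu).ne).1 ?_
  simp only [← ENNReal.tsum_mul_left, mul_left_comm (Phi w _), Phi_mul_offspring hw0 hnu]
  rw [tsum_mul_radius_pow hw0 hnu, mul_comm]

lemma sum_toReal_pmf_le_one {α : Type*} (p : PMF α) (J : Finset α) :
    ∑ a ∈ J, (p a).toReal ≤ 1 := by
  rw [← ENNReal.toReal_sum fun a _ => p.apply_ne_top a]
  refine ENNReal.toReal_le_of_le_ofReal zero_le_one ?_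
  rw [ENNReal.ofReal_one, ← p.tsum_coe]
  exact ENNReal.sum_le_tsum J

end Allocation

section BoxCount

variable {w : ℕ → ℝ≥0} {m n : ℕ}

/-- The number `N_k` of boxes with `k` balls. -/
def boxCount (y : Fin n → ℕ) (k : ℕ) : ℕ := (Finset.univ.filter fun i => y i = k).card

/-- The law of the random allocation `B_{n-1,n}` as a measure. -/
abbrev boxMeasure (w : ℕ → ℝ≥0) (n : ℕ) : Measure (Fin n → ℕ) :=
  (allocation w (n - 1) n).toMeasure

lemma boxCount_le (y : Fin n → ℕ) (k : ℕ) : boxCount y k ≤ n := by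
  simpa [boxCount] using Finset.card_filter_le (Finset.univ : Finset (Fin n)) fun i => y i = k

lemma prod_ite_eq_pow_boxCount (y : Fin n → ℕ) (k : ℕ) (x : ℝ≥0∞) :
    ∏ i, (if y i = k then x else 1) = x ^ boxCount y k := by
  simp [boxCount, Finset.prod_ite]

lemma tendsto_zero_of_mul_pow_le {l : Filter ℕ} (hl : l ≤ atTop) {f : ℕ → ℝ≥0∞}
    {κ A Q X : ℝ≥0∞} (hκ : κ ≠ 0) (hA : A ≠ ∞) (hQX : Q < X) (hX : X ≠ ∞)
    (h : ∀ᶠ n in l, f n * (κ * X ^ n) ≤ A * Q ^ n) : Tendsto f l (𝓝 0) := by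
  have hX0 : X ≠ 0 := (zero_le.trans_lt hQX).ne'
  have hratio : Q / X < 1 := (ENNReal.div_lt_iff (.inl hX0) (.inl hX)).2 (by rwa [one_mul])
  have hgeom : Tendsto (fun n : ℕ => A / κ * (Q / X) ^ n) l (𝓝 0) := by
    simpa using (ENNReal.Tendsto.const_mul (ENNReal.tendsto_pow_atTop_nhds_zero_of_lt_one hratio)
      (.inr (ENNReal.div_ne_top hA hκ))).mono_left hl
  refine tendsto_of_tendsto_of_tendsto_of_le_of_le' tendsto_const_nhds hgeom
    (.of_forall fun _ => zero_le) ?_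
  filter_upwards [h] with n hn
  have hXn : X ^ n ≠ 0 := pow_ne_zero _ hX0
  have hQ : Q ≠ ∞ := hQX.ne_top
  calc f n ≤ A * Q ^ n / (κ * X ^ n) :=
        (ENNReal.le_div_iff_mul_le (.inl (mul_ne_zero hκ hXn)) (.inr (by finiteness))).2 hn
    _ = A / κ * (Q / X) ^ n := by
        simp only [div_eq_mul_inv, mul_pow]
        rw [ENNReal.mul_inv (.inl hκ) (.inr hXn), ENNReal.inv_pow]
        ring

lemma tendsto_boxMeasure_biUnion {κ : Type*} (J : Finset κ) (s : κ → ∀ n, Set (Fin n → ℕ))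
    (h : ∀ j ∈ J, Tendsto (fun n => boxMeasure w n (s j n)) (sizes w) (𝓝 0)) :
    Tendsto (fun n => boxMeasure w n (⋃ j ∈ J, s j n)) (sizes w) (𝓝 0) :=
  tendsto_of_tendsto_of_tendsto_of_le_of_le tendsto_const_nhds
    (by simpa using tendsto_finsetSum J h) (fun _ => zero_le) fun _ => measure_biUnion_finset_le J _

lemma allocation_mul_le_boxZ_tilted (hZ : boxZ (extWeight w) m n ≠ 0) (u : ℕ → ℝ≥0∞) (D : ℝ≥0∞)
    {s : Set (Fin n → ℕ)} (hs : ∀ y ∈ s, D ≤ ∏ i, u (y i)) :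
    (allocation w m n).toMeasure s * D * boxZ (extWeight w) m n ≤
      boxZ (fun j => u j * w j) m n := by
  have hmarkov : (allocation w m n).toMeasure s * D ≤
      ∫⁻ y, ∏ i, u (y i) ∂(allocation w m n).toMeasure := by
    rw [mul_comm]
    exact (mul_le_mul_right (measure_mono hs) _).trans
      (mul_meas_ge_le_lintegral .of_discrete _)
  refine (mul_le_mul_left hmarkov _).trans_eq ?_
  rw [mul_comm, boxZ_mul_lintegral_allocation hZ, ← tsum_ite_sum_eq_boxZ]
  refine tsum_congr fun y => ?_
  simp [← Finset.prod_mul_distrib, mul_comm]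

/-- The Chernoff bound: the exponential growth rate of the partition function is
`Φ(ρ) / ρ`, so an event on which the weight `∏ u_{y_i}` gains more than the growth rate allows
is exponentially unlikely. -/
lemma tendsto_boxMeasure_of_tilt (hw0 : 0 < w 0) (hw2 : ∃ k, 2 ≤ k ∧ 0 < w k) (hnu : nu w < 1)
    (hr : radius w ≠ 0) {u : ℕ → ℝ≥0∞} {D : ℝ≥0∞} (hD : D ≠ ∞)
    (hu : ∑' j, u j * (w j : ℝ≥0∞) * radius w ^ j < D * Phi w (radius w))
    {s : ∀ n, Set (Fin n → ℕ)} (hs : ∀ n, ∀ y ∈ s n, D ^ n ≤ ∏ i, u (y i)) :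
    Tendsto (fun n => boxMeasure w n (s n)) (sizes w) (𝓝 0) := by
  have hrt := radius_ne_top hw0 hw2 hnu
  have hD0 : D ≠ 0 := left_ne_zero_of_mul (zero_le.trans_lt hu).ne'
  set S := ∑' j, u j * (w j : ℝ≥0∞) * radius w ^ j
  obtain ⟨c, hSc, hc⟩ : ∃ c : ℝ≥0, S / (D * radius w) < c ∧
      (c : ℝ≥0∞) < Phi w (radius w) / radius w := by
    rw [← ENNReal.lt_iff_exists_nnreal_btwn, ENNReal.div_lt_iff
      (.inl (mul_ne_zero hD0 hr)) (.inl (by finiteness)), mul_left_comm,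
      ENNReal.div_mul_cancel hr hrt]
    exact hu
  have hc0 : (c : ℝ≥0∞) ≠ 0 := (zero_le.trans_lt hSc).ne'
  rw [ENNReal.lt_div_iff_mul_lt (.inl hr) (.inl hrt)] at hc
  rw [ENNReal.div_lt_iff (.inl (mul_ne_zero hD0 hr)) (.inl (by finiteness))] at hSc
  obtain ⟨κ, hκ0, hκ⟩ := exists_mul_pow_le_boxZ_pred (extWeight w) hc0 ENNReal.coe_ne_top
    (exists_pow_le_boxZ_self hw0 hw2 hnu hc)
  refine tendsto_zero_of_mul_pow_le sizes_le_atTop hκ0 hrt hSc (by finiteness) ?_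
  filter_upwards [eventually_boxZ_ne_zero] with n ⟨hn, hZ⟩
  calc boxMeasure w n (s n) * (κ * (c * (D * radius w)) ^ n)
      = boxMeasure w n (s n) * D ^ n * (κ * c ^ n) * radius w ^ (n - 1 + 1) := by
        rw [Nat.sub_add_cancel (Nat.pos_of_ne_zero hn)]
        ring
    _ ≤ boxMeasure w n (s n) * D ^ n * boxZ (extWeight w) (n - 1) n * radius w ^ (n - 1 + 1) := by
        gcongr
        exact hκ n hn hZ
    _ ≤ boxZ (fun j => u j * w j) (n - 1) n * radius w ^ (n - 1 + 1) := by
        gcongr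
        exact allocation_mul_le_boxZ_tilted hZ u _ (hs n)
    _ = radius w * (boxZ (fun j => u j * w j) (n - 1) n * radius w ^ (n - 1)) := by ring
    _ ≤ radius w * S ^ n := by
        gcongr
        exact boxZ_mul_pow_le _ _ _ _

lemma tsum_tilted_mul_pow (hw0 : 0 < w 0) (hnu : nu w < 1) (k : ℕ) (z : ℝ≥0∞) :
    ∑' j, (if j = k then 1 + z else 1) * (w j : ℝ≥0∞) * radius w ^ j =
      (1 + offspring w k * z) * Phi w (radius w) := by
  have hsplit (j : ℕ) : (if j = k then 1 + z else 1) * (w j : ℝ≥0∞) * radius w ^ j =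
      w j * radius w ^ j + if j = k then z * (w j * radius w ^ j) else 0 := by
    split_ifs <;> ring
  simp only [hsplit]
  rw [ENNReal.tsum_add, tsum_ite_eq, ← Phi_mul_offspring hw0 hnu, ← Phi]
  ring

lemma exists_tilt {p ε : ℝ} (hp0 : 0 ≤ p) (hp1 : p ≤ 1) (hε : 0 < ε) :
    ∃ z D : ℝ≥0, 1 + p * z < D ∧
      ∀ n N : ℕ, (p + ε) * n ≤ N → D ^ n ≤ (1 + z) ^ N := by
  have hx : (0 : ℝ) < 1 + ε / 2 := by positivity
  refine ⟨⟨ε / 2, by positivity⟩, ⟨Real.exp ((p + ε) * Real.log (1 + ε / 2)), (Real.exp_pos _).le⟩,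
    ?_, fun n N h => ?_⟩
  · change 1 + p * (ε / 2) < Real.exp ((p + ε) * Real.log (1 + ε / 2))
    have hlog : ε / 2 / (1 + ε / 2) ≤ Real.log (1 + ε / 2) := by
      convert Real.one_sub_inv_le_log_of_pos hx using 1
      field_simp
      ring
    calc 1 + p * (ε / 2) < 1 + (p + ε) * (ε / 2 / (1 + ε / 2)) := by
          gcongr 1 + ?_
          rw [← mul_div_assoc (p + ε), lt_div_iff₀ hx]
          nlinarith [mul_pos hε hε, mul_nonneg (sub_nonneg.2 hp1) (mul_pos hε hε).le]
      _ ≤ (p + ε) * Real.log (1 + ε / 2) + 1 := by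
          rw [add_comm]
          gcongr
      _ ≤ Real.exp ((p + ε) * Real.log (1 + ε / 2)) := Real.add_one_le_exp _
  · rw [← NNReal.coe_le_coe]
    push_cast
    change Real.exp _ ^ n ≤ (1 + ε / 2) ^ N
    have hlog : 0 ≤ Real.log (1 + ε / 2) := Real.log_nonneg (by linarith)
    rw [← Real.exp_nat_mul]
    nth_rw 2 [← Real.exp_log hx]
    rw [← Real.exp_nat_mul, Real.exp_le_exp]
    nlinarith [mul_le_mul_of_nonneg_right h hlog]

lemma tendsto_boxMeasure_le_boxCount_of_radius_ne_zero (hw0 : 0 < w 0)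
    (hw2 : ∃ k, 2 ≤ k ∧ 0 < w k) (hnu : nu w < 1) (hr : radius w ≠ 0) (k : ℕ) {ε : ℝ}
    (hε : 0 < ε) :
    Tendsto (fun n => boxMeasure w n {y | ((offspring w k).toReal + ε) * n ≤ boxCount y k})
      (sizes w) (𝓝 0) := by
  obtain ⟨z, D, hD, hDpow⟩ := exists_tilt ENNReal.toReal_nonneg
    (by simpa using sum_toReal_pmf_le_one (offspring w) {k}) hε
  have hzD : 1 + offspring w k * z < D := by
    have hfin : offspring w k ≠ ∞ := PMF.apply_ne_top _ _
    rw [← ENNReal.toReal_lt_toReal (by finiteness) (by finiteness),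
      ENNReal.toReal_add (by finiteness) (by finiteness), ENNReal.toReal_mul]
    simpa using hD
  refine tendsto_boxMeasure_of_tilt hw0 hw2 hnu hr (u := fun j => if j = k then 1 + z else 1)
    (D := D) ENNReal.coe_ne_top ?_ fun n y hy => ?_
  · rw [tsum_tilted_mul_pow hw0 hnu]
    exact ENNReal.mul_lt_mul_left (Phi_ne_zero hw0) (Phi_radius_lt_top hw0 hnu).ne hzD
  · rw [prod_ite_eq_pow_boxCount]
    exact_mod_cast hDpow n _ hy

lemma allocation_forall_eq_const_mul_le (hZ : boxZ (extWeight w) m n ≠ 0) (I : Finset (Fin n))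
    (k : ℕ) :
    (allocation w m n).toMeasure {y | ∀ i ∈ I, y i = k} * boxZ (extWeight w) (I.card * k) I.card ≤
      (w k : ℝ≥0∞) ^ I.card := by
  have hcard : I.card ≤ n := by simpa using Finset.card_le_univ I
  refine (ENNReal.mul_le_mul_iff_right hZ (boxZ_ne_top extWeight_ne_top m n)).1 ?_
  rw [← mul_assoc, boxZ_mul_allocation_forall_eq hZ I fun _ => k, Finset.sum_const,
    Finset.prod_const, smul_eq_mul]
  split_ifs with h
  · have hmul := boxZ_mul_boxZ_le (extWeight w) (m - I.card * k) (I.card * k) (n - I.card) I.card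
    rw [Nat.sub_add_cancel h, Nat.sub_add_cancel hcard] at hmul
    rw [mul_assoc, mul_comm (boxZ _ m n)]
    gcongr
  · simp

lemma allocation_le_boxCount_mul_le (hZ : boxZ (extWeight w) m n ≠ 0) (j k : ℕ) :
    (allocation w m n).toMeasure {y | j ≤ boxCount y k} * boxZ (extWeight w) (j * k) j ≤
      2 ^ n * (w k : ℝ≥0∞) ^ j := by
  set 𝒥 := (Finset.univ : Finset (Fin n)).powersetCard j
  have hunion : {y : Fin n → ℕ | j ≤ boxCount y k} ⊆ ⋃ J ∈ 𝒥, {y | ∀ i ∈ J, y i = k} := by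
    intro y hy
    obtain ⟨J, hJ, hcard⟩ := Finset.exists_subset_card_eq hy
    exact Set.mem_biUnion (Finset.mem_powersetCard.2 ⟨Finset.subset_univ J, hcard⟩)
      fun i hi => (Finset.mem_filter.1 (hJ hi)).2
  calc _ ≤ (∑ J ∈ 𝒥, (allocation w m n).toMeasure {y | ∀ i ∈ J, y i = k}) *
        boxZ (extWeight w) (j * k) j := by
        gcongr
        exact (measure_mono hunion).trans (measure_biUnion_finset_le _ _)
    _ ≤ ∑ _J ∈ 𝒥, (w k : ℝ≥0∞) ^ j := by
        rw [Finset.sum_mul]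
        refine Finset.sum_le_sum fun _ hJ => ?_
        rw [← (Finset.mem_powersetCard.1 hJ).2]
        exact allocation_forall_eq_const_mul_le hZ _ k
    _ ≤ 2 ^ n * (w k : ℝ≥0∞) ^ j := by
        rw [Finset.sum_const, Finset.card_powersetCard, Finset.card_univ, Fintype.card_fin,
          nsmul_eq_mul]
        gcongr
        exact_mod_cast Nat.choose_le_two_pow n j

lemma tendsto_boxMeasure_le_boxCount_of_eq_zero {k : ℕ} (hwk : w k = 0) {δ : ℝ} (hδ : 0 < δ) :
    Tendsto (fun n => boxMeasure w n {y | δ * n ≤ boxCount y k}) (sizes w) (𝓝 0) := by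
  refine tendsto_const_nhds.congr' ?_
  filter_upwards [eventually_boxZ_ne_zero] with n ⟨hn, hZ⟩
  refine (measure_eq_zero_iff_ae_notMem.2 ?_).symm
  filter_upwards [ae_allocation hZ] with y ⟨_, hy⟩ hle
  have hcount : boxCount y k = 0 := by
    rw [boxCount, Finset.card_eq_zero, Finset.filter_eq_empty_iff]
    rintro i - rfl
    exact hy i hwk
  have hpos : 0 < δ * n := by positivity
  simp only [hcount, Nat.cast_zero] at hle
  exact hle.not_gt hpos

lemma tendsto_boxMeasure_le_boxCount_of_radius_eq_zero (hw0 : 0 < w 0) (hr : radius w = 0) {k : ℕ}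
    (hk : k ≠ 0) {δ : ℝ} (hδ : 0 < δ) :
    Tendsto (fun n => boxMeasure w n {y | δ * n ≤ boxCount y k}) (sizes w) (𝓝 0) := by
  rcases eq_or_ne (w k) 0 with hwk | hwk
  · exact tendsto_boxMeasure_le_boxCount_of_eq_zero hwk hδ
  obtain ⟨M, hM⟩ := exists_nat_ge (1 / δ)
  have hceil (n : ℕ) : n ≤ M * ⌈δ * n⌉₊ := by
    rw [div_le_iff₀ hδ] at hM
    have : (n : ℝ) ≤ M * ⌈δ * n⌉₊ :=
      calc (n : ℝ) ≤ (M * δ) * n := le_mul_of_one_le_left (by positivity) hM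
        _ = M * (δ * n) := mul_assoc _ _ _
        _ ≤ _ := by gcongr; exact Nat.le_ceil _
    exact_mod_cast this
  set C : ℝ≥0 := w k * 4 ^ M + 1
  have hC1 : 1 ≤ C := le_add_self
  obtain ⟨a, ha, hCa⟩ := exists_pow_le_boxZ_mul_of_radius_eq_zero hw0 hr hk hC1
  obtain ⟨κ, hκ0, hκ⟩ := exists_mul_pow_le_boxZ_mul (extWeight w) ha
    (ENNReal.coe_ne_zero.2 hwk) (by exact_mod_cast hC1) ENNReal.coe_ne_top hCa
  refine tendsto_zero_of_mul_pow_le sizes_le_atTop hκ0 ENNReal.one_ne_top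
    (Q := 2) (X := 4) (by norm_num) (by norm_num) ?_
  filter_upwards [eventually_boxZ_ne_zero] with n ⟨_, hZ⟩
  set j := ⌈δ * n⌉₊
  have hwj : (w k : ℝ≥0∞) ^ j ≠ 0 := by simp [hwk]
  refine (ENNReal.mul_le_mul_iff_left hwj (by finiteness)).1 ?_
  calc boxMeasure w n {y | δ * n ≤ boxCount y k} * (κ * 4 ^ n) * w k ^ j
      ≤ boxMeasure w n {y | j ≤ boxCount y k} * (κ * 4 ^ (M * j)) * w k ^ j := by
        gcongr ?_ * (_ * ?_) * _
        · exact measure_mono fun y hy => Nat.ceil_le.2 hy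
        · exact pow_le_pow_right₀ (by norm_num) (hceil n)
    _ = boxMeasure w n {y | j ≤ boxCount y k} * (κ * (w k * 4 ^ M) ^ j) := by ring
    _ ≤ boxMeasure w n {y | j ≤ boxCount y k} * boxZ (extWeight w) (j * k) j := by
        gcongr
        refine le_trans ?_ (hκ j)
        gcongr
        simp [C]
    _ ≤ 1 * 2 ^ n * w k ^ j := by
        rw [one_mul]
        exact allocation_le_boxCount_mul_le hZ j k

lemma offspring_zero_of_radius_eq_zero (hw0 : 0 < w 0) (hnu : nu w < 1) (hr : radius w = 0) :
    offspring w 0 = 1 := by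
  rw [offspring_apply hw0 hnu, hr, Phi_zero, pow_zero, mul_one,
    ENNReal.div_self (ENNReal.coe_ne_zero.2 hw0.ne') ENNReal.coe_ne_top]

lemma tendsto_boxMeasure_le_boxCount (hw0 : 0 < w 0) (hw2 : ∃ k, 2 ≤ k ∧ 0 < w k) (hnu : nu w < 1)
    (k : ℕ) {ε : ℝ} (hε : 0 < ε) :
    Tendsto (fun n => boxMeasure w n {y | ((offspring w k).toReal + ε) * n ≤ boxCount y k})
      (sizes w) (𝓝 0) := by
  rcases ne_or_eq (radius w) 0 with hr | hr
  · exact tendsto_boxMeasure_le_boxCount_of_radius_ne_zero hw0 hw2 hnu hr k hε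
  rcases ne_or_eq k 0 with hk | rfl
  · have hk0 : offspring w k = 0 := by rw [offspring_apply hw0 hnu, hr]; simp [hk]
    simpa [hk0] using tendsto_boxMeasure_le_boxCount_of_radius_eq_zero hw0 hr hk hε
  · refine tendsto_const_nhds.congr' ?_
    filter_upwards [eventually_boxZ_ne_zero] with n ⟨hn, _⟩
    refine (measure_eq_zero_iff_ae_notMem.2 (.of_forall fun y hy => ?_)).symm
    simp only [offspring_zero_of_radius_eq_zero hw0 hnu hr, ENNReal.toReal_one,
      Set.mem_ofPred_eq] at hy
    have hcount : (boxCount y 0 : ℝ) ≤ n := by exact_mod_cast boxCount_le y 0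
    have hpos : 0 < ε * n := by positivity
    linarith

lemma le_sum_boxCount_add (y : Fin n → ℕ) (K : ℕ) :
    (n : ℝ) ≤ ∑ k ∈ Finset.range (K + 1), (boxCount y k : ℝ) + (∑ i, y i : ℕ) / (K + 1) := by
  have hbox (i : Fin n) : (1 : ℝ) ≤
      ∑ k ∈ Finset.range (K + 1), (if y i = k then (1 : ℝ) else 0) + (y i : ℝ) / (K + 1) := by
    rw [Finset.sum_ite_eq]
    split_ifs with h
    · exact le_add_of_nonneg_right (by positivity)
    · rw [Finset.mem_range, not_lt] at h
      rw [zero_add, one_le_div (by positivity)]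
      exact_mod_cast h
  have hsum := Finset.sum_le_sum fun i (_ : i ∈ Finset.univ) => hbox i
  rw [Finset.sum_add_distrib, Finset.sum_comm, ← Finset.sum_div] at hsum
  simpa [boxCount] using hsum

lemma sub_mul_le_boxCount {y : Fin n → ℕ} (hy : ∑ i, y i ≤ n) {p : ℕ → ℝ} {k K : ℕ} (hk : k ≤ K)
    (hp : ∑ j ∈ Finset.range (K + 1), p j ≤ 1) {η : ℝ}
    (h : ∀ j ∈ (Finset.range (K + 1)).erase k, (boxCount y j : ℝ) ≤ (p j + η) * n) :
    (p k - (K * η + 1 / (K + 1))) * n ≤ boxCount y k := by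
  have hkmem : k ∈ Finset.range (K + 1) := Finset.mem_range.2 (by omega)
  have htotal := le_sum_boxCount_add y K
  rw [← Finset.add_sum_erase _ _ hkmem] at hp htotal
  have hothers := Finset.sum_le_sum h
  rw [← Finset.sum_mul, Finset.sum_add_distrib, Finset.sum_const, nsmul_eq_mul,
    Finset.card_erase_of_mem hkmem, Finset.card_range, Nat.add_sub_cancel] at hothers
  have hballs : ((∑ i, y i : ℕ) : ℝ) / (K + 1) ≤ 1 / (K + 1) * n := by
    rw [one_div_mul_eq_div]
    gcongr
  have hmass := mul_le_mul_of_nonneg_right hp n.cast_nonneg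
  linarith

lemma tendsto_boxMeasure_boxCount_lt (hw0 : 0 < w 0) (hw2 : ∃ k, 2 ≤ k ∧ 0 < w k) (hnu : nu w < 1)
    (k : ℕ) {ε : ℝ} (hε : 0 < ε) :
    Tendsto (fun n => boxMeasure w n {y | boxCount y k < ((offspring w k).toReal - ε) * n})
      (sizes w) (𝓝 0) := by
  obtain ⟨K, hK⟩ := exists_nat_gt (max (2 / ε) k)
  have hkK : k < K := by exact_mod_cast (le_max_right _ _).trans_lt hK
  set η : ℝ := ε / (2 * (K + 1)) with hη
  have herr : K * η + 1 / (K + 1) ≤ ε := by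
    have hεK : 2 < K * ε := (div_lt_iff₀ hε).1 ((le_max_left _ _).trans_lt hK)
    rw [hη, mul_div_assoc', div_add_div _ _ (by positivity) (by positivity),
      div_le_iff₀ (by positivity)]
    nlinarith
  have hupper := tendsto_boxMeasure_biUnion ((Finset.range (K + 1)).erase k)
    (fun j n => {y | ((offspring w j).toReal + η) * n ≤ boxCount y j})
    fun j _ => tendsto_boxMeasure_le_boxCount hw0 hw2 hnu j (by positivity)
  refine tendsto_of_tendsto_of_tendsto_of_le_of_le' tendsto_const_nhds hupper
    (.of_forall fun _ => zero_le) ?_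
  filter_upwards [eventually_boxZ_ne_zero] with n ⟨hn, hZ⟩
  refine measure_mono_ae ?_
  filter_upwards [ae_allocation hZ] with y ⟨hy, _⟩ hyk
  by_contra hcon
  have hothers : ∀ j ∈ (Finset.range (K + 1)).erase k,
      (boxCount y j : ℝ) ≤ ((offspring w j).toReal + η) * n := fun j hj =>
    le_of_not_ge fun hle => hcon (Set.mem_biUnion hj hle)
  have hlower := sub_mul_le_boxCount (by omega) hkK.le (sum_toReal_pmf_le_one _ _) hothers
  refine (lt_of_lt_of_le hyk ?_).not_ge hlower
  gcongr

end BoxCount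

/-! ### Threshold sequences -/

section Threshold

variable {w : ℕ → ℝ≥0} {n : ℕ}

lemma smallBalls_eq_sum_mul_boxCount (y : Fin n → ℕ) {K : ℝ} (hK : 0 ≤ K) :
    smallBalls y K = ∑ j ∈ Finset.range (⌊K⌋₊ + 1), j * boxCount y j := by
  have hbox (i : Fin n) : (if (y i : ℝ) ≤ K then y i else 0) =
      ∑ j ∈ Finset.range (⌊K⌋₊ + 1), j * (if y i = j then 1 else 0) := by
    simp only [mul_ite, mul_one, mul_zero, Finset.sum_ite_eq, Finset.mem_range, Nat.lt_succ_iff,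
      Nat.le_floor_iff hK]
  simp only [smallBalls, Finset.sum_filter, hbox, boxCount, Finset.card_filter, Finset.mul_sum]
  exact Finset.sum_comm

lemma smallBalls_natFloor (y : Fin n → ℕ) {K : ℝ} (hK : 0 ≤ K) :
    smallBalls y (⌊K⌋₊ : ℝ) = smallBalls y K := by
  rw [smallBalls_eq_sum_mul_boxCount y hK, smallBalls_eq_sum_mul_boxCount y (Nat.cast_nonneg _),
    Nat.floor_natCast]

lemma smallBalls_add_largeBalls (y : Fin n → ℕ) (K : ℝ) :
    smallBalls y K + largeBalls y K = ∑ i, y i := by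
  simp only [smallBalls, largeBalls, ← not_le]
  exact Finset.sum_filter_add_sum_filter_not _ _ _

/-- The truncated mean `∑_{j ≤ k} j π_j` of the offspring distribution. -/
def truncatedMean (w : ℕ → ℝ≥0) (k : ℕ) : ℝ :=
  ∑ j ∈ Finset.range (k + 1), (j : ℝ) * (offspring w j).toReal

lemma tendsto_truncatedMean (hw0 : 0 < w 0) (hnu : nu w < 1) :
    Tendsto (truncatedMean w) atTop (𝓝 (nu w).toReal) := by
  have hsum := ENNReal.tendsto_nat_tsum fun j : ℕ => (j : ℝ≥0∞) * offspring w j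
  rw [tsum_mul_offspring hw0 hnu] at hsum
  have hreal := (ENNReal.tendsto_toReal hnu.ne_top).comp hsum
  refine (hreal.comp (tendsto_add_atTop_nat 1)).congr fun k => ?_
  simp only [Function.comp_apply, truncatedMean]
  rw [ENNReal.toReal_sum fun j _ => ENNReal.mul_ne_top (by simp) (PMF.apply_ne_top _ _)]
  simp

lemma abs_smallBalls_div_sub_le (y : Fin n → ℕ) {p : ℕ → ℝ} {k : ℕ} {η : ℝ}
    (h : ∀ j ∈ Finset.range (k + 1), |(boxCount y j : ℝ) / n - p j| ≤ η) :
    |(smallBalls y k : ℝ) / n - ∑ j ∈ Finset.range (k + 1), (j : ℝ) * p j| ≤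
      (k + 1) * (k * η) := by
  rw [smallBalls_eq_sum_mul_boxCount y (Nat.cast_nonneg k), Nat.floor_natCast]
  push_cast
  rw [Finset.sum_div, ← Finset.sum_sub_distrib]
  calc _ ≤ ∑ j ∈ Finset.range (k + 1), |(j : ℝ) * boxCount y j / n - j * p j| :=
        Finset.abs_sum_le_sum_abs _ _
    _ ≤ ∑ _j ∈ Finset.range (k + 1), k * η := by
        refine Finset.sum_le_sum fun j hj => ?_
        rw [mul_div_assoc, ← mul_sub, abs_mul, Nat.abs_cast]
        have hjk : j ≤ k := Finset.mem_range_succ_iff.1 hj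
        gcongr
        exact h j hj
    _ = (k + 1) * (k * η) := by simp

lemma tendsto_boxMeasure_abs_boxCount (hw0 : 0 < w 0) (hw2 : ∃ k, 2 ≤ k ∧ 0 < w k) (hnu : nu w < 1)
    (k : ℕ) {ε : ℝ} (hε : 0 < ε) :
    Tendsto (fun n => boxMeasure w n
      {y | ε < |(boxCount y k : ℝ) / n - (offspring w k).toReal|}) (sizes w) (𝓝 0) := by
  have hbound := (tendsto_boxMeasure_le_boxCount hw0 hw2 hnu k hε).add
    (tendsto_boxMeasure_boxCount_lt hw0 hw2 hnu k hε)
  rw [add_zero] at hbound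
  refine tendsto_of_tendsto_of_tendsto_of_le_of_le' tendsto_const_nhds hbound
    (.of_forall fun _ => zero_le) ?_
  filter_upwards [eventually_boxZ_ne_zero] with n ⟨hn, _⟩
  refine (measure_mono fun y hy => ?_).trans (measure_union_le _ _)
  have hn0 : (0 : ℝ) < n := by positivity
  rcases lt_abs.1 (show ε < |_ - _| from hy) with h | h
  · rw [lt_sub_iff_add_lt', lt_div_iff₀ hn0] at h
    exact Or.inl h.le
  · rw [neg_sub, lt_sub_comm, div_lt_iff₀ hn0] at h
    exact Or.inr h

lemma tendsto_boxMeasure_abs_smallBalls_natCast (hw0 : 0 < w 0) (hw2 : ∃ k, 2 ≤ k ∧ 0 < w k)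
    (hnu : nu w < 1) (k : ℕ) {ε : ℝ} (hε : 0 < ε) :
    Tendsto (fun n => boxMeasure w n {y | ε < |(smallBalls y k : ℝ) / n - truncatedMean w k|})
      (sizes w) (𝓝 0) := by
  set η : ℝ := ε / ((k + 1) * (k + 1)) with hη
  have hη0 : 0 < η := by positivity
  have hηε : (k + 1) * (k * η) ≤ ε := by
    calc (k + 1) * (k * η) ≤ (k + 1) * ((k + 1) * η) := by gcongr; linarith
      _ = ε := by rw [hη]; field_simp
  refine tendsto_of_tendsto_of_tendsto_of_le_of_le tendsto_const_nhds
    (tendsto_boxMeasure_biUnion (Finset.range (k + 1)) _ fun j _ =>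
      tendsto_boxMeasure_abs_boxCount hw0 hw2 hnu j hη0) (fun _ => zero_le)
    fun n => measure_mono fun y hy => ?_
  by_contra hcon
  refine hy.not_ge ((abs_smallBalls_div_sub_le y fun j hj => ?_).trans hηε)
  exact le_of_not_gt fun hlt => hcon (Set.mem_biUnion hj hlt)

lemma exists_tendsto_forall_le {F : Filter ℕ} (hF : F ≤ atTop) {p : ℕ → ℕ → Prop}
    (h0 : ∀ n, p 0 n) (hp : ∀ k, ∀ᶠ n in F, p k n) :
    ∃ Ω : ℕ → ℕ, Tendsto Ω F atTop ∧ ∀ n, ∀ k ≤ Ω n, p k n := by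
  classical
  refine ⟨fun n => Nat.findGreatest (fun K => ∀ k ≤ K, p k n) n, tendsto_atTop.2 fun K => ?_,
    fun n => ?_⟩
  · have hall : ∀ᶠ n in F, ∀ k ∈ Finset.range (K + 1), p k n :=
      (Filter.eventually_all_finset _).2 fun k _ => hp k
    filter_upwards [hall, hF (eventually_ge_atTop K)] with n hn hK
    exact Nat.le_findGreatest hK fun k hk => hn k (Finset.mem_range.2 (by omega))
  · refine Nat.findGreatest_spec (P := fun K => ∀ k ≤ K, p k n) (Nat.zero_le n) fun k hk => ?_
    rw [Nat.le_zero.1 hk]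
    exact h0 n

lemma exists_forall_boxMeasure_smallBalls_le (hw0 : 0 < w 0) (hw2 : ∃ k, 2 ≤ k ∧ 0 < w k)
    (hnu : nu w < 1) :
    ∃ Ω : ℕ → ℕ, Tendsto Ω (sizes w) atTop ∧ ∀ n, ∀ k ≤ Ω n,
      boxMeasure w n {y | (1 / k : ℝ) < |(smallBalls y k : ℝ) / n - truncatedMean w k|} ≤
        (k : ℝ≥0∞)⁻¹ := by
  refine exists_tendsto_forall_le sizes_le_atTop (fun n => by simp) fun k => ?_
  rcases eq_or_ne k 0 with rfl | hk
  · simp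
  · have hlaw := tendsto_boxMeasure_abs_smallBalls_natCast hw0 hw2 hnu k
      (ε := 1 / k) (by positivity)
    exact hlaw.eventually_le_const (ENNReal.inv_pos.2 (ENNReal.natCast_ne_top k))

lemma tendsto_boxMeasure_abs_smallBalls (hw0 : 0 < w 0) (hnu : nu w < 1) {Ω : ℕ → ℕ}
    (hΩ : ∀ n, ∀ k ≤ Ω n,
      boxMeasure w n {y | (1 / k : ℝ) < |(smallBalls y k : ℝ) / n - truncatedMean w k|} ≤
        (k : ℝ≥0∞)⁻¹)
    {K : ℕ → ℝ} (hK : Tendsto K (sizes w) atTop) (hKΩ : ∀ n, K n ≤ Ω n) {ε : ℝ} (hε : 0 < ε) :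
    Tendsto (fun n : ℕ => boxMeasure w n
      {y | ε < |(smallBalls y (K n) : ℝ) / n - (nu w).toReal|}) (sizes w) (𝓝 0) := by
  have hfloor : Tendsto (fun n => ⌊K n⌋₊) (sizes w) atTop := tendsto_nat_floor_atTop.comp hK
  have herr : ∀ᶠ k : ℕ in atTop, 1 / (k : ℝ) + |truncatedMean w k - (nu w).toReal| < ε := by
    have hlim := tendsto_one_div_atTop_nhds_zero_nat.add
      ((tendsto_truncatedMean hw0 hnu).sub_const (nu w).toReal).abs
    rw [sub_self, abs_zero, add_zero] at hlim
    exact hlim.eventually_lt_const hε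
  refine tendsto_of_tendsto_of_tendsto_of_le_of_le' tendsto_const_nhds
    (ENNReal.tendsto_inv_nat_nhds_zero.comp hfloor) (.of_forall fun _ => zero_le) ?_
  filter_upwards [hfloor.eventually herr, hK.eventually_ge_atTop 0] with n herr hK0
  have hfloorΩ : ⌊K n⌋₊ ≤ Ω n := Nat.floor_le_of_le (hKΩ n)
  refine (measure_mono fun y hy => ?_).trans (hΩ n _ hfloorΩ)
  simp only [Set.mem_ofPred_eq, smallBalls_natFloor y hK0] at hy ⊢
  have htriangle := abs_sub_le ((smallBalls y (K n) : ℝ) / n) (truncatedMean w ⌊K n⌋₊) (nu w).toReal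
  linarith

lemma tendsto_boxMeasure_abs_largeBalls {K : ℕ → ℝ} {a : ℝ}
    (h : ∀ ε : ℝ, 0 < ε → Tendsto (fun n : ℕ => boxMeasure w n
      {y | ε < |(smallBalls y (K n) : ℝ) / n - a|}) (sizes w) (𝓝 0)) {ε : ℝ} (hε : 0 < ε) :
    Tendsto (fun n : ℕ => boxMeasure w n
      {y | ε < |(largeBalls y (K n) : ℝ) / n - (1 - a)|}) (sizes w) (𝓝 0) := by
  refine tendsto_of_tendsto_of_tendsto_of_le_of_le' tendsto_const_nhds (h (ε / 2) (half_pos hε))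
    (.of_forall fun _ => zero_le) ?_
  have hinv : ∀ᶠ n : ℕ in sizes w, 1 / (n : ℝ) < ε / 2 :=
    (tendsto_one_div_atTop_nhds_zero_nat.mono_left sizes_le_atTop).eventually_lt_const
      (half_pos hε)
  filter_upwards [eventually_boxZ_ne_zero, hinv] with n ⟨hn, hZ⟩ hinv
  refine measure_mono_ae ?_
  filter_upwards [ae_allocation hZ] with y ⟨hy, _⟩ hlarge
  have hn0 : (0 : ℝ) < n := by positivity
  have hsum : (smallBalls y (K n) : ℝ) + largeBalls y (K n) = n - 1 := by
    rw [← Nat.cast_add, smallBalls_add_largeBalls, hy,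
      Nat.cast_sub (Nat.one_le_iff_ne_zero.2 hn), Nat.cast_one]
  have hdiff : (largeBalls y (K n) : ℝ) / n - (1 - a) =
      -((smallBalls y (K n) : ℝ) / n - a) - 1 / n := by
    rw [eq_sub_of_add_eq' hsum]
    field_simp
    ring
  have htriangle := abs_sub (-((smallBalls y (K n) : ℝ) / n - a)) (1 / (n : ℝ))
  rw [abs_neg, abs_of_pos (one_div_pos.2 hn0), ← hdiff] at htriangle
  have hlarge : ε < |(largeBalls y (K n) : ℝ) / n - (1 - a)| := hlarge
  change ε / 2 < |(smallBalls y (K n) : ℝ) / n - a|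
  linarith

theorem exists_isThreshold (hw0 : 0 < w 0) (hw2 : ∃ k, 2 ≤ k ∧ 0 < w k) (hnu : nu w < 1) :
    ∃ Ω : ℕ → ℝ, IsThreshold w Ω := by
  obtain ⟨Ω, hΩ, hsmall⟩ := exists_forall_boxMeasure_smallBalls_le hw0 hw2 hnu
  refine ⟨fun n => Ω n, tendsto_natCast_atTop_atTop.comp hΩ, fun K hK hKΩ ε hε => ?_⟩
  have hK (δ : ℝ) (hδ : 0 < δ) := tendsto_boxMeasure_abs_smallBalls hw0 hnu hsmall hK hKΩ hδ
  exact ⟨hK ε hε, tendsto_boxMeasure_abs_largeBalls hK hε⟩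

end Threshold

/-! ### Asymptotic independence of the boxes -/

section Independence

variable {w : ℕ → ℝ≥0} {m n : ℕ}

lemma lintegral_allocation_comp_perm (hZ : boxZ (extWeight w) m n ≠ 0) (σ : Equiv.Perm (Fin n))
    (g : (Fin n → ℕ) → ℝ≥0∞) :
    ∫⁻ y, g (y ∘ σ) ∂(allocation w m n).toMeasure = ∫⁻ y, g y ∂(allocation w m n).toMeasure := by
  refine (ENNReal.mul_right_inj hZ (boxZ_ne_top extWeight_ne_top _ _)).1 ?_
  rw [boxZ_mul_lintegral_allocation hZ, boxZ_mul_lintegral_allocation hZ,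
    ← (σ.symm.arrowCongr (Equiv.refl ℕ)).tsum_eq fun y => _ * g y]
  refine tsum_congr fun y => ?_
  have hcomp : σ.symm.arrowCongr (Equiv.refl ℕ) y = y ∘ σ := by ext; simp [Equiv.arrowCongr]
  rw [hcomp]
  simp only [Function.comp_apply]
  rw [Equiv.sum_comp σ fun i => y i, Equiv.prod_comp σ fun i => (w (y i) : ℝ≥0∞)]

lemma natCast_mul_lintegral_eq_sum (hZ : boxZ (extWeight w) m n ≠ 0) (I : Finset (Fin n))
    {j : Fin n} (hj : j ∉ I) {G : Fin n → (Fin n → ℕ) → ℝ≥0∞}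
    (hG : ∀ i ∉ I, ∀ i' ∉ I, ∀ y, G i (y ∘ Equiv.swap i i') = G i' y) :
    ((n - I.card : ℕ) : ℝ≥0∞) * ∫⁻ y, G j y ∂(allocation w m n).toMeasure =
      ∑ i ∈ Iᶜ, ∫⁻ y, G i y ∂(allocation w m n).toMeasure := by
  have hexchange : ∀ i ∈ Iᶜ, ∫⁻ y, G i y ∂(allocation w m n).toMeasure =
      ∫⁻ y, G j y ∂(allocation w m n).toMeasure := fun i hi => by
    rw [← lintegral_allocation_comp_perm hZ (Equiv.swap i j)]
    simp only [hG i (Finset.mem_compl.1 hi) j hj]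
  rw [Finset.sum_congr rfl hexchange, Finset.sum_const, Finset.card_compl, Fintype.card_fin,
    nsmul_eq_mul]

lemma setLIntegral_apply_le (hn : n ≠ 0) (hZ : boxZ (extWeight w) (n - 1) n ≠ 0) (i : Fin n)
    {B : Set (Fin n → ℕ)} (hB : ∀ (σ : Equiv.Perm (Fin n)) y, y ∘ σ ∈ B ↔ y ∈ B) :
    ∫⁻ y in B, y i ∂boxMeasure w n ≤ boxMeasure w n B := by
  have hsum := natCast_mul_lintegral_eq_sum hZ ∅ (Finset.notMem_empty i)
    (G := fun i => B.indicator fun y => (y i : ℝ≥0∞)) fun i _ i' _ y => by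
      classical simp only [Set.indicator_apply, hB, Function.comp_apply, Equiv.swap_apply_left]
  simp only [lintegral_indicator (MeasurableSet.of_discrete (s := B)), Finset.card_empty,
    Nat.sub_zero, Finset.compl_empty] at hsum
  refine (ENNReal.mul_le_mul_iff_right (Nat.cast_ne_zero.2 hn) (by simp)).1 ?_
  calc n * ∫⁻ y in B, y i ∂boxMeasure w n
      = ∫⁻ y in B, ∑ i, (y i : ℝ≥0∞) ∂boxMeasure w n := by
        rw [hsum, lintegral_finsetSum _ fun _ _ => .of_discrete]
    _ ≤ ∫⁻ _ in B, n ∂boxMeasure w n := by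
        refine lintegral_mono_ae (ae_restrict_of_ae ?_)
        filter_upwards [ae_allocation hZ] with y ⟨hy, _⟩
        rw [← Nat.cast_sum, hy]
        exact_mod_cast Nat.sub_le n 1
    _ = n * boxMeasure w n B := setLIntegral_const _ _

lemma lintegral_apply_le_one (hn : n ≠ 0) (hZ : boxZ (extWeight w) (n - 1) n ≠ 0) (i : Fin n) :
    ∫⁻ y, y i ∂boxMeasure w n ≤ 1 := by
  simpa using setLIntegral_apply_le hn hZ i (B := Set.univ) (by simp)

lemma setLIntegral_le_two_mul (hn : n ≠ 0) (hZ : boxZ (extWeight w) (n - 1) n ≠ 0) (i : Fin n)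
    {g : (Fin n → ℕ) → ℝ≥0∞} (hg : ∀ y, g y ≤ 1 + y i) {B : Set (Fin n → ℕ)}
    (hB : ∀ (σ : Equiv.Perm (Fin n)) y, y ∘ σ ∈ B ↔ y ∈ B) :
    ∫⁻ y in B, g y ∂boxMeasure w n ≤ 2 * boxMeasure w n B := by
  calc ∫⁻ y in B, g y ∂boxMeasure w n
      ≤ ∫⁻ y in B, 1 + y i ∂boxMeasure w n := lintegral_mono hg
    _ = boxMeasure w n B + ∫⁻ y in B, y i ∂boxMeasure w n := by
        rw [lintegral_add_left .of_discrete, setLIntegral_one]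
    _ ≤ 2 * boxMeasure w n B := by
        rw [two_mul]
        gcongr
        exact setLIntegral_apply_le hn hZ i hB

lemma boxCount_comp_perm (y : Fin n → ℕ) (σ : Equiv.Perm (Fin n)) (k : ℕ) :
    boxCount (y ∘ σ) k = boxCount y k := by
  rw [boxCount, boxCount, Finset.card_filter, Finset.card_filter]
  exact Equiv.sum_comp σ fun i => if y i = k then 1 else 0

lemma boxCount_mul_le (I : Finset (Fin n)) (g : (Fin n → ℕ) → ℝ≥0∞) (k : ℕ) (y : Fin n → ℕ) :
    boxCount y k * g y ≤ ∑ i ∈ Iᶜ, {y | y i = k}.indicator g y + I.card * g y := by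
  classical
  calc (boxCount y k : ℝ≥0∞) * g y = ∑ i, {y | y i = k}.indicator g y := by
        simp [boxCount, Set.indicator_apply, ← Finset.sum_filter]
    _ ≤ _ := by
        rw [← Finset.sum_compl_add_sum I, ← nsmul_eq_mul]
        gcongr
        exact Finset.sum_le_card_nsmul _ _ _ fun i _ => Set.indicator_le_self _ _ _

lemma natCast_mul_mul_le (I : Finset (Fin n)) (g : (Fin n → ℕ) → ℝ≥0∞) (k : ℕ) {p : ℝ≥0∞}
    (hp : p ≤ 1) (η : ℝ≥0) (y : Fin n → ℕ) :
    n * p * g y ≤ ∑ i ∈ Iᶜ, {y | y i = k}.indicator g y +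
      (I.card * g y + n * η * g y +
        n * {y | boxCount y k < (p.toReal - η) * n}.indicator g y) := by
  have hp' : p ≠ ∞ := ne_top_of_le_ne_top ENNReal.one_ne_top hp
  set B : Set (Fin n → ℕ) := {y | boxCount y k < (p.toReal - η) * n}
  by_cases hy : y ∈ B
  · rw [Set.indicator_of_mem hy, ← add_assoc]
    refine le_add_left ?_
    gcongr
    exact mul_le_of_le_one_right zero_le hp
  · have hy' : (p.toReal - η) * n ≤ boxCount y k := not_lt.1 hy
    have hmany : n * p ≤ boxCount y k + n * η := by
      rw [← ENNReal.toReal_le_toReal (by finiteness) (by finiteness),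
        ENNReal.toReal_add (by finiteness) (by finiteness)]
      simp only [ENNReal.toReal_mul, ENNReal.toReal_natCast, ENNReal.coe_toReal]
      linarith
    rw [Set.indicator_of_notMem hy, mul_zero, add_zero, ← add_assoc]
    calc n * p * g y ≤ boxCount y k * g y + n * η * g y := by rw [← add_mul]; gcongr
      _ ≤ _ := by gcongr; exact boxCount_mul_le I g k y

/-- A set of boxes that is exchangeable given `g` contains the right proportion of boxes with `k`
balls, because the whole allocation does and the other boxes are few. -/
lemma offspring_mul_lintegral_le (hn : n ≠ 0) (hZ : boxZ (extWeight w) (n - 1) n ≠ 0)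
    (I : Finset (Fin n)) {i j : Fin n} (hj : j ∉ I) {g : (Fin n → ℕ) → ℝ≥0∞}
    (hg : ∀ i ∉ I, ∀ i' ∉ I, ∀ y, g (y ∘ Equiv.swap i i') = g y) (hgle : ∀ y, g y ≤ 1 + y i)
    (k : ℕ) (η : ℝ≥0) :
    offspring w k * ∫⁻ y, g y ∂boxMeasure w n ≤ ∫⁻ y in {y | y j = k}, g y ∂boxMeasure w n +
      2 * (I.card / n + η +
        boxMeasure w n {y | boxCount y k < ((offspring w k).toReal - η) * n}) := by
  set B : Set (Fin n → ℕ) := {y | boxCount y k < ((offspring w k).toReal - η) * n} with hB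
  have hn0 : (n : ℝ≥0∞) ≠ 0 := Nat.cast_ne_zero.2 hn
  have htotal : ∫⁻ y, g y ∂boxMeasure w n ≤ 2 := by
    simpa using setLIntegral_le_two_mul hn hZ i hgle (B := Set.univ) (by simp)
  have hbad : ∫⁻ y in B, g y ∂boxMeasure w n ≤ 2 * boxMeasure w n B :=
    setLIntegral_le_two_mul hn hZ i hgle fun σ y => by
      simp only [hB, Set.mem_ofPred_eq, boxCount_comp_perm]
  have hsum := natCast_mul_lintegral_eq_sum hZ I hj (G := fun i => {y | y i = k}.indicator g)
    fun i hi i' hi' y => by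
      classical simp only [Set.indicator_apply, Set.mem_ofPred_eq, Function.comp_apply,
        Equiv.swap_apply_left, hg i hi i' hi']
  have hmean := lintegral_mono (μ := boxMeasure w n)
    (natCast_mul_mul_le I g k ((offspring w).coe_le_one k) η)
  rw [lintegral_const_mul _ .of_discrete, lintegral_add_left .of_discrete,
    lintegral_finsetSum _ fun _ _ => .of_discrete, ← hsum, lintegral_add_left .of_discrete,
    lintegral_add_left .of_discrete, lintegral_const_mul _ .of_discrete,
    lintegral_const_mul _ .of_discrete, lintegral_const_mul _ .of_discrete,
    lintegral_indicator .of_discrete, lintegral_indicator .of_discrete] at hmean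
  refine (ENNReal.mul_le_mul_iff_right hn0 (by simp)).1 ?_
  calc _ ≤ _ := (mul_assoc _ _ _).symm.trans_le hmean
    _ ≤ n * ∫⁻ y in {y | y j = k}, g y ∂boxMeasure w n +
        (I.card * 2 + n * η * 2 + n * (2 * boxMeasure w n B)) := by
        gcongr
        exact Nat.sub_le _ _
    _ = n * ∫⁻ y in {y | y j = k}, g y ∂boxMeasure w n +
        2 * (n * (I.card / n) + n * η + n * boxMeasure w n B) := by
        rw [ENNReal.mul_div_cancel hn0 (by simp)]; ring
    _ = _ := by ring

lemma eventually_offspring_mul_lintegral_le (hw0 : 0 < w 0) (hw2 : ∃ k, 2 ≤ k ∧ 0 < w k)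
    (hnu : nu w < 1) (k s : ℕ) {ε : ℝ≥0∞} (hε : ε ≠ 0) :
    ∀ᶠ n in sizes w, ∀ (I : Finset (Fin n)) (i j : Fin n) (g : (Fin n → ℕ) → ℝ≥0∞),
      I.card ≤ s → j ∉ I → (∀ i ∉ I, ∀ i' ∉ I, ∀ y, g (y ∘ Equiv.swap i i') = g y) →
      (∀ y, g y ≤ 1 + y i) →
      offspring w k * ∫⁻ y, g y ∂boxMeasure w n ≤
        ∫⁻ y in {y | y j = k}, g y ∂boxMeasure w n + ε := by
  have hε6 : (0 : ℝ≥0∞) < ε / 6 := ENNReal.div_pos hε (by simp)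
  obtain ⟨η, hη0, hη⟩ := ENNReal.lt_iff_exists_nnreal_btwn.1 hε6
  have hfew : Tendsto (fun n : ℕ => (s : ℝ≥0∞) / n) (sizes w) (𝓝 0) := by
    simpa only [mul_zero, ← div_eq_mul_inv] using
      (ENNReal.Tendsto.const_mul ENNReal.tendsto_inv_nat_nhds_zero
        (.inr (ENNReal.natCast_ne_top s))).mono_left sizes_le_atTop
  have hbad := tendsto_boxMeasure_boxCount_lt hw0 hw2 hnu k (ε := η) (by simpa using hη0)
  filter_upwards [eventually_boxZ_ne_zero, hfew.eventually_le_const hε6,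
    hbad.eventually_le_const hε6] with n ⟨hn, hZ⟩ hfew hbad I i j g hI hj hg hgle
  refine (offspring_mul_lintegral_le hn hZ I hj hg hgle k η).trans ?_
  gcongr
  have hI' : (I.card : ℝ≥0∞) / n ≤ ε / 6 := le_trans (by gcongr) hfew
  calc _ ≤ 2 * (ε / 6 + ε / 6 + ε / 6) := by grw [hI', hη, hbad]
    _ = ε / 6 * 6 := by ring
    _ = ε := ENNReal.div_mul_cancel (by simp) (by simp)

lemma indicator_forall_eq_comp_swap {κ : Type*} (e : κ → Fin n) (i : Fin n) (J : Finset κ)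
    (c : κ → ℕ) (g : ℕ → ℝ≥0∞) {a b : Fin n} (ha : a ∉ insert i (J.image e))
    (hb : b ∉ insert i (J.image e)) (y : Fin n → ℕ) :
    {y : Fin n → ℕ | ∀ j ∈ J, y (e j) = c j}.indicator (fun y => g (y i)) (y ∘ Equiv.swap a b) =
      {y : Fin n → ℕ | ∀ j ∈ J, y (e j) = c j}.indicator (fun y => g (y i)) y := by
  classical
  have hfix : ∀ x ∈ insert i (J.image e), Equiv.swap a b x = x := fun x hx =>
    Equiv.swap_apply_of_ne_of_ne (by rintro rfl; exact ha hx) (by rintro rfl; exact hb hx)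
  simp only [Finset.forall_mem_insert, Finset.forall_mem_image] at hfix
  simp only [Set.indicator_apply, Set.mem_ofPred_eq, Function.comp_apply, hfix.1]
  exact if_congr (forall₂_congr fun j hj => by rw [hfix.2 hj]) rfl rfl

lemma eventually_prod_offspring_mul_lintegral_le (hw0 : 0 < w 0) (hw2 : ∃ k, 2 ≤ k ∧ 0 < w k)
    (hnu : nu w < 1) {κ : Type*} (J : Finset κ) (c : κ → ℕ) {ε : ℝ≥0∞} (hε : ε ≠ 0) :
    ∀ᶠ n in sizes w, ∀ e : κ → Fin n, Set.InjOn e J → ∀ i, i ∉ J.image e →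
      ∀ g : ℕ → ℝ≥0∞, (∀ k, g k ≤ 1 + k) →
      (∏ j ∈ J, offspring w (c j)) * ∫⁻ y, g (y i) ∂boxMeasure w n ≤
        ∫⁻ y in {y | ∀ j ∈ J, y (e j) = c j}, g (y i) ∂boxMeasure w n + ε := by
  classical
  induction J using Finset.induction_on generalizing ε with
  | empty => exact .of_forall fun n e _ i _ g _ => by simp
  | insert a J ha ih =>
    have hε2 : ε / 2 ≠ 0 := (ENNReal.half_pos hε).ne'
    filter_upwards [ih hε2,
      eventually_offspring_mul_lintegral_le hw0 hw2 hnu (c a) (J.card + 1) hε2]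
      with n hJ hstep e he i hi g hg
    rw [Finset.image_insert, Finset.mem_insert, not_or] at hi
    have hea : e a ∉ insert i (J.image e) := by
      simp only [Finset.mem_insert, Finset.mem_image, not_or, not_exists, not_and]
      exact ⟨Ne.symm hi.1, fun x hx hxa =>
        ha (he (by simp [hx]) (by simp) hxa ▸ hx)⟩
    set s := {y : Fin n → ℕ | ∀ j ∈ J, y (e j) = c j}
    have hinter : s ∩ {y | y (e a) = c a} = {y | ∀ j ∈ insert a J, y (e j) = c j} := by
      ext y
      simp only [s, Set.mem_inter_iff, Set.mem_ofPred_eq, Finset.forall_mem_insert, and_comm]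
    have hJ' := hJ e (he.mono (by simp)) i hi.2 g hg
    have hstep' := hstep _ i (e a) (s.indicator fun y => g (y i))
      ((Finset.card_insert_le _ _).trans (Nat.succ_le_succ Finset.card_image_le)) hea
      (fun _ hb _ hb' => indicator_forall_eq_comp_swap e i J c g hb hb')
      fun y => (Set.indicator_le_self _ _ y).trans (hg _)
    rw [lintegral_indicator .of_discrete, setLIntegral_indicator .of_discrete, hinter] at hstep'
    calc (∏ j ∈ insert a J, offspring w (c j)) * ∫⁻ y, g (y i) ∂boxMeasure w n
        = offspring w (c a) *
            ((∏ j ∈ J, offspring w (c j)) * ∫⁻ y, g (y i) ∂boxMeasure w n) := by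
          rw [Finset.prod_insert ha, mul_assoc]
      _ ≤ offspring w (c a) * (∫⁻ y in s, g (y i) ∂boxMeasure w n + ε / 2) := by gcongr
      _ ≤ offspring w (c a) * ∫⁻ y in s, g (y i) ∂boxMeasure w n + ε / 2 := by
          rw [mul_add]
          gcongr
          exact mul_le_of_le_one_left zero_le (PMF.coe_le_one _ _)
      _ ≤ _ := by
          grw [hstep', add_assoc, ENNReal.add_halves]

lemma boxZ_mul_boxMeasure_injOn (hZ : boxZ (extWeight w) m n ≠ 0) {κ : Type*} (S : Finset κ)
    (d : κ → ℕ) {e : κ → Fin n} (he : Set.InjOn e S) :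
    boxZ (extWeight w) m n * (allocation w m n).toMeasure {y | ∀ u ∈ S, y (e u) = d u} =
      if ∑ u ∈ S, d u ≤ m then (∏ u ∈ S, (w (d u) : ℝ≥0∞)) *
        boxZ (extWeight w) (m - ∑ u ∈ S, d u) (n - S.card) else 0 := by
  classical
  rcases S.eq_empty_or_nonempty with rfl | ⟨u₀, -⟩
  · simp
  have : Nonempty κ := ⟨u₀⟩
  have hinv : ∀ u ∈ S, Function.invFunOn e S (e u) = u := fun u hu => he.leftInvOn_invFunOn hu
  have h := boxZ_mul_allocation_forall_eq hZ (S.image e) fun i => d (Function.invFunOn e S i)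
  rw [Finset.sum_image he, Finset.prod_image he, Finset.card_image_of_injOn he,
    Finset.sum_congr rfl fun u hu => congrArg d (hinv u hu),
    Finset.prod_congr rfl fun u hu => congrArg (fun a => (w (d a) : ℝ≥0∞)) (hinv u hu)] at h
  rw [← h]
  congr with y
  simp only [Finset.forall_mem_image]
  exact forall₂_congr fun u hu => by rw [hinv u hu]

lemma treeZ_ne_top (n : ℕ) : treeZ w n ≠ ∞ := by
  rcases eq_or_ne n 0 with rfl | hn
  · simp [treeZ_eq, forestZ_zero_right]
  · refine fun htop => boxZ_ne_top (extWeight_ne_top (w := w)) (n - 1) n ?_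
    rw [← natCast_mul_forestZ_one _ hn, ← treeZ_eq, htop,
      ENNReal.mul_top (Nat.cast_ne_zero.2 hn)]

instance : MeasurableSpace OrderedTree := ⊤

instance : DiscreteMeasurableSpace OrderedTree := ⟨fun _ => trivial⟩

/-- The law of `T_n` as a measure; every set of trees is measurable. -/
abbrev treeMeasure (w : ℕ → ℝ≥0) (n : ℕ) : Measure OrderedTree := (randomTree w n).toMeasure

lemma treeMeasure_matches_mul_treeZ (hn : 0 < treeZ w n) (S : Finset Node) (d : Node → ℕ) :
    treeMeasure w n {T | T.Matches S d} * treeZ w n = matchWeight w S d n := by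
  classical
  rw [PMF.toMeasure_apply _ .of_discrete, matchWeight, ← ENNReal.tsum_mul_right]
  refine tsum_congr fun T => ?_
  simp only [Set.indicator_apply]
  split_ifs
  · rw [randomTree, proportionalTo_apply _ hn.ne' (treeZ_ne_top n)]
    exact ENNReal.div_mul_cancel hn.ne' (treeZ_ne_top n)
  · simp

/-- The factor `#boundary` is the cycle lemma for the forest that hangs at the boundary. -/
lemma card_boundary_mul_boxMeasure_le (hn : n ≠ 0) (hZ : boxZ (extWeight w) (n - 1) n ≠ 0)
    {S : Finset Node} {d : Node → ℕ} (hS : IsExplored S d) (hSn : S.card < n) {e : Node → Fin n}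
    (he : Set.InjOn e S) :
    (boundary S d).card * boxMeasure w n {y | ∀ u ∈ S, y (e u) = d u} ≤
      treeMeasure w n {T | T.Matches S d} := by
  have htree := treeZ_pos_iff.2 ⟨hn, hZ⟩
  obtain ⟨r, hr⟩ := Nat.exists_eq_add_of_le hSn.le
  have hq := hS.card_boundary
  set q := (boundary S d).card with hq'
  have hmatch := matchWeight_card_add w r hS
  rw [← hr, ← hq'] at hmatch
  refine (ENNReal.mul_le_mul_iff_left htree.ne' (treeZ_ne_top n)).1 ?_
  rw [treeMeasure_matches_mul_treeZ htree]
  refine (ENNReal.mul_le_mul_iff_right (Nat.cast_ne_zero.2 hn) (by simp)).1 ?_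
  rw [hmatch]
  calc _ = q * (boxZ (extWeight w) (n - 1) n *
        boxMeasure w n {y | ∀ u ∈ S, y (e u) = d u}) := by
        rw [← natCast_mul_forestZ_one _ hn, ← treeZ_eq]; ring
    _ ≤ (∏ u ∈ S, (w (d u) : ℝ≥0∞)) * (r * forestZ (extWeight w) q r) := by
        rw [boxZ_mul_boxMeasure_injOn hZ S d he]
        split_ifs with hle
        · rw [natCast_mul_forestZ _ (by omega) (by omega), show n - S.card = r by omega,
            show n - 1 - ∑ u ∈ S, d u = r - q by omega]
          exact le_of_eq (by ring)
        · simp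
    _ ≤ n * ((∏ u ∈ S, (w (d u) : ℝ≥0∞)) * forestZ (extWeight w) q r) := by
        rw [mul_left_comm]
        gcongr
        omega

end Independence

/-! ### The spine of the modified Galton–Watson tree -/

section HatTree

variable {ω : Node → Mark} {S : Finset Node} {d : Node → ℕ} {u v : Node}

lemma status_cons_eq_special_iff {i : ℕ} :
    status ω (i :: v) = .special ↔
      status ω v = .special ∧ (i : ℕ∞) < (ω v).2.1 ∧ (ω v).2.1 ≠ ⊤ ∧ i = (ω v).2.2 := by
  rw [status]
  cases h : status ω v with
  | absent => simp [childStatus]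
  | normal =>
    simp only [childStatus]
    split_ifs <;> simp
  | special =>
    simp only [childStatus]
    split_ifs with hi hspecial
    · exact iff_of_true rfl ⟨trivial, hi, hspecial⟩
    · exact iff_of_false (by simp) fun h => hspecial h.2.2
    · simp [hi]

lemma status_special_of_suffix (huv : u <:+ v)
    (hv : status ω v = .special) : status ω u = .special := by
  induction v with
  | nil => rw [List.suffix_nil.1 huv]; exact hv
  | cons i v ih =>
    rcases List.suffix_cons_iff.1 huv with rfl | h
    · exact hv
    · exact ih h (status_cons_eq_special_iff.1 hv).1

lemma eq_of_status_special (hl : u.length = v.length)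
    (hu : status ω u = .special) (hv : status ω v = .special) : u = v := by
  induction u generalizing v with
  | nil => exact (List.length_eq_zero_iff.1 hl.symm).symm
  | cons i u ih =>
    cases v with
    | nil => simp at hl
    | cons j v =>
      rw [status_cons_eq_special_iff] at hu hv
      obtain rfl := ih (by simpa using hl) hu.1 hv.1
      rw [hu.2.2.2, hv.2.2.2]

lemma suffix_of_status_special (hl : u.length ≤ v.length)
    (hu : status ω u = .special) (hv : status ω v = .special) : u <:+ v := by
  have hs : v.drop (v.length - u.length) <:+ v := List.drop_suffix _ _
  rwa [← eq_of_status_special (by simp; omega) hu (status_special_of_suffix hs hv)] at hs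

lemma suffix_or_suffix_of_status_special {ω : Node → Mark} {u v : Node}
    (hu : status ω u = .special) (hv : status ω v = .special) : u <:+ v ∨ v <:+ u := by
  rcases le_total u.length v.length with h | h
  · exact Or.inl (suffix_of_status_special h hu hv)
  · exact Or.inr (suffix_of_status_special h hv hu)

lemma exists_cons_suffix (h : u <:+ v) (hne : u ≠ v) : ∃ j, (j :: u) <:+ v := by
  obtain ⟨t, rfl⟩ := h
  rcases List.eq_nil_or_concat t with rfl | ⟨s, j, rfl⟩
  · simp at hne
  · exact ⟨j, s, by simp⟩

/-- The outdegree, in the modified Galton–Watson tree, of a node that has status `s` and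
mark `c`. -/
def Status.outdeg (s : Status) (c : Mark) : ℕ∞ :=
  match s with
  | .absent => 0
  | .normal => c.1
  | .special => c.2.1

lemma eq_of_forall_natCast_lt_iff {a b : ℕ∞} (h : ∀ i : ℕ, (i : ℕ∞) < a ↔ (i : ℕ∞) < b) :
    a = b := by
  refine ENat.eq_of_forall_natCast_le_iff fun i => ?_
  cases i with
  | zero => simp
  | succ i => simpa [ENat.add_one_le_iff] using h i

lemma hatTree_outdeg (ω : Node → Mark) (v : Node) :
    (hatTree ω).outdeg v = (status ω v).outdeg (ω v) := by
  refine eq_of_forall_natCast_lt_iff fun i => ?_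
  rw [← OrderedTree.cons_mem_nodes_iff]
  change status ω (i :: v) ≠ .absent ↔ _
  rw [status]
  cases hs : status ω v with
  | absent => simp [childStatus, Status.outdeg]
  | normal => simp [childStatus, Status.outdeg]
  | special =>
    simp only [childStatus, Status.outdeg]
    split_ifs <;> simp_all

lemma hatTree_outdeg_eq_top (h : (hatTree ω).outdeg v = ⊤) :
    status ω v = .special ∧ (ω v).2.1 = ⊤ := by
  rw [hatTree_outdeg] at h
  cases hs : status ω v with
  | absent => simp [hs, Status.outdeg] at h
  | normal => simp [hs, Status.outdeg] at h
  | special => exact ⟨rfl, by simpa [hs, Status.outdeg] using h⟩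

lemma suffix_of_mark_eq_top (hv : status ω v = .special)
    (htop : (ω v).2.1 = ⊤) (hu : status ω u = .special) : u <:+ v := by
  rcases suffix_or_suffix_of_status_special hu hv with h | h
  · exact h
  · by_cases hne : v = u
    · rw [hne]
    · obtain ⟨j, hj⟩ := exists_cons_suffix h hne
      exact absurd htop (status_cons_eq_special_iff.1 (status_special_of_suffix hj hu)).2.2.1

lemma eq_of_outdeg_eq_top (hu : (hatTree ω).outdeg u = ⊤)
    (hv : (hatTree ω).outdeg v = ⊤) : u = v := by
  obtain ⟨hus, hutop⟩ := hatTree_outdeg_eq_top hu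
  obtain ⟨hvs, hvtop⟩ := hatTree_outdeg_eq_top hv
  exact (suffix_of_mark_eq_top hvs hvtop hus).eq_of_length_le
    (suffix_of_mark_eq_top hus hutop hvs).length_le

/-- At every node, the mark puts the special child at a position where there is a child, unless
the offspring is infinite. Almost all choices of marks have this property, and then every finite
part of the spine can be continued. -/
def ProperMarks (ω : Node → Mark) : Prop :=
  ∀ v, (ω v).2.1 = ⊤ ∨ ((ω v).2.2 : ℕ∞) < (ω v).2.1

/-- The marks that the node `u` can have if its outdegree is `d` and the spine reaches the node `b`,
where `u` does not come after `b` on the spine: if `u` is a proper ancestor of `b`, then both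
components of its special mark are determined. -/
def spineMarks (b u : Node) (d : ℕ) : Set Mark :=
  {c | (∀ j, (j :: u) <:+ b → c.2 = ((d : ℕ∞), j)) ∧ ((∀ j, ¬ (j :: u) <:+ b) → c.1 = d)}

lemma mem_spineMarks {b : Node} {d : ℕ} (hb : status ω b = .special)
    (hu : u ∈ (hatTree ω).nodes) (hd : (hatTree ω).outdeg u = d)
    (hs : status ω u = .special → ∃ j, (j :: u) <:+ b) : ω u ∈ spineMarks b u d := by
  rw [hatTree_outdeg] at hd
  refine ⟨fun j hj => ?_, fun hno => ?_⟩
  · have h := status_cons_eq_special_iff.1 (status_special_of_suffix hj hb)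
    rw [h.1] at hd
    exact Prod.ext hd h.2.2.2.symm
  · cases hst : status ω u with
    | absent => exact absurd hst hu
    | normal =>
      rw [hst] at hd
      exact_mod_cast (show ((ω u).1 : ℕ∞) = d from hd)
    | special =>
      obtain ⟨j, hj⟩ := hs hst
      exact absurd hj (hno j)

/-- The last special node that is known to belong to the tree is unexplored, for otherwise its
special child would be a later one. -/
lemma exists_special_mem_boundary (hω : ProperMarks ω) (hm : (hatTree ω).Matches S d) :
    ∃ b ∈ boundary S d, status ω b = .special := by
  classical
  obtain ⟨b, hb, hmax⟩ := Finset.exists_max_image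
    ((reach S d).filter fun v => status ω v = .special) List.length
    ⟨[], Finset.mem_filter.2 ⟨nil_mem_reach, rfl⟩⟩
  rw [Finset.mem_filter] at hb
  refine ⟨b, Finset.mem_sdiff.2 ⟨hb.1, fun hbS => ?_⟩, hb.2⟩
  have hdeg : (ω b).2.1 = d b := by simpa [hatTree_outdeg, hb.2, Status.outdeg] using hm b hbS
  have hpos : ((ω b).2.2 : ℕ∞) < (ω b).2.1 := (hω b).resolve_left (by simp [hdeg])
  have hchild : (ω b).2.2 :: b ∈ reach S d :=
    cons_mem_reach.2 ⟨hbS, by exact_mod_cast hpos.trans_eq hdeg⟩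
  have hspecial : status ω ((ω b).2.2 :: b) = .special :=
    status_cons_eq_special_iff.2 ⟨hb.2, hpos, by simp [hdeg], rfl⟩
  simpa using hmax _ (Finset.mem_filter.2 ⟨hchild, hspecial⟩)

lemma IsExplored.mem_of_suffix (hS : IsExplored S d) (huv : u <:+ v) (hv : v ∈ S) : u ∈ S := by
  induction v with
  | nil => rwa [List.suffix_nil.1 huv]
  | cons i v ih =>
    rcases List.suffix_cons_iff.1 huv with rfl | h
    · exact hv
    · exact ih h (cons_mem_reach.1 (isExplored_iff_subset_reach.1 hS hv)).1

lemma exists_forall_mem_spineMarks (hω : ProperMarks ω) (hS : IsExplored S d)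
    (hm : (hatTree ω).Matches S d) : ∃ b ∈ boundary S d, ∀ u ∈ S, ω u ∈ spineMarks b u (d u) := by
  obtain ⟨b, hb, hbs⟩ := exists_special_mem_boundary hω hm
  have hbS := (Finset.mem_sdiff.1 hb).2
  have hnodes : ∀ u ∈ S, u ∈ (hatTree ω).nodes := fun u hu =>
    hm.reach_subset (isExplored_iff_subset_reach.1 hS hu)
  refine ⟨b, hb, fun u hu => mem_spineMarks hbs (hnodes u hu) (hm u hu) fun hus => ?_⟩
  rcases suffix_or_suffix_of_status_special hus hbs with h | h
  · exact exists_cons_suffix h (by rintro rfl; exact hbS hu)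
  · exact absurd (hS.mem_of_suffix h hu) hbS

lemma forall_mem_spineMarks_of_top (hv : (hatTree ω).outdeg v = ⊤)
    (hS : ∀ u ∈ S, u ∈ (hatTree ω).nodes) (hm : ∀ u ∈ S, u ≠ v → (hatTree ω).outdeg u = d u) :
    (ω v).2.1 = ⊤ ∧ ∀ u ∈ S, u ≠ v → ω u ∈ spineMarks v u (d u) := by
  obtain ⟨hvs, htop⟩ := hatTree_outdeg_eq_top hv
  refine ⟨htop, fun u hu hne => mem_spineMarks hvs (hS u hu) (hm u hu hne) fun hus => ?_⟩
  exact exists_cons_suffix (suffix_of_mark_eq_top hvs htop hus) hne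

variable {π : PMF ℕ}

lemma tsum_natCast_add_top (f : ℕ∞ → ℝ≥0∞) : ∑' k, f k = ∑' j : ℕ, f j + f ⊤ := by
  have hcast : ∑' j : ℕ, f j = ∑' k, if k = ⊤ then 0 else f k := by
    refine Eq.trans (by simp) (Nat.cast_injective.tsum_eq (g := ((↑) : ℕ → ℕ∞)) fun k hk => ?_)
    exact ENat.ne_top_iff_exists.1 fun h => by simp [h] at hk
  rw [hcast, add_comm]
  convert ENNReal.tsum_eq_add_tsum_ite (f := f) ⊤

lemma specialOffspring_apply (hπ : ∑' j : ℕ, (j : ℝ≥0∞) * π j ≤ 1) (k : ℕ∞) :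
    specialOffspring π k =
      if k = ⊤ then 1 - ∑' j : ℕ, (j : ℝ≥0∞) * π j else (k.toNat : ℝ≥0∞) * π k.toNat := by
  classical
  set f : ℕ∞ → ℝ≥0∞ := fun k =>
    if k = ⊤ then 1 - ∑' j : ℕ, (j : ℝ≥0∞) * π j else (k.toNat : ℝ≥0∞) * π k.toNat with hf
  have hsum : ∑' k, f k = 1 := by
    rw [tsum_natCast_add_top]
    simpa [hf] using add_tsub_cancel_of_le hπ
  have h := proportionalTo_apply (f := f) ⊤ (by rw [hsum]; simp) (by rw [hsum]; simp) k
  rwa [hsum, div_one] at h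

lemma map_apply_le_of_injective {α β : Type*} {f : α → β} (hf : Function.Injective f) (p : PMF α)
    {c : ℝ≥0∞} (hc : ∀ a, p a ≤ c) (b : β) : p.map f b ≤ c := by
  rw [PMF.map_apply]
  by_cases hb : b ∈ Set.range f
  · obtain ⟨a, rfl⟩ := hb
    rw [tsum_eq_single a fun a' ha => if_neg fun h => ha (hf h).symm, if_pos rfl]
    exact hc a
  · rw [ENNReal.tsum_eq_zero.2 fun a => if_neg fun h => hb ⟨a, h.symm⟩]
    exact zero_le

/-- In the definition of `specialMark`, the coercion `Fin (m + 1) → ℕ` is elaborated as a lift in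
the monad `PMF`; here it is inside the function that is mapped. -/
lemma specialMark_eq_bind : specialMark π = (specialOffspring π).bind fun k =>
    match k.toNat with
    | 0 => PMF.pure (k, 0)
    | m + 1 => (PMF.uniformOfFintype (Fin (m + 1))).map fun j : Fin (m + 1) => (k, j.val) := by
  rw [specialMark]
  congr 1
  funext k
  cases k.toNat with
  | zero => rfl
  | succ m => exact PMF.map_comp _ _ _

lemma specialMark_apply_le (hπ : ∑' j : ℕ, (j : ℝ≥0∞) * π j ≤ 1) (k j : ℕ) :
    specialMark π ((k : ℕ∞), j) ≤ π k := by
  rw [specialMark_eq_bind, PMF.bind_apply, tsum_eq_single (k : ℕ∞)]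
  · rw [specialOffspring_apply hπ, if_neg (by simp), ENat.toNat_natCast]
    cases k with
    | zero => simp
    | succ m =>
      have hinj : Function.Injective fun i : Fin (m + 1) => (((m + 1 : ℕ) : ℕ∞), i.val) :=
        fun _ _ h => Fin.ext (Prod.ext_iff.1 h).2
      calc _ ≤ ((m + 1 : ℕ) : ℝ≥0∞) * π (m + 1) * ((m + 1 : ℕ) : ℝ≥0∞)⁻¹ :=
            mul_le_mul_right (map_apply_le_of_injective hinj (PMF.uniformOfFintype _)
              (fun i => by rw [PMF.uniformOfFintype_apply, Fintype.card_fin]) _) _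
        _ = π (m + 1) := by
            rw [mul_right_comm, ENNReal.mul_inv_cancel (by simp) (ENNReal.natCast_ne_top _),
              one_mul]
  · intro a ha
    rw [mul_eq_zero]
    right
    split
    · rw [PMF.pure_apply, if_neg]
      exact fun h => ha (Prod.ext_iff.1 h).1.symm
    · rw [PMF.map_apply, ENNReal.tsum_eq_zero]
      exact fun i => if_neg fun h => ha (Prod.ext_iff.1 h).1.symm

lemma specialMark_map_fst : (specialMark π).map Prod.fst = specialOffspring π := by
  rw [specialMark_eq_bind, PMF.map_bind]
  conv_rhs => rw [← PMF.bind_pure (specialOffspring π)]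
  congr 1
  funext k
  split
  · rw [PMF.pure_map]
  · rw [PMF.map_comp]
    exact PMF.map_const _ _

lemma eq_top_or_lt_of_mem_support_specialMark (hπ : ∑' j : ℕ, (j : ℝ≥0∞) * π j ≤ 1) {x : ℕ∞ × ℕ}
    (hx : x ∈ (specialMark π).support) : x.1 = ⊤ ∨ (x.2 : ℕ∞) < x.1 := by
  rw [specialMark_eq_bind, PMF.mem_support_bind_iff] at hx
  obtain ⟨k, hk, hx⟩ := hx
  rw [PMF.mem_support_iff, specialOffspring_apply hπ] at hk
  rcases eq_or_ne k ⊤ with rfl | hne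
  · left
    split at hx
    · rw [PMF.support_pure, Set.mem_singleton_iff] at hx
      rw [hx]
    · rw [PMF.mem_support_map_iff] at hx
      obtain ⟨a, _, rfl⟩ := hx
      rfl
  · right
    obtain ⟨k, rfl⟩ := ENat.ne_top_iff_exists.1 hne
    rw [if_neg hne, ENat.toNat_natCast] at hk
    rw [ENat.toNat_natCast] at hx
    cases k with
    | zero => simp at hk
    | succ m =>
      rw [PMF.mem_support_map_iff] at hx
      obtain ⟨i, _, rfl⟩ := hx
      exact Nat.cast_lt.2 i.isLt

/-- The law of the random choices at one node, the factor of the product measure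
`markMeasure π`. -/
def markLaw (π : PMF ℕ) : Measure Mark := π.toMeasure.prod (specialMark π).toMeasure

instance : IsProbabilityMeasure (markLaw π) := by unfold markLaw; infer_instance

lemma markMeasure_eq (π : PMF ℕ) :
    markMeasure π = Measure.infinitePi fun _ : Node => markLaw π := rfl

instance : IsProbabilityMeasure (markMeasure π) := by rw [markMeasure_eq]; infer_instance

lemma markLaw_fst_eq (k : ℕ) : markLaw π {c | c.1 = k} = π k := by
  have hprod : {c : Mark | c.1 = k} = {k} ×ˢ Set.univ := by ext c; simp
  rw [hprod, markLaw, Measure.prod_prod, measure_univ, mul_one,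
    PMF.toMeasure_apply_singleton _ _ (measurableSet_singleton k)]

lemma markLaw_snd (s : Set (ℕ∞ × ℕ)) :
    markLaw π {c | c.2 ∈ s} = (specialMark π).toMeasure s := by
  have hprod : {c : Mark | c.2 ∈ s} = Set.univ ×ˢ s := by ext c; simp
  rw [hprod, markLaw, Measure.prod_prod, measure_univ, one_mul]

lemma markLaw_spineMarks_le (hπ : ∑' j : ℕ, (j : ℝ≥0∞) * π j ≤ 1) (b u : Node) (d : ℕ) :
    markLaw π (spineMarks b u d) ≤ π d := by
  by_cases h : ∃ j, (j :: u) <:+ b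
  · obtain ⟨j, hj⟩ := h
    calc markLaw π (spineMarks b u d) ≤ markLaw π {c | c.2 ∈ ({((d : ℕ∞), j)} : Set _)} :=
          measure_mono fun c hc => hc.1 j hj
      _ = specialMark π ((d : ℕ∞), j) := by
          rw [markLaw_snd, PMF.toMeasure_apply_singleton _ _ (measurableSet_singleton _)]
      _ ≤ π d := specialMark_apply_le hπ d j
  · push Not at h
    rw [← markLaw_fst_eq]
    exact measure_mono fun c hc => hc.2 h

lemma markLaw_eq_top (hπ : ∑' j : ℕ, (j : ℝ≥0∞) * π j ≤ 1) :
    markLaw π {c | c.2.1 = ⊤} = 1 - ∑' j : ℕ, (j : ℝ≥0∞) * π j := by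
  refine (markLaw_snd (Prod.fst ⁻¹' {⊤})).trans ?_
  rw [← PMF.toMeasure_map_apply Prod.fst _ _ measurable_fst (measurableSet_singleton _),
    specialMark_map_fst, PMF.toMeasure_apply_singleton _ _ (measurableSet_singleton _),
    specialOffspring_apply hπ, if_pos rfl]

lemma markMeasure_forall_mem (S : Finset Node) (C : Node → Set Mark) :
    markMeasure π {ω | ∀ u ∈ S, ω u ∈ C u} = ∏ u ∈ S, markLaw π (C u) :=
  Measure.infinitePi_pi (fun _ : Node => markLaw π) (s := S) (t := C)
    fun _ _ => MeasurableSet.of_discrete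

lemma ae_properMarks (hπ : ∑' j : ℕ, (j : ℝ≥0∞) * π j ≤ 1) :
    ∀ᵐ ω ∂markMeasure π, ProperMarks ω := by
  refine ae_all_iff.2 fun v => ?_
  set improper : Set (ℕ∞ × ℕ) := {x | ¬ (x.1 = ⊤ ∨ (x.2 : ℕ∞) < x.1)}
  have hv := markMeasure_forall_mem (π := π) {v} fun _ => {c | c.2 ∈ improper}
  simp only [Finset.mem_singleton, forall_eq, Finset.prod_singleton, markLaw_snd] at hv
  rw [ae_iff]
  refine hv.trans ?_
  rw [PMF.toMeasure_apply_eq_zero_iff _ MeasurableSet.of_discrete, Set.disjoint_left]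
  exact fun x hx himproper => himproper (eq_top_or_lt_of_mem_support_specialMark hπ hx)

lemma markMeasure_matches_le (hπ : ∑' j : ℕ, (j : ℝ≥0∞) * π j ≤ 1) (hS : IsExplored S d) :
    markMeasure π {ω | (hatTree ω).Matches S d} ≤ (boundary S d).card * ∏ u ∈ S, π (d u) := by
  calc markMeasure π {ω | (hatTree ω).Matches S d}
      ≤ markMeasure π (⋃ b ∈ boundary S d, {ω | ∀ u ∈ S, ω u ∈ spineMarks b u (d u)}) := by
        refine measure_mono_ae ?_
        filter_upwards [ae_properMarks hπ] with ω hω hm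
        obtain ⟨b, hb, h⟩ := exists_forall_mem_spineMarks hω hS hm
        exact Set.mem_iUnion₂.2 ⟨b, hb, h⟩
    _ ≤ ∑ b ∈ boundary S d, markMeasure π {ω | ∀ u ∈ S, ω u ∈ spineMarks b u (d u)} :=
        measure_biUnion_finset_le _ _
    _ ≤ ∑ _b ∈ boundary S d, ∏ u ∈ S, π (d u) := by
        refine Finset.sum_le_sum fun b _ => ?_
        rw [markMeasure_forall_mem S fun u => spineMarks b u (d u)]
        exact Finset.prod_le_prod' fun u _ => markLaw_spineMarks_le hπ b u (d u)
    _ = _ := by rw [Finset.sum_const, nsmul_eq_mul]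

lemma markMeasure_matches_top_le (hπ : ∑' j : ℕ, (j : ℝ≥0∞) * π j ≤ 1) (hv : v ∈ S) :
    markMeasure π {ω | (∀ u ∈ S, u ∈ (hatTree ω).nodes) ∧ (hatTree ω).outdeg v = ⊤ ∧
        ∀ u ∈ S, u ≠ v → (hatTree ω).outdeg u = d u} ≤
      (1 - ∑' j : ℕ, (j : ℝ≥0∞) * π j) * ∏ u ∈ S.erase v, π (d u) := by
  classical
  set C : Node → Set Mark := fun u =>
    if u = v then {c | c.2.1 = ⊤} else spineMarks v u (d u) with hC
  calc _ ≤ markMeasure π {ω | ∀ u ∈ S, ω u ∈ C u} := by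
        refine measure_mono fun ω ⟨hnodes, htop, hdeg⟩ u hu => ?_
        obtain ⟨hv_top, hspine⟩ := forall_mem_spineMarks_of_top htop hnodes hdeg
        rcases eq_or_ne u v with rfl | huv
        · simpa only [hC, if_true, Set.mem_ofPred_eq] using hv_top
        · simpa only [hC, if_neg huv] using hspine u hu huv
    _ = ∏ u ∈ S, markLaw π (C u) := markMeasure_forall_mem S C
    _ ≤ _ := by
        rw [← Finset.mul_prod_erase S _ hv]
        gcongr with u hu
        · simp only [hC, if_true]
          exact (markLaw_eq_top hπ).le
        · simp only [hC, if_neg (Finset.mem_erase.1 hu).1]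
          exact markLaw_spineMarks_le hπ v u (d u)

instance : MeasurableSpace Status := ⊤

instance : Countable Status :=
  Function.Injective.countable (f := fun s : Status => (match s with
    | .absent => 0 | .normal => 1 | .special => 2 : ℕ)) fun a b h => by
      cases a <;> cases b <;> simp_all

lemma measurable_status (v : Node) : Measurable fun ω : Node → Mark => status ω v := by
  induction v with
  | nil => exact measurable_const
  | cons i v ih =>
    have h : Measurable fun p : Status × Mark => childStatus p.1 p.2 i := Measurable.of_discrete
    exact h.comp (ih.prodMk (measurable_pi_apply v))

lemma measurable_hatTree_outdeg (v : Node) :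
    Measurable fun ω : Node → Mark => (hatTree ω).outdeg v := by
  simp only [hatTree_outdeg]
  have h : Measurable fun p : Status × Mark => p.1.outdeg p.2 := Measurable.of_discrete
  exact h.comp ((measurable_status v).prodMk (measurable_pi_apply v))

end HatTree

/-! ### The size-biased law of the first box -/

section SizeBiased

variable {w : ℕ → ℝ≥0} {Ω : ℕ → ℝ} {n : ℕ} {K : ℝ} {ε : ℝ≥0∞}

lemma tsum_mul_firstBox (hZ : boxZ (extWeight w) (n - 1) n ≠ 0) (i : Fin n) (f : ℕ → ℝ≥0∞) :
    ∑' k, f k * firstBox w n k = ∫⁻ y, f (y i) ∂boxMeasure w n := by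
  have hswap := lintegral_allocation_comp_perm hZ (Equiv.swap ⟨0, i.pos⟩ i) fun y => f (y i)
  simp only [Function.comp_apply, Equiv.swap_apply_right] at hswap
  calc ∑' k, f k * firstBox w n k
      = ∫⁻ k, f k ∂(firstBox w n).toMeasure := by
        rw [lintegral_countable']
        exact tsum_congr fun k => by rw [PMF.toMeasure_apply_singleton _ _ .of_discrete]
    _ = ∫⁻ y, f (y ⟨0, i.pos⟩) ∂boxMeasure w n := by
        rw [firstBox, ← PMF.toMeasure_map _ _ .of_discrete, lintegral_map .of_discrete .of_discrete]
        simp only [i.pos, dif_pos]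
    _ = _ := hswap

open Classical in
/-- The normalizing constant `∑_{k > K} k P(Y_1 = k)` of the law of `Y**`. -/
def sizeBiasedMass (w : ℕ → ℝ≥0) (n : ℕ) (K : ℝ) : ℝ≥0∞ :=
  ∑' k : ℕ, if K < (k : ℝ) then (k : ℝ≥0∞) * firstBox w n k else 0

lemma sizeBiasedMass_eq (hZ : boxZ (extWeight w) (n - 1) n ≠ 0) (i : Fin n) (K : ℝ) :
    sizeBiasedMass w n K =
      ∫⁻ y, {k : ℕ | K < k}.indicator (fun k => (k : ℝ≥0∞)) (y i) ∂boxMeasure w n := by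
  classical
  rw [← tsum_mul_firstBox hZ]
  exact tsum_congr fun k => by simp [Set.indicator_apply]

lemma sizeBiasedMass_le_one (hn : n ≠ 0) (hZ : boxZ (extWeight w) (n - 1) n ≠ 0) (K : ℝ) :
    sizeBiasedMass w n K ≤ 1 := by
  rw [sizeBiasedMass_eq hZ ⟨0, Nat.pos_of_ne_zero hn⟩]
  exact (lintegral_mono fun y => Set.indicator_le_self _ _ _).trans (lintegral_apply_le_one hn hZ _)

lemma sizeBiasedMass_mul_toMeasure (hn : n ≠ 0) (hZ : boxZ (extWeight w) (n - 1) n ≠ 0)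
    (h0 : sizeBiasedMass w n K ≠ 0) (i : Fin n) {B : Set ℕ} (hB : ∀ k ∈ B, K < (k : ℝ)) :
    sizeBiasedMass w n K * (sizeBiasedLarge w n K).toMeasure B =
      ∫⁻ y, B.indicator (fun k => (k : ℝ≥0∞)) (y i) ∂boxMeasure w n := by
  classical
  have htop : sizeBiasedMass w n K ≠ ∞ :=
    ne_top_of_le_ne_top ENNReal.one_ne_top (sizeBiasedMass_le_one hn hZ K)
  rw [PMF.toMeasure_apply_eq_tsum, ← ENNReal.tsum_mul_left, ← tsum_mul_firstBox hZ]
  refine tsum_congr fun k => ?_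
  by_cases hk : k ∈ B
  · rw [Set.indicator_of_mem hk, Set.indicator_of_mem hk, sizeBiasedLarge,
      proportionalTo_apply 0 h0 htop, if_pos (hB k hk)]
    exact ENNReal.mul_div_cancel h0 htop
  · simp [hk]

lemma sizeBiasedLarge_toMeasure_eq_zero (hn : n ≠ 0) (hZ : boxZ (extWeight w) (n - 1) n ≠ 0)
    (h0 : sizeBiasedMass w n K ≠ 0) :
    (sizeBiasedLarge w n K).toMeasure {k | (k : ℝ) ≤ K} = 0 := by
  have htop : sizeBiasedMass w n K ≠ ∞ :=
    ne_top_of_le_ne_top ENNReal.one_ne_top (sizeBiasedMass_le_one hn hZ K)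
  rw [PMF.toMeasure_apply_eq_zero_iff _ .of_discrete, Set.disjoint_left]
  intro k hk hk'
  refine hk ?_
  rw [sizeBiasedLarge, proportionalTo_apply 0 h0 htop, if_neg (not_lt.2 hk'), ENNReal.zero_div]

lemma natCast_mul_sizeBiasedMass (hZ : boxZ (extWeight w) (n - 1) n ≠ 0) (K : ℝ) :
    n * sizeBiasedMass w n K = ∫⁻ y, (largeBalls y K : ℝ≥0∞) ∂boxMeasure w n := by
  classical
  calc n * sizeBiasedMass w n K = ∑ _i : Fin n, sizeBiasedMass w n K := by simp
    _ = ∫⁻ y, ∑ i : Fin n, {k : ℕ | K < k}.indicator (fun k => (k : ℝ≥0∞)) (y i)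
          ∂boxMeasure w n := by
        rw [lintegral_finsetSum _ fun _ _ => .of_discrete]
        exact Finset.sum_congr rfl fun i _ => sizeBiasedMass_eq hZ i K
    _ = _ := by simp [largeBalls, Finset.sum_filter, Set.indicator_apply]

lemma natCast_mul_one_sub_le (hn : n ≠ 0) {q : ℝ≥0∞} (hq : q ≤ 1) {L : ℕ} {η : ℝ≥0}
    (h : |(L : ℝ) / n - (1 - q.toReal)| ≤ η) : n * (1 - q) ≤ L + n * η := by
  have hn' : (0 : ℝ) < n := by exact_mod_cast Nat.pos_of_ne_zero hn
  have hreal : n * (1 - q.toReal) ≤ L + n * η := by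
    have := (abs_le.1 h).1
    rw [neg_le_sub_iff_le_add, ← sub_le_iff_le_add, le_div_iff₀ hn'] at this
    linarith
  have hq' : q ≠ ∞ := ne_top_of_le_ne_top ENNReal.one_ne_top hq
  rw [← ENNReal.toReal_le_toReal (by finiteness) (by finiteness),
    ENNReal.toReal_add (by finiteness) (by finiteness)]
  simpa [ENNReal.toReal_sub_of_le hq] using hreal

lemma eventually_le_sizeBiasedMass (hnu : nu w < 1) (hΩ : IsThreshold w Ω) (hε : ε ≠ 0) :
    ∀ᶠ n in sizes w, 1 - nu w ≤ sizeBiasedMass w n (Ω n) + ε := by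
  have hε2 : 0 < ε / 2 := ENNReal.half_pos hε
  obtain ⟨η, hη0, hη⟩ := ENNReal.lt_iff_exists_nnreal_btwn.1 hε2
  have hlim := (hΩ.2 Ω hΩ.1 (fun _ => le_rfl) η (by exact_mod_cast hη0)).2
  filter_upwards [eventually_boxZ_ne_zero, hlim.eventually_le_const hε2] with n ⟨hn, hZ⟩ hbad
  set B : Set (Fin n → ℕ) :=
    {y | (η : ℝ) < |(largeBalls y (Ω n) : ℝ) / n - (1 - (nu w).toReal)|}
  have hpointwise : ∀ y : Fin n → ℕ,
      n * (1 - nu w) ≤ largeBalls y (Ω n) + (n * η + B.indicator (fun _ => (n : ℝ≥0∞)) y) := by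
    intro y
    by_cases hy : y ∈ B
    · rw [Set.indicator_of_mem hy, ← add_assoc]
      exact le_add_left (mul_le_of_le_one_right zero_le tsub_le_self)
    · rw [Set.indicator_of_notMem hy, add_zero]
      exact natCast_mul_one_sub_le hn hnu.le (not_lt.1 hy)
  have hmean : n * (1 - nu w) ≤
      n * sizeBiasedMass w n (Ω n) + (n * η + n * boxMeasure w n B) := by
    have := lintegral_mono (μ := boxMeasure w n) hpointwise
    rwa [lintegral_const, measure_univ, mul_one, lintegral_add_left .of_discrete,
      lintegral_add_left .of_discrete, lintegral_const, measure_univ, mul_one,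
      lintegral_indicator_const .of_discrete, ← natCast_mul_sizeBiasedMass hZ] at this
  rw [← mul_add, ← mul_add,
    ENNReal.mul_le_mul_iff_right (Nat.cast_ne_zero.2 hn) (by simp)] at hmean
  grw [hmean, hη, hbad, ENNReal.add_halves]

lemma eventually_sizeBiasedMass_ne_zero (hnu : nu w < 1) (hΩ : IsThreshold w Ω) :
    ∀ᶠ n in sizes w, sizeBiasedMass w n (Ω n) ≠ 0 := by
  have hpos : (0 : ℝ≥0∞) < 1 - nu w := tsub_pos_of_lt hnu
  filter_upwards [eventually_le_sizeBiasedMass hnu hΩ (ENNReal.half_pos hpos.ne').ne'] with n hn h0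
  rw [h0, zero_add] at hn
  exact absurd hn (not_le.2 (ENNReal.half_lt_self hpos.ne' (by finiteness)))

lemma eventually_natCast_mul_boxMeasure_lt_le (hΩ : Tendsto Ω (sizes w) atTop) (c : ℕ)
    (hε : ε ≠ 0) :
    ∀ᶠ n in sizes w, ∀ i, c * boxMeasure w n {y | Ω n < y i} ≤ ε := by
  obtain ⟨M, hM⟩ := ENNReal.exists_nat_gt (ENNReal.div_ne_top (ENNReal.natCast_ne_top c) hε)
  have hcM : (c : ℝ≥0∞) ≤ ε * M := by
    rw [mul_comm]
    exact (ENNReal.div_le_iff_le_mul (.inl hε) (.inr (zero_le.trans_lt hM).ne')).1 hM.le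
  filter_upwards [eventually_boxZ_ne_zero, hΩ.eventually_ge_atTop (M : ℝ)]
    with n ⟨hn, hZ⟩ hMΩ i
  have hsub : {y : Fin n → ℕ | Ω n < y i} ⊆ {y | (M : ℝ≥0∞) ≤ y i} := fun y (hy : Ω n < y i) => by
    exact_mod_cast (hMΩ.trans_lt hy).le
  have hmarkov := (mul_meas_ge_le_lintegral (μ := boxMeasure w n) .of_discrete (M : ℝ≥0∞)).trans
    (lintegral_apply_le_one hn hZ i)
  grw [hsub, hcM, mul_assoc, hmarkov, mul_one]

end SizeBiased

/-! ### Comparison for one pattern of outdegrees -/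

section Patterns

variable {w : ℕ → ℝ≥0} {Ω : ℕ → ℝ} {V S : Finset Node} {T T₀ : OrderedTree} {n : ℕ} {ε : ℝ≥0∞}

/-- `V` contains the parents of its nodes; such sets of nodes are large enough for their
outdegrees to tell which of the nodes belong to a tree. -/
def IsParentClosed (V : Finset Node) : Prop := ∀ i u, i :: u ∈ V → u ∈ V

/-- The nodes of `T` that belong to `V`. -/
def OrderedTree.inside (T : OrderedTree) (V : Finset Node) : Finset Node :=
  open Classical in V.filter (· ∈ T.nodes)

lemma OrderedTree.mem_inside {u : Node} : u ∈ T.inside V ↔ u ∈ V ∧ u ∈ T.nodes := by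
  simp [OrderedTree.inside]

lemma OrderedTree.mem_nodes_iff_of_outdeg_eq (hV : IsParentClosed V) {d : Node → ℕ∞}
    (hd : ∀ i u, i :: u ∈ V → ((i : ℕ∞) < d u ↔ i :: u ∈ T₀.nodes))
    (hT : ∀ u ∈ T₀.inside V, T.outdeg u = d u) {u : Node} (hu : u ∈ V) :
    u ∈ T.nodes ↔ u ∈ T₀.nodes := by
  induction u with
  | nil => exact iff_of_true T.root_mem T₀.root_mem
  | cons i u ih =>
    have huV := hV i u hu
    by_cases huT : u ∈ T₀.nodes
    · rw [OrderedTree.cons_mem_nodes_iff, hT u (OrderedTree.mem_inside.2 ⟨huV, huT⟩), hd i u hu]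
    · exact iff_of_false (fun h => huT ((ih huV).1 (T.parent_mem u i h)))
        fun h => huT (T₀.parent_mem u i h)

lemma OrderedTree.outdeg_eq_of_inside (hV : IsParentClosed V) {d : Node → ℕ∞}
    (hd : ∀ i u, i :: u ∈ V → ((i : ℕ∞) < d u ↔ i :: u ∈ T₀.nodes))
    (hd0 : ∀ u ∈ V, u ∉ T₀.nodes → d u = 0) (hT : ∀ u ∈ T₀.inside V, T.outdeg u = d u)
    {u : Node} (hu : u ∈ V) : T.outdeg u = d u := by
  by_cases h : u ∈ T₀.nodes
  · exact hT u (OrderedTree.mem_inside.2 ⟨hu, h⟩)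
  · rw [hd0 u hu h]
    exact OrderedTree.outdeg_eq_zero
      (mt (OrderedTree.mem_nodes_iff_of_outdeg_eq hV hd hT hu).1 h)

lemma OrderedTree.isExplored_inside (hV : IsParentClosed V) {d : Node → ℕ}
    (hd : ∀ i u, i :: u ∈ V → ((i : ℕ∞) < d u ↔ i :: u ∈ T₀.nodes)) :
    IsExplored (T₀.inside V) d := by
  intro v hv
  rw [OrderedTree.mem_inside] at hv
  cases v with
  | nil => exact .inl rfl
  | cons i u =>
    exact .inr ⟨i, u, rfl, OrderedTree.mem_inside.2 ⟨hV i u hv.1, T₀.parent_mem u i hv.2⟩,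
      by exact_mod_cast (hd i u hv.1).2 hv.2⟩

lemma exists_injOn_fin {κ : Type*} (J : Finset κ) (hJ : J.card < n) :
    ∃ e : κ → Fin n, Set.InjOn e J := by
  have : Nonempty (Fin n) := ⟨⟨0, by omega⟩⟩
  obtain ⟨e, -, he⟩ := J.finite_toSet.exists_injOn_of_encard_le (t := (Set.univ : Set (Fin n)))
    (by simpa [Set.encard_univ] using hJ.le)
  exact ⟨e, he⟩

lemma eventually_prod_offspring_le (hw0 : 0 < w 0) (hw2 : ∃ k, 2 ≤ k ∧ 0 < w k) (hnu : nu w < 1)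
    {κ : Type*} (J : Finset κ) (c : κ → ℕ) (hε : ε ≠ 0) :
    ∀ᶠ n in sizes w, ∀ e : κ → Fin n, Set.InjOn e J →
      ∏ j ∈ J, offspring w (c j) ≤ boxMeasure w n {y | ∀ j ∈ J, y (e j) = c j} + ε := by
  classical
  filter_upwards [eventually_prod_offspring_mul_lintegral_le hw0 hw2 hnu J c hε,
    sizes_le_atTop (eventually_gt_atTop J.card)] with n h hJn e he
  obtain ⟨i, -, hi⟩ := Finset.exists_mem_notMem_of_card_lt_card
    (s := J.image e) (t := Finset.univ) (by simpa using Finset.card_image_le.trans_lt hJn)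
  simpa using h e he i hi (fun _ => 1) fun _ => le_self_add

lemma eventually_markMeasure_matches_le (hw0 : 0 < w 0) (hw2 : ∃ k, 2 ≤ k ∧ 0 < w k)
    (hnu : nu w < 1) {d : Node → ℕ} (hS : IsExplored S d) (hε : ε ≠ 0) :
    ∀ᶠ n in sizes w, markMeasure (offspring w) {ω | (hatTree ω).Matches S d} ≤
      treeMeasure w n {T | T.Matches S d} + ε := by
  set q := (boundary S d).card
  have hε' : ε / q ≠ 0 := (ENNReal.div_pos hε (by finiteness)).ne'
  filter_upwards [eventually_boxZ_ne_zero, eventually_prod_offspring_le hw0 hw2 hnu S d hε',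
    sizes_le_atTop (eventually_gt_atTop S.card)] with n ⟨hn, hZ⟩ hprod hSn
  obtain ⟨e, he⟩ := exists_injOn_fin S hSn
  calc _ ≤ q * ∏ u ∈ S, offspring w (d u) :=
        markMeasure_matches_le ((tsum_mul_offspring hw0 hnu).trans_le hnu.le) hS
    _ ≤ q * boxMeasure w n {y | ∀ u ∈ S, y (e u) = d u} + q * (ε / q) := by
        grw [hprod e he, mul_add]
    _ ≤ _ := by grw [card_boundary_mul_boxMeasure_le hn hZ hS hSn he, ENNReal.mul_div_le]

lemma eventually_markMeasure_outdeg_eq_le (hw0 : 0 < w 0) (hw2 : ∃ k, 2 ≤ k ∧ 0 < w k)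
    (hnu : nu w < 1) (hV : IsParentClosed V) (hfin : ∀ u ∈ V, T₀.outdeg u ≠ ⊤) (hε : ε ≠ 0) :
    ∀ᶠ n in sizes w,
      markMeasure (offspring w) {ω | ∀ u ∈ V, (hatTree ω).outdeg u = T₀.outdeg u} ≤
        treeMeasure w n {T | ∀ u ∈ V, T.outdeg u = T₀.outdeg u} + ε := by
  set d : Node → ℕ := fun u => (T₀.outdeg u).toNat
  have hdeg : ∀ u ∈ V, (d u : ℕ∞) = T₀.outdeg u := fun u hu => ENat.natCast_toNat (hfin u hu)
  have hmatches : ∀ T : OrderedTree,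
      T.Matches (T₀.inside V) d ↔ ∀ u ∈ V, T.outdeg u = T₀.outdeg u := by
    have hinside : ∀ u ∈ T₀.inside V, (d u : ℕ∞) = T₀.outdeg u :=
      fun u hu => hdeg u (OrderedTree.mem_inside.1 hu).1
    refine fun T => ⟨fun hT u hu => ?_, fun hT u hu => ?_⟩
    · exact OrderedTree.outdeg_eq_of_inside hV
        (fun i u _ => (OrderedTree.cons_mem_nodes_iff i).symm)
        (fun u _ => OrderedTree.outdeg_eq_zero) (fun u hu => (hT u hu).trans (hinside u hu)) hu
    · rw [hT u (OrderedTree.mem_inside.1 hu).1, hinside u hu]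
  simp only [← hmatches]
  refine eventually_markMeasure_matches_le hw0 hw2 hnu
    (OrderedTree.isExplored_inside hV fun i u hu => ?_) hε
  rw [hdeg u (hV i u hu), OrderedTree.cons_mem_nodes_iff]

lemma setLIntegral_indicator_comp_eq_tsum {α : Type*} [MeasurableSpace α] {μ : Measure α}
    {X : α → ℕ} (hX : Measurable X) (A : Set α) (B : Set ℕ) (f : ℕ → ℝ≥0∞) :
    ∫⁻ a in A, B.indicator f (X a) ∂μ = ∑' k : B, f k * μ (A ∩ X ⁻¹' {(k : ℕ)}) := by
  rw [← lintegral_map (f := B.indicator f) .of_discrete hX, lintegral_countable',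
    tsum_subtype B fun k => f k * μ (A ∩ X ⁻¹' {k})]
  refine tsum_congr fun k => ?_
  rw [Measure.map_apply hX .of_discrete, Measure.restrict_apply (hX .of_discrete),
    Set.inter_comm]
  by_cases hk : k ∈ B <;> simp [hk]

lemma natCast_mul_boxMeasure_le (hn : n ≠ 0) (hZ : boxZ (extWeight w) (n - 1) n ≠ 0)
    {d : Node → ℕ} (hS : IsExplored S d) (hSn : S.card < n) {e : Node → Fin n}
    (he : Set.InjOn e S) {v : Node} (hv : v ∈ S) :
    d v * boxMeasure w n {y | ∀ u ∈ S, y (e u) = d u} ≤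
      treeMeasure w n {T | T.Matches S d} +
        S.card * boxMeasure w n {y | ∀ u ∈ S, y (e u) = d u} := by
  have hle : d v ≤ (boundary S d).card + S.card := by
    rw [hS.card_boundary]
    exact le_add_left (Finset.single_le_sum (fun _ _ => Nat.zero_le _) hv)
  have hle' : (d v : ℝ≥0∞) ≤ (boundary S d).card + S.card := by exact_mod_cast hle
  grw [hle', add_mul, card_boundary_mul_boxMeasure_le hn hZ hS hSn he]

/-- The vertex `v` of degree `k` accounts for nearly all the `k + O(1)` boundary nodes, so the
size-biasing of `Y**` is the factor `#boundary` of the cycle lemma. -/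
lemma setLIntegral_indicator_le_treeMeasure (hn : n ≠ 0) (hZ : boxZ (extWeight w) (n - 1) n ≠ 0)
    {v : Node} (hv : v ∈ S) {d : Node → ℕ} {B : Set ℕ}
    (hS : ∀ k ∈ B, IsExplored S (Function.update d v k)) (hSn : S.card < n) {e : Node → Fin n}
    (he : Set.InjOn e S) :
    ∫⁻ y in {y | ∀ u ∈ S.erase v, y (e u) = d u}, B.indicator (fun k => (k : ℝ≥0∞)) (y (e v))
        ∂boxMeasure w n ≤
      treeMeasure w n {T | ∃ k ∈ B, T.Matches S (Function.update d v k)} +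
        S.card * boxMeasure w n {y | y (e v) ∈ B} := by
  set A : ℕ → Set (Fin n → ℕ) := fun k => {y | ∀ u ∈ S, y (e u) = Function.update d v k u}
  have hA : ∀ k, {y | ∀ u ∈ S.erase v, y (e u) = d u} ∩ (fun y => y (e v)) ⁻¹' {k} = A k := by
    intro k
    ext y
    simp only [A, Set.mem_inter_iff, Set.mem_ofPred_eq, Set.mem_preimage, Set.mem_singleton_iff]
    conv_rhs => rw [← Finset.insert_erase hv, Finset.forall_mem_insert, Function.update_self]
    rw [and_comm]
    refine and_congr_right fun _ => forall₂_congr fun u hu => ?_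
    rw [Function.update_of_ne (Finset.ne_of_mem_erase hu)]
  have hA_apply : ∀ k, ∀ y ∈ A k, y (e v) = k := fun k y hy =>
    (hy v hv).trans (Function.update_self ..)
  have hT_apply : ∀ k (T : OrderedTree), T.Matches S (Function.update d v k) → T.outdeg v = k :=
    fun k T hT => (hT v hv).trans (by rw [Function.update_self])
  calc _ = ∑' k : B, (k : ℝ≥0∞) * boxMeasure w n (A k) := by
        rw [setLIntegral_indicator_comp_eq_tsum .of_discrete]
        simp only [hA]
    _ ≤ ∑' k : B, (treeMeasure w n {T | T.Matches S (Function.update d v k)} +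
          S.card * boxMeasure w n (A k)) := ENNReal.tsum_le_tsum fun k => by
        simpa using natCast_mul_boxMeasure_le hn hZ (hS k k.2) hSn he hv
    _ = treeMeasure w n (⋃ k : B, {T | T.Matches S (Function.update d v k)}) +
          S.card * boxMeasure w n (⋃ k : B, A k) := by
        rw [ENNReal.tsum_add, ENNReal.tsum_mul_left, measure_iUnion _ fun _ => .of_discrete,
          measure_iUnion _ fun _ => .of_discrete]
        · exact fun k k' hk => Set.disjoint_left.2 fun y hy hy' =>
            hk (Subtype.ext ((hA_apply k y hy).symm.trans (hA_apply k' y hy')))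
        · exact fun k k' hk => Set.disjoint_left.2 fun T hT hT' =>
            hk (Subtype.ext (by exact_mod_cast (hT_apply k T hT).symm.trans (hT_apply k' T hT')))
    _ ≤ _ := by
        gcongr
        · exact Set.iUnion_subset fun k T hT => ⟨k, k.2, hT⟩
        · exact Set.iUnion_subset fun k y hy =>
            Set.mem_ofPred_eq ▸ (hA_apply k y hy).symm ▸ k.2

lemma eventually_mul_sizeBiasedLarge_le (hw0 : 0 < w 0) (hw2 : ∃ k, 2 ≤ k ∧ 0 < w k)
    (hnu : nu w < 1) (hΩ : IsThreshold w Ω) {v : Node} (hv : v ∈ S) (d : Node → ℕ) (hε : ε ≠ 0) :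
    ∀ᶠ n in sizes w, ∀ B : Set ℕ, (∀ k ∈ B, Ω n < (k : ℝ)) →
      (∀ k ∈ B, IsExplored S (Function.update d v k)) →
      (1 - nu w) * (∏ u ∈ S.erase v, offspring w (d u)) *
          (sizeBiasedLarge w n (Ω n)).toMeasure B ≤
        treeMeasure w n {T | ∃ k ∈ B, T.Matches S (Function.update d v k)} + ε := by
  have hε3 : ε / 3 ≠ 0 := (ENNReal.div_pos hε (by simp)).ne'
  filter_upwards [eventually_boxZ_ne_zero,
    eventually_prod_offspring_mul_lintegral_le hw0 hw2 hnu (S.erase v) d hε3,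
    sizes_le_atTop (eventually_gt_atTop S.card), eventually_le_sizeBiasedMass hnu hΩ hε3,
    eventually_sizeBiasedMass_ne_zero hnu hΩ,
    eventually_natCast_mul_boxMeasure_lt_le hΩ.1 S.card hε3]
    with n ⟨hn, hZ⟩ hprod hSn hmass hmass0 hmarkov B hB hS
  obtain ⟨e, he⟩ := exists_injOn_fin S hSn
  have hev : e v ∉ (S.erase v).image e := by
    simp only [Finset.mem_image, not_exists, not_and]
    exact fun u hu huv =>
      Finset.ne_of_mem_erase hu (he (Finset.mem_of_mem_erase hu) hv huv)
  have hprod' := hprod e (he.mono (Finset.erase_subset v S)) (e v) hev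
    (B.indicator fun k => (k : ℝ≥0∞)) fun k => (Set.indicator_le_self _ _ k).trans le_add_self
  have hsub : {y : Fin n → ℕ | y (e v) ∈ B} ⊆ {y | Ω n < y (e v)} := fun y hy => hB _ hy
  set p := ∏ u ∈ S.erase v, offspring w (d u)
  set b := (sizeBiasedLarge w n (Ω n)).toMeasure B
  have hp : p ≤ 1 := Finset.prod_le_one' fun u _ => PMF.coe_le_one _ _
  have hpb : p * b ≤ 1 := mul_le_one' hp prob_le_one
  calc (1 - nu w) * p * b
      ≤ (sizeBiasedMass w n (Ω n) + ε / 3) * p * b := by gcongr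
    _ = p * (sizeBiasedMass w n (Ω n) * b) + ε / 3 * (p * b) := by ring
    _ ≤ p * (sizeBiasedMass w n (Ω n) * b) + ε / 3 := by grw [hpb, mul_one]
    _ ≤ treeMeasure w n {T | ∃ k ∈ B, T.Matches S (Function.update d v k)} +
          ε / 3 + ε / 3 + ε / 3 := by
        grw [sizeBiasedMass_mul_toMeasure hn hZ hmass0 (e v) hB, hprod',
          setLIntegral_indicator_le_treeMeasure hn hZ hv hS hSn he, hsub, hmarkov]
    _ = _ := by rw [add_assoc, add_assoc, ← add_assoc (ε / 3), ENNReal.add_thirds]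

lemma markMeasure_outdeg_eq_le (hw0 : 0 < w 0) (hnu : nu w < 1) (hV : IsParentClosed V)
    {v : Node} (hv : v ∈ T₀.inside V) (htop : ∀ u, T₀.outdeg u = ⊤ ↔ u = v) :
    markMeasure (offspring w) {ω | ∀ u ∈ V, (hatTree ω).outdeg u = T₀.outdeg u} ≤
      (1 - nu w) * ∏ u ∈ (T₀.inside V).erase v, offspring w (T₀.outdeg u).toNat := by
  rw [← tsum_mul_offspring hw0 hnu]
  refine le_trans (measure_mono fun ω hω => ?_)
    (markMeasure_matches_top_le ((tsum_mul_offspring hw0 hnu).trans_le hnu.le) hv)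
  have hinside : ∀ u ∈ T₀.inside V, (hatTree ω).outdeg u = T₀.outdeg u :=
    fun u hu => hω u (OrderedTree.mem_inside.1 hu).1
  refine ⟨fun u hu => ?_, (hinside v hv).trans ((htop v).2 rfl), fun u hu hne => ?_⟩
  · obtain ⟨huV, huT⟩ := OrderedTree.mem_inside.1 hu
    exact (OrderedTree.mem_nodes_iff_of_outdeg_eq hV
      (fun i u _ => (OrderedTree.cons_mem_nodes_iff i).symm) hinside huV).2 huT
  · rw [hinside u hu, ENat.natCast_toNat (mt (htop u).1 hne)]

lemma eventually_markMeasure_outdeg_eq_mul_le_of_top (hw0 : 0 < w 0)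
    (hw2 : ∃ k, 2 ≤ k ∧ 0 < w k) (hnu : nu w < 1) (hΩ : IsThreshold w Ω)
    (hV : IsParentClosed V) {v : Node} (hv : v ∈ V) (htop : ∀ u, T₀.outdeg u = ⊤ ↔ u = v)
    (hε : ε ≠ 0) :
    ∀ᶠ n in sizes w, ∀ B : Set ℕ, (∀ k ∈ B, Ω n < (k : ℝ)) →
      markMeasure (offspring w) {ω | ∀ u ∈ V, (hatTree ω).outdeg u = T₀.outdeg u} *
          (sizeBiasedLarge w n (Ω n)).toMeasure B ≤
        treeMeasure w n {T | ∃ k ∈ B, ∀ u ∈ V, T.outdeg u = T₀.modifiedOutdeg k u} + ε := by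
  set d : Node → ℕ := fun u => (T₀.outdeg u).toNat
  have hvin : v ∈ T₀.inside V := OrderedTree.mem_inside.2 ⟨hv, by
    by_contra h
    simpa [OrderedTree.outdeg_eq_zero h] using (htop v).2 rfl⟩
  have hmod : ∀ k u, T₀.modifiedOutdeg k u = (Function.update d v k u : ℕ) := by
    intro k u
    rcases eq_or_ne u v with rfl | hu
    · rw [OrderedTree.modifiedOutdeg, if_pos ((htop u).2 rfl), Function.update_self]
    · rw [OrderedTree.modifiedOutdeg, if_neg (mt (htop u).1 hu), Function.update_of_ne hu,
        ENat.natCast_toNat (mt (htop u).1 hu)]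
  set L : ℕ := V.sup fun u => u.headD 0
  have hchild : ∀ k, L < k → ∀ i u, i :: u ∈ V →
      ((i : ℕ∞) < (Function.update d v k u : ℕ) ↔ i :: u ∈ T₀.nodes) := by
    intro k hk i u hiu
    rw [← hmod, OrderedTree.cons_mem_nodes_iff, OrderedTree.modifiedOutdeg]
    split_ifs with h
    · have hi : i ≤ L := Finset.le_sup (f := fun u : Node => u.headD 0) hiu
      rw [h]
      exact iff_of_true (by exact_mod_cast hi.trans_lt hk) (ENat.natCast_lt_top i)
    · rfl
  filter_upwards [eventually_mul_sizeBiasedLarge_le hw0 hw2 hnu hΩ hvin d hε,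
    hΩ.1.eventually_gt_atTop (L : ℝ)] with n h hΩL B hB
  have hLB : ∀ k ∈ B, L < k := fun k hk => by exact_mod_cast hΩL.trans (hB k hk)
  refine (mul_le_mul_left (markMeasure_outdeg_eq_le hw0 hnu hV hvin htop) _).trans
    ((h B hB fun k hk => OrderedTree.isExplored_inside hV (hchild k (hLB k hk))).trans ?_)
  refine add_le_add_left (measure_mono ?_) ε
  rintro T ⟨k, hk, hT⟩
  refine ⟨k, hk, fun u hu => ?_⟩
  rw [hmod]
  refine OrderedTree.outdeg_eq_of_inside hV (hchild k (hLB k hk)) (fun u _ hu => ?_) hT hu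
  rw [← hmod, OrderedTree.modifiedOutdeg, OrderedTree.outdeg_eq_zero hu]
  simp

end Patterns

/-! ### Comparison of the laws -/

section Laws

variable {w : ℕ → ℝ≥0} {Ω : ℕ → ℝ} {V : Finset Node} {ε : ℝ≥0∞} {l : ℕ}

lemma exists_finset_measure_compl_le {α : Type*} [Countable α] [MeasurableSpace α]
    [MeasurableSingletonClass α] (μ : Measure α) [IsFiniteMeasure μ] (hε : ε ≠ 0) :
    ∃ s : Finset α, μ (s : Set α)ᶜ ≤ ε := by
  have hsum : ∑' a, μ {a} ≠ ∞ := by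
    rw [← measure_iUnion (fun a b hab => by simpa using hab) (measurableSet_singleton ·)]
    exact measure_ne_top _ _
  obtain ⟨s, hs⟩ :=
    ((ENNReal.tendsto_tsum_compl_atTop_zero hsum).eventually_le_const hε.bot_lt).exists
  refine ⟨s, le_trans ?_ hs⟩
  rw [← Set.biUnion_of_singleton (s : Set α)ᶜ]
  exact measure_biUnion_le μ (Set.to_countable _) _

lemma prod_measure_le_add_sum {α β γ : Type*} [MeasurableSpace α] [MeasurableSpace β]
    {μ : Measure α} {ν : Measure β} [IsProbabilityMeasure ν] {D : α → γ} {Δ : Finset γ}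
    {A : Set (α × β)} {N : Set β} {B : γ → Set β} (hN : ν N = 0)
    (hB : ∀ a b, (a, b) ∈ A → D a ∈ Δ → b ∉ N → b ∈ B (D a)) :
    μ.prod ν A ≤ μ (D ⁻¹' (Δ : Set γ)ᶜ) + ∑ δ ∈ Δ, μ (D ⁻¹' {δ}) * ν (B δ) := by
  have hsub : A ⊆ ((D ⁻¹' (Δ : Set γ)ᶜ) ×ˢ Set.univ ∪ ⋃ δ ∈ Δ, (D ⁻¹' {δ}) ×ˢ B δ) ∪
      Set.univ ×ˢ N := by
    rintro ⟨a, b⟩ hab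
    by_cases hb : b ∈ N
    · exact .inr ⟨trivial, hb⟩
    · by_cases ha : D a ∈ Δ
      · exact .inl (.inr (Set.mem_biUnion ha ⟨rfl, hB a b hab ha hb⟩))
      · exact .inl (.inl ⟨ha, trivial⟩)
  grw [hsub, measure_union_le, measure_union_le, measure_biUnion_finset_le]
  simp [Measure.prod_prod, hN]

/-- The outdegrees of `T` at the nodes of `V`. -/
def outdegOn (V : Finset Node) (T : OrderedTree) : V → ℕ∞ := fun u => T.outdeg u

/-- The degrees `δ` with `∞` replaced by `k`: this turns `d⁺` into `d⁺⁺`. -/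
def replaceTop (δ : V → ℕ∞) (k : ℕ) (u : V) : ℕ∞ :=
  open Classical in if δ u = ⊤ then (k : ℕ∞) else δ u

lemma replaceTop_outdegOn (T : OrderedTree) (k : ℕ) :
    replaceTop (outdegOn V T) k = fun u : V => T.modifiedOutdeg k u := rfl

lemma measurable_outdegOn_hatTree : Measurable fun ω => outdegOn V (hatTree ω) :=
  measurable_pi_lambda _ fun u => measurable_hatTree_outdeg u

lemma eq_of_replaceTop_eq {δ δ' : V → ℕ∞} {k k' : ℕ} (hk : ∀ u, (δ' u).toNat < k)
    (hk' : ∀ u, (δ u).toNat < k') (h : replaceTop δ k = replaceTop δ' k') : δ = δ' := by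
  funext u
  have hu := congrFun h u
  simp only [replaceTop] at hu
  split_ifs at hu with hδ hδ' hδ'
  · rw [hδ, hδ']
  · exact absurd (hk u) (by simp [← hu])
  · exact absurd (hk' u) (by simp [hu])
  · exact hu

lemma sum_measure_replaceTop_le {μ : Measure OrderedTree} {Δ : Finset (V → ℕ∞)} {B : Set ℕ}
    (hB : ∀ k ∈ B, ∀ δ ∈ Δ, ∀ u, (δ u).toNat < k) (A : Set (V → ℕ∞)) :
    ∑ δ ∈ Δ, μ {T | ∃ k ∈ B ∩ {k | replaceTop δ k ∈ A}, outdegOn V T = replaceTop δ k} ≤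
      μ {T | outdegOn V T ∈ A} := by
  rw [← measure_biUnion_finset _ fun _ _ => .of_discrete]
  · refine measure_mono (Set.iUnion₂_subset fun δ _ => ?_)
    rintro T ⟨k, hk, hT⟩
    rw [Set.mem_ofPred_eq, hT]
    exact hk.2
  · refine fun δ hδ δ' hδ' hne => Set.disjoint_left.2 ?_
    rintro T ⟨k, hk, hT⟩ ⟨k', hk', hT'⟩
    exact hne (eq_of_replaceTop_eq (hB k hk.1 δ' hδ') (hB k' hk'.1 δ hδ) (hT.symm.trans hT'))

lemma eventually_markMeasure_outdegOn_mul_le (hw0 : 0 < w 0) (hw2 : ∃ k, 2 ≤ k ∧ 0 < w k)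
    (hnu : nu w < 1) (hΩ : IsThreshold w Ω) (hV : IsParentClosed V) (δ : V → ℕ∞) (hε : ε ≠ 0) :
    ∀ᶠ n in sizes w, ∀ B : Set ℕ, (∀ k ∈ B, Ω n < (k : ℝ)) →
      markMeasure (offspring w) ((fun ω => outdegOn V (hatTree ω)) ⁻¹' {δ}) *
          (sizeBiasedLarge w n (Ω n)).toMeasure B ≤
        treeMeasure w n {T | ∃ k ∈ B, outdegOn V T = replaceTop δ k} + ε := by
  obtain hδ | ⟨ω₀, hω₀⟩ := ((fun ω => outdegOn V (hatTree ω)) ⁻¹' {δ}).eq_empty_or_nonempty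
  · simp [hδ]
  set T₀ := hatTree ω₀
  obtain rfl : outdegOn V T₀ = δ := hω₀
  have hset : (fun ω => outdegOn V (hatTree ω)) ⁻¹' {outdegOn V T₀} =
      {ω | ∀ u ∈ V, (hatTree ω).outdeg u = T₀.outdeg u} := by
    ext ω
    simp [outdegOn, funext_iff]
  simp only [replaceTop_outdegOn, hset]
  simp only [outdegOn, funext_iff, Subtype.forall]
  by_cases htop : ∃ v ∈ V, T₀.outdeg v = ⊤
  · obtain ⟨v, hv, htop⟩ := htop
    exact eventually_markMeasure_outdeg_eq_mul_le_of_top hw0 hw2 hnu hΩ hV hv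
      (fun u => ⟨fun hu => eq_of_outdeg_eq_top hu htop, fun hu => hu ▸ htop⟩) hε
  · push Not at htop
    filter_upwards [eventually_markMeasure_outdeg_eq_le hw0 hw2 hnu hV htop hε] with n hn B _
    obtain rfl | ⟨k, hk⟩ := B.eq_empty_or_nonempty
    · simp
    · refine (mul_le_of_le_one_right zero_le prob_le_one).trans (hn.trans ?_)
      refine add_le_add_left (measure_mono ?_) ε
      refine fun T hT => ⟨k, hk, fun u hu => ?_⟩
      rw [OrderedTree.modifiedOutdeg, if_neg (htop u hu), hT u hu]

lemma eventually_modifiedOutdeg_le (hw0 : 0 < w 0) (hw2 : ∃ k, 2 ≤ k ∧ 0 < w k)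
    (hnu : nu w < 1) (hΩ : IsThreshold w Ω) (hV : IsParentClosed V) (hε : ε ≠ 0) :
    ∀ᶠ n in sizes w, ∀ A : Set (V → ℕ∞),
      ((markMeasure (offspring w)).prod (sizeBiasedLarge w n (Ω n)).toMeasure)
          {p | (fun u : V => (hatTree p.1).modifiedOutdeg p.2 u) ∈ A} ≤
        treeMeasure w n {T | outdegOn V T ∈ A} + ε := by
  set H := markMeasure (offspring w)
  set D : (Node → Mark) → V → ℕ∞ := fun ω => outdegOn V (hatTree ω)
  obtain ⟨Δ, hΔ⟩ := exists_finset_measure_compl_le (H.map D) (ENNReal.half_pos hε).ne'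
  rw [Measure.map_apply measurable_outdegOn_hatTree .of_discrete] at hΔ
  have hε' : ε / 2 / Δ.card ≠ 0 :=
    (ENNReal.div_pos (ENNReal.half_pos hε).ne' (by finiteness)).ne'
  obtain ⟨M, hM⟩ : ∃ M : ℕ, ∀ δ ∈ Δ, ∀ u, (δ u).toNat ≤ M := by
    obtain ⟨M, hM⟩ := (Set.finite_range fun p : Δ × V => (p.1.1 p.2).toNat).bddAbove
    exact ⟨M, fun δ hδ u => hM ⟨(⟨δ, hδ⟩, u), rfl⟩⟩
  have hpattern := (eventually_all_finset Δ).2 fun δ _ =>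
    eventually_markMeasure_outdegOn_mul_le hw0 hw2 hnu hΩ hV δ hε'
  filter_upwards [eventually_boxZ_ne_zero, hpattern, eventually_sizeBiasedMass_ne_zero hnu hΩ,
    hΩ.1.eventually_ge_atTop (M : ℝ)] with n ⟨hn, hZ⟩ hpattern hmass0 hΩM A
  set Y := (sizeBiasedLarge w n (Ω n)).toMeasure
  set B : (V → ℕ∞) → Set ℕ := fun δ => {k | Ω n < (k : ℝ)} ∩ {k | replaceTop δ k ∈ A}
  have hlarge : ∀ k ∈ {k : ℕ | Ω n < k}, ∀ δ ∈ Δ, ∀ u, (δ u).toNat < k := fun k hk δ hδ u =>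
    (hM δ hδ u).trans_lt (by exact_mod_cast hΩM.trans_lt hk)
  calc _ ≤ H (D ⁻¹' (Δ : Set (V → ℕ∞))ᶜ) + ∑ δ ∈ Δ, H (D ⁻¹' {δ}) * Y (B δ) :=
        prod_measure_le_add_sum (sizeBiasedLarge_toMeasure_eq_zero hn hZ hmass0)
          fun _ _ hA _ hk => ⟨not_le.1 (Set.notMem_ofPred_iff.1 hk), hA⟩
    _ ≤ ε / 2 + ∑ δ ∈ Δ, (treeMeasure w n {T | ∃ k ∈ B δ, outdegOn V T = replaceTop δ k} +
          ε / 2 / Δ.card) :=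
        add_le_add hΔ (Finset.sum_le_sum fun δ hδ => hpattern δ hδ (B δ) fun k hk => hk.1)
    _ ≤ ε / 2 + (treeMeasure w n {T | outdegOn V T ∈ A} + ε / 2) := by
        rw [Finset.sum_add_distrib, Finset.sum_const, nsmul_eq_mul]
        grw [sum_measure_replaceTop_le hlarge A, ENNReal.mul_div_le]
    _ = _ := by rw [add_left_comm, ENNReal.add_halves]

lemma measurable_modifiedOutdeg (v : Fin l → Node) :
    Measurable fun (p : (Node → Mark) × ℕ) i => (hatTree p.1).modifiedOutdeg p.2 (v i) := by
  classical
  refine measurable_pi_lambda _ fun i => ?_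
  have hreplace : Measurable fun q : ℕ∞ × ℕ => if q.1 = ⊤ then (q.2 : ℕ∞) else q.1 :=
    .of_discrete
  exact hreplace.comp
    (((measurable_hatTree_outdeg (v i)).comp measurable_fst).prodMk measurable_snd)

lemma exists_isParentClosed (v : Fin l → Node) :
    ∃ V : Finset Node, IsParentClosed V ∧ ∀ i, v i ∈ V := by
  refine ⟨Finset.univ.biUnion fun i => (v i).tails.toFinset, fun j u h => ?_, fun i => ?_⟩
  · simp only [Finset.mem_biUnion, Finset.mem_univ, true_and, List.mem_toFinset,
      List.mem_tails] at h ⊢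
    obtain ⟨i, hi⟩ := h
    exact ⟨i, (List.suffix_cons j u).trans hi⟩
  · simp only [Finset.mem_biUnion, Finset.mem_univ, true_and, List.mem_toFinset, List.mem_tails]
    exact ⟨i, List.suffix_rfl⟩

lemma eventually_modifiedDegreeLaw_le (hw0 : 0 < w 0) (hw2 : ∃ k, 2 ≤ k ∧ 0 < w k)
    (hnu : nu w < 1) (hΩ : IsThreshold w Ω) (v : Fin l → Node) (hε : ε ≠ 0) :
    ∀ᶠ n in sizes w, ∀ A : Set (Fin l → ℕ∞),
      modifiedDegreeLaw w Ω v n A ≤ degreeLaw w v n A + ε := by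
  obtain ⟨V, hV, hv⟩ := exists_isParentClosed v
  filter_upwards [eventually_modifiedOutdeg_le hw0 hw2 hnu hΩ hV hε] with n hn A
  rw [modifiedDegreeLaw, Measure.map_apply (measurable_modifiedOutdeg v) .of_discrete,
    degreeLaw, PMF.toMeasure_map_apply _ _ _ .of_discrete .of_discrete]
  exact hn {δ | (fun i => δ ⟨v i, hv i⟩) ∈ A}

instance (v : Fin l → Node) (n : ℕ) : IsProbabilityMeasure (degreeLaw w v n) :=
  PMF.toMeasure.isProbabilityMeasure _

instance (Ω : ℕ → ℝ) (v : Fin l → Node) (n : ℕ) :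
    IsProbabilityMeasure (modifiedDegreeLaw w Ω v n) :=
  Measure.isProbabilityMeasure_map (measurable_modifiedOutdeg v).aemeasurable

end Laws

end SimplyGenerated

end

theorem mainTheorem12 (w : ℕ → ℝ≥0) (hw0 : 0 < w 0) (hw2 : ∃ k, 2 ≤ k ∧ 0 < w k)
    (hnu : SimplyGenerated.nu w < 1) :
    (∃ Ω : ℕ → ℝ, SimplyGenerated.IsThreshold w Ω) ∧
    ∀ Ω : ℕ → ℝ, SimplyGenerated.IsThreshold w Ω →
      ∀ (l : ℕ) (v : Fin l → SimplyGenerated.Node),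
        SimplyGenerated.ApproxEqual (SimplyGenerated.sizes w)
          (SimplyGenerated.degreeLaw w v) (SimplyGenerated.modifiedDegreeLaw w Ω v) :=
  ⟨SimplyGenerated.exists_isThreshold hw0 hw2 hnu, fun _ hΩ _ v =>
    SimplyGenerated.approxEqual_of_eventually_le _ _ fun _ hε =>
      (SimplyGenerated.eventually_modifiedDegreeLaw_le hw0 hw2 hnu hΩ v hε).mono
        fun _ h A _ => h A⟩
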